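/- **Setting.** $\Pi^D_1$ is the higher-order $\pi$-calculus with unary process parameterization. Its terms, taken up to $\alpha$-conversion, are $$T ::= 0 \mid X \mid a(X).T \mid \overline{a}T'.T \mid T\mid T' \mid (c)T \mid \langle X\rangle T \mid T\langle T'\rangle ,$$ where $a(X).T$ and $\overline{a}T'.T$ are input and output prefix, $(c)T$ is restriction, $\langle X\rangle T$ is parameterization (abstraction) and $T\langle T'\rangle$ is application; $\overline{a}T'$ stands for $\overline{a}T'.0$. All terms are well typed by the simple types $\sigma ::= \mathsf{proc}\mid\sigma\to\sigma'$: every name carries objects of one fixed type (with infinitely many names for each type), $0$, prefixes, parallel compositions and restrictions are of type $\mathsf{proc}$, as are their continuations and components, and abstractions have the type $\sigma\to\sigma'$. The terms of type $\mathsf{proc}$ are the non-parameterized processes. Structural congruence $\equiv$ is the least congruence such that $T\mid 0\equiv T$, parallel composition is associative and commutative, $(c)(d)T\equiv(d)(c)T$, $(c)\lambda.T\equiv 0$ if the prefix $\lambda$ has subject $c$, $(c)(T\mid T')\equiv (c)T\mid T'$ if $c\notin fn(T')$, and $(\langle X\rangle T)\langle K\rangle\equiv T\{K/X\}$. Transitions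 of closed processes are the usual ones: $a(X).T\xrightarrow{a(A)}T\{A/X\}$, $\overline{a}A.T\xrightarrow{\overline{a}A}T$, closure under parallel composition and restriction without name capture, extrusion $(d)T\xrightarrow{(d\tilde c)\overline{a}A}T'$ from $T\xrightarrow{(\tilde c)\overline{a}A}T'$ if $d\in fn(A)\setminus\{\tilde c,a\}$, communication $T_1\mid T_2\xrightarrow{\tau}(\tilde c)(T_1'\mid T_2')$ (and symmetrically) from $T_1\xrightarrow{a(A)}T_1'$ and $T_2\xrightarrow{(\tilde c)\overline{a}A}T_2'$, and closure under $\equiv$. Write $\Rightarrow$ for the reflexive transitive closure of $\xrightarrow{\tau}$, and $\stackrel{\lambda}{\Rightarrow}$ for $\Rightarrow\xrightarrow{\lambda}\Rightarrow$. A symmetric relation $\mathcal R$ on closed processes is a *context bisimulation* if $P\,\mathcal R\,Q$ implies: if $P\xrightarrow{\tau}P'$ then $Q\Rightarrow Q'$ with $P'\,\mathcal R\,Q'$ for some $Q'$; if $P\xrightarrow{a(A)}P'$ then $Q\stackrel{a(A)}{\Rightarrow}Q'$ with $P'\,\mathcal R\,Q'$ for some $Q'$; and if $P\xrightarrow{(\tilde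 c)\overline{a}A}P'$ then $Q\stackrel{(\tilde d)\overline{a}B}{\Rightarrow}Q'$ for some $\tilde d,B,Q'$ such that $(\tilde c)(E[A]\mid P')\,\mathcal R\,(\tilde d)(E[B]\mid Q')$ for every process $E[X]$ with $\{\tilde c,\tilde d\}\cap fn(E)=\emptyset$. Closed processes are context bisimilar ($P\approx Q$) if some context bisimulation relates them; closed terms $F,G$ of an abstraction type satisfy $F\approx G$ if $F\langle B\rangle\approx G\langle B\rangle$ for all closed $B$ of the argument type; open terms are related by $\approx$ if all their closed instances are. For an input prefix $\phi$ put $!\phi.P := (c)(Q_c\mid\overline{c}Q_c)$ with $Q_c := c(X).(\phi.(X\mid P)\mid\overline{c}X)$ and $c$, $X$ fresh. For a name $m$ put $Tr_m := \langle Z\rangle\overline{m}Z$. **Theorem (Factorization).** Let $\sigma$ be a type, let $X$ be a variable of type $\sigma\to\mathsf{proc}$, let $E=E[X]$ be a term of $\Pi^D_1$ (possibly with further free variables), let $A$ be a term of type $\sigma\to\mathsf{proc}$ in which $X$ is not free, and let $m$ be a name carrying objects of type $\sigma$ that is fresh for $E$ and $A$. 1. If $E[Tr_m]$ is a non-parameterized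 process, then $$E[A]\approx (m)(E[Tr_m]\mid\, !m(Z).A\langle Z\rangle).$$ 2. If $E[Tr_m]\equiv\langle Y_1\rangle\cdots\langle Y_k\rangle E'$ for some $k\ge 1$ and some non-parameterized process $E'$, where $Y_1,\dots,Y_k$ are not free in $A$, then $$E[A]\approx \langle Y_1\rangle\cdots\langle Y_k\rangle\,(m)(E'\mid\, !m(Z).A\langle Z\rangle).$$ -/

import Mathlib

/-!  The higher-order pi-calculus with unary process parameterization, in well-typed
de Bruijn form (terms are identified up to alpha-conversion and substitution never captures).

Types are the simple types over the type of processes. Every channel name has a sort, the type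
of the objects it carries, and there are infinitely many names of each sort: a name of
sort `σ` is a natural number. Restriction `(c)T` with `c` of sort `σ` binds the name `0` of
sort `σ` in `T`, and inside it the outer name `n` of sort `σ` is called `n + 1`
(names of the other sorts keep their number). -/

namespace PiD

/-- Types: processes, and abstractions from `a` to `b`. -/
inductive Ty : Type
  | proc : Ty
  | arr (a b : Ty) : Ty
  deriving DecidableEq

/-- Process variables of type `σ` in the variable context `Γ`. -/
inductive Var : List Ty → Ty → Type
  | zero {Γ : List Ty} {σ : Ty} : Var (σ :: Γ) σ
  | succ {Γ : List Ty} {σ τ : Ty} (x : Var Γ σ) : Var (τ :: Γ) σ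

/-- Well-typed terms with free variables in `Γ`. -/
inductive Tm : List Ty → Ty → Type
  /-- a variable `X` -/
  | var {Γ : List Ty} {σ : Ty} (x : Var Γ σ) : Tm Γ σ
  /-- the null process `0` -/
  | nil {Γ : List Ty} : Tm Γ Ty.proc
  /-- input prefix `a(X).T`, where `a` is the name number `a` of sort `σ` -/
  | inp {Γ : List Ty} (σ : Ty) (a : ℕ) (T : Tm (σ :: Γ) Ty.proc) : Tm Γ Ty.proc
  /-- output prefix: send `K` on `a` and continue as `T` -/
  | out {Γ : List Ty} (σ : Ty) (a : ℕ) (K : Tm Γ σ) (T : Tm Γ Ty.proc) : Tm Γ Ty.proc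
  /-- parallel composition -/
  | par {Γ : List Ty} (T T' : Tm Γ Ty.proc) : Tm Γ Ty.proc
  /-- restriction `(c)T` of a name `c` of sort `σ` -/
  | res {Γ : List Ty} (σ : Ty) (T : Tm Γ Ty.proc) : Tm Γ Ty.proc
  /-- parameterization (abstraction) `⟨X⟩T` -/
  | lam {Γ : List Ty} {σ τ : Ty} (T : Tm (σ :: Γ) τ) : Tm Γ (Ty.arr σ τ)
  /-- application `F⟨K⟩` -/
  | app {Γ : List Ty} {σ τ : Ty} (F : Tm Γ (Ty.arr σ τ)) (K : Tm Γ σ) : Tm Γ τ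

/-- Closed processes. -/
abbrev Proc : Type := Tm [] Ty.proc

/-! Name renamings (sort-preserving). -/

/-- A sort-preserving renaming of names. -/
abbrev Ren : Type := Ty → ℕ → ℕ

/-- Weakening of names past a binder of sort `d`. -/
def up (d : Ty) : Ren := fun s n => if s = d then n + 1 else n

/-- The renaming `ρ` under a binder of sort `d`. -/
def Ren.lift (ρ : Ren) (d : Ty) : Ren := fun s n =>
  if s = d then
    match n with
    | 0 => 0
    | k + 1 => ρ s k + 1
  else ρ s n

/-- The renaming `ρ` under a sequence of binders (listed from the outermost). -/
def Ren.lifts (ρ : Ren) : List Ty → Ren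
  | [] => ρ
  | d :: ds => Ren.lifts (ρ.lift d) ds

/-- Weakening of names past a sequence of binders. -/
def ups (ds : List Ty) : Ren := fun s n => n + ds.count s

/-- The renaming that moves a binder of sort `d` from outside the binders `cs` to inside them. -/
def exch (d : Ty) (cs : List Ty) : Ren := fun s n =>
  if s = d then
    if n < cs.count d then n + 1 else if n = cs.count d then 0 else n
  else n

/-- Renaming of the free names of a term. -/
def Tm.ren {Γ : List Ty} {τ : Ty} : Ren → Tm Γ τ → Tm Γ τ
  | _, .var x => .var x
  | _, .nil => .nil
  | ρ, .inp σ a T => .inp σ (ρ σ a) (T.ren ρ)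
  | ρ, .out σ a K T => .out σ (ρ σ a) (K.ren ρ) (T.ren ρ)
  | ρ, .par T T' => .par (T.ren ρ) (T'.ren ρ)
  | ρ, .res σ T => .res σ (T.ren (ρ.lift σ))
  | ρ, .lam T => .lam (T.ren ρ)
  | ρ, .app F K => .app (F.ren ρ) (K.ren ρ)

/-- `T.HasFn s n`: the name `n` of sort `s` belongs to `fn(T)`. -/
def Tm.HasFn {Γ : List Ty} {τ : Ty} : Tm Γ τ → Ty → ℕ → Prop
  | .var _, _, _ => False
  | .nil, _, _ => False
  | .inp σ a T, s, n => (σ = s ∧ a = n) ∨ T.HasFn s n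
  | .out σ a K T, s, n => (σ = s ∧ a = n) ∨ K.HasFn s n ∨ T.HasFn s n
  | .par T T', s, n => T.HasFn s n ∨ T'.HasFn s n
  | .res σ T, s, n => T.HasFn s (up σ s n)
  | .lam T, s, n => T.HasFn s n
  | .app F K, s, n => F.HasFn s n ∨ K.HasFn s n

/-! Variable renaming and higher-order substitution. -/

/-- Renamings of variables. -/
abbrev VRen (Γ Γ' : List Ty) : Type := (σ : Ty) → Var Γ σ → Var Γ' σ

/-- A variable renaming under a variable binder. -/
def VRen.lift {Γ Γ' : List Ty} (ξ : VRen Γ Γ') (ρ : Ty) : VRen (ρ :: Γ) (ρ :: Γ')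
  | _, .zero => .zero
  | _, .succ x => .succ (ξ _ x)

/-- Renaming of the free variables of a term. -/
def Tm.vren {Γ Γ' : List Ty} {τ : Ty} : VRen Γ Γ' → Tm Γ τ → Tm Γ' τ
  | ξ, .var x => .var (ξ _ x)
  | _, .nil => .nil
  | ξ, .inp σ a T => .inp σ a (T.vren (ξ.lift σ))
  | ξ, .out σ a K T => .out σ a (K.vren ξ) (T.vren ξ)
  | ξ, .par T T' => .par (T.vren ξ) (T'.vren ξ)
  | ξ, .res σ T => .res σ (T.vren ξ)
  | ξ, .lam T => .lam (T.vren (ξ.lift _))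
  | ξ, .app F K => .app (F.vren ξ) (K.vren ξ)

/-- Weakening by one variable. -/
def Tm.wk {Γ : List Ty} {τ : Ty} (ρ : Ty) (T : Tm Γ τ) : Tm (ρ :: Γ) τ :=
  T.vren (fun _ x => Var.succ x)

/-- Simultaneous substitutions of terms for variables. -/
abbrev Sub (Γ Γ' : List Ty) : Type := (σ : Ty) → Var Γ σ → Tm Γ' σ

/-- A substitution under a variable binder. -/
def Sub.lift {Γ Γ' : List Ty} (θ : Sub Γ Γ') (ρ : Ty) : Sub (ρ :: Γ) (ρ :: Γ')
  | _, .zero => .var .zero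
  | _, .succ x => (θ _ x).wk ρ

/-- A substitution under a name binder. -/
def Sub.up {Γ Γ' : List Ty} (θ : Sub Γ Γ') (d : Ty) : Sub Γ Γ' :=
  fun σ x => (θ σ x).ren (PiD.up d)

/-- Capture-avoiding higher-order substitution. -/
def Tm.sub {Γ Γ' : List Ty} {τ : Ty} : Sub Γ Γ' → Tm Γ τ → Tm Γ' τ
  | θ, .var x => θ _ x
  | _, .nil => .nil
  | θ, .inp σ a T => .inp σ a (T.sub (θ.lift σ))
  | θ, .out σ a K T => .out σ a (K.sub θ) (T.sub θ)
  | θ, .par T T' => .par (T.sub θ) (T'.sub θ)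
  | θ, .res σ T => .res σ (T.sub (θ.up σ))
  | θ, .lam T => .lam (T.sub (θ.lift _))
  | θ, .app F K => .app (F.sub θ) (K.sub θ)

/-- The substitution of `A` for the variable bound last, identity on the others. -/
def Sub.single {Γ : List Ty} {σ : Ty} (A : Tm Γ σ) : Sub (σ :: Γ) Γ
  | _, .zero => A
  | _, .succ x => .var x

/-- `E.inst A` is `E[A]`, where `E = E[X]` and `X` is the variable bound last. -/
def Tm.inst {Γ : List Ty} {σ τ : Ty} (E : Tm (σ :: Γ) τ) (A : Tm Γ σ) : Tm Γ τ :=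
  E.sub (Sub.single A)

/-- `(c₁)⋯(cₙ)T`. -/
def Tm.ress {Γ : List Ty} : List Ty → Tm Γ Ty.proc → Tm Γ Ty.proc
  | [], T => T
  | d :: ds, T => .res d (Tm.ress ds T)

/-! Structural congruence and the transition system. -/

/-- Structural congruence `≡`: the least congruence with the laws below. -/
inductive Struct : {Γ : List Ty} → {τ : Ty} → Tm Γ τ → Tm Γ τ → Prop
  | refl {Γ : List Ty} {τ : Ty} (T : Tm Γ τ) : Struct T T
  | symm {Γ : List Ty} {τ : Ty} {T T' : Tm Γ τ} : Struct T T' → Struct T' T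
  | trans {Γ : List Ty} {τ : Ty} {T T' T'' : Tm Γ τ} :
      Struct T T' → Struct T' T'' → Struct T T''
  | inp {Γ : List Ty} (σ : Ty) (a : ℕ) {T T' : Tm (σ :: Γ) Ty.proc} :
      Struct T T' → Struct (.inp σ a T) (.inp σ a T')
  | out {Γ : List Ty} (σ : Ty) (a : ℕ) {K K' : Tm Γ σ} {T T' : Tm Γ Ty.proc} :
      Struct K K' → Struct T T' → Struct (.out σ a K T) (.out σ a K' T')
  | par {Γ : List Ty} {T₁ T₁' T₂ T₂' : Tm Γ Ty.proc} :
      Struct T₁ T₁' → Struct T₂ T₂' → Struct (.par T₁ T₂) (.par T₁' T₂')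
  | res {Γ : List Ty} (σ : Ty) {T T' : Tm Γ Ty.proc} :
      Struct T T' → Struct (.res σ T) (.res σ T')
  | lam {Γ : List Ty} {σ τ : Ty} {T T' : Tm (σ :: Γ) τ} :
      Struct T T' → Struct (.lam T) (.lam T')
  | app {Γ : List Ty} {σ τ : Ty} {F F' : Tm Γ (Ty.arr σ τ)} {K K' : Tm Γ σ} :
      Struct F F' → Struct K K' → Struct (.app F K) (.app F' K')
  | par_nil {Γ : List Ty} (T : Tm Γ Ty.proc) : Struct (.par T .nil) T
  | par_assoc {Γ : List Ty} (T T' T'' : Tm Γ Ty.proc) :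
      Struct (.par T (.par T' T'')) (.par (.par T T') T'')
  | par_comm {Γ : List Ty} (T T' : Tm Γ Ty.proc) : Struct (.par T T') (.par T' T)
  | res_comm {Γ : List Ty} (c d : Ty) (T : Tm Γ Ty.proc) :
      Struct (.res c (.res d T)) (.res d (.res c (T.ren (exch c [d]))))
  | res_inp {Γ : List Ty} (c : Ty) (T : Tm (c :: Γ) Ty.proc) :
      Struct (.res c (.inp c 0 T)) .nil
  | res_out {Γ : List Ty} (c : Ty) (K : Tm Γ c) (T : Tm Γ Ty.proc) :
      Struct (.res c (.out c 0 K T)) .nil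
  | res_par {Γ : List Ty} (c : Ty) (T T' : Tm Γ Ty.proc) :
      Struct (.res c (.par T (T'.ren (up c)))) (.par (.res c T) T')
  | beta {Γ : List Ty} {σ τ : Ty} (T : Tm (σ :: Γ) τ) (K : Tm Γ σ) :
      Struct (.app (.lam T) K) (T.inst K)

/-- Actions: `τ`, the input `a(A)`, and the output of `A` on `a` with the extruded names
`cs` (given by their sorts, outermost first), which are binders for `A` but not for `a`. -/
inductive Act : Type
  | tau : Act
  | inp (σ : Ty) (a : ℕ) (A : Tm [] σ) : Act
  | out (cs : List Ty) (σ : Ty) (a : ℕ) (A : Tm [] σ) : Act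

/-- The bound names of an action. They are binders for the derivative as well. -/
def Act.bn : Act → List Ty
  | .tau => []
  | .inp _ _ _ => []
  | .out cs _ _ _ => cs

/-- Renaming of the free names of an action. The actions in which the name bound by a restriction
of sort `d` does not occur are the actions `act.ren (up d)`. -/
def Act.ren (ρ : Ren) : Act → Act
  | .tau => .tau
  | .inp σ a A => .inp σ (ρ σ a) (A.ren ρ)
  | .out cs σ a A => .out cs σ (ρ σ a) (A.ren (ρ.lifts cs))

/-- Labelled transitions of closed processes. In `Step T act T'` the derivative `T'` lives under the
binders `act.bn`. -/
inductive Step : Proc → Act → Proc → Prop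
  | inp (σ : Ty) (a : ℕ) (T : Tm [σ] Ty.proc) (A : Tm [] σ) :
      Step (.inp σ a T) (.inp σ a A) (T.inst A)
  | out (σ : Ty) (a : ℕ) (A : Tm [] σ) (T : Proc) :
      Step (.out σ a A T) (.out [] σ a A) T
  | res (d : Ty) {T T' : Proc} (act : Act) :
      Step T (act.ren (up d)) T' → Step (.res d T) act (.res d (T'.ren (exch d act.bn)))
  | opn (d : Ty) {T T' : Proc} (cs : List Ty) (σ : Ty) (a : ℕ) (A : Tm [] σ) :
      Step T (.out cs σ (up d σ a) A) T' → A.HasFn d (cs.count d) →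
      Step (.res d T) (.out (d :: cs) σ a A) T'
  | parL {T T' : Proc} (act : Act) (T₁ : Proc) :
      Step T act T' → Step (.par T T₁) act (.par T' (T₁.ren (ups act.bn)))
  | parR {T T' : Proc} (act : Act) (T₁ : Proc) :
      Step T act T' → Step (.par T₁ T) act (.par (T₁.ren (ups act.bn)) T')
  | comL {T₁ T₁' T₂ T₂' : Proc} (cs : List Ty) (σ : Ty) (a : ℕ) (A : Tm [] σ) :
      Step (T₁.ren (ups cs)) (.inp σ (ups cs σ a) A) T₁' → Step T₂ (.out cs σ a A) T₂' →
      Step (.par T₁ T₂) .tau (Tm.ress cs (.par T₁' T₂'))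
  | comR {T₁ T₁' T₂ T₂' : Proc} (cs : List Ty) (σ : Ty) (a : ℕ) (A : Tm [] σ) :
      Step T₁ (.out cs σ a A) T₁' → Step (T₂.ren (ups cs)) (.inp σ (ups cs σ a) A) T₂' →
      Step (.par T₁ T₂) .tau (Tm.ress cs (.par T₁' T₂'))
  | struct {T T₁ T₂ T' : Proc} (act : Act) :
      Struct T T₁ → Step T₁ act T₂ → Struct T₂ T' → Step T act T'

/-- The reflexive transitive closure of the internal transitions. -/
def Taus : Proc → Proc → Prop := Relation.ReflTransGen (fun P Q => Step P .tau Q)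

/-- Weak transitions. -/
def WStep (P : Proc) (act : Act) (Q : Proc) : Prop :=
  ∃ P₁ P₂, Taus P P₁ ∧ Step P₁ act P₂ ∧ Taus P₂ Q

/-! Context bisimilarity. -/

/-- Context bisimulations on closed processes. -/
structure IsContextBisim (R : Proc → Proc → Prop) : Prop where
  symm : ∀ P Q, R P Q → R Q P
  tau : ∀ P Q P', R P Q → Step P .tau P' → ∃ Q', Taus Q Q' ∧ R P' Q'
  inp : ∀ P Q P' (σ : Ty) (a : ℕ) (A : Tm [] σ), R P Q → Step P (.inp σ a A) P' →
    ∃ Q', WStep Q (.inp σ a A) Q' ∧ R P' Q'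
  out : ∀ P Q P' (cs : List Ty) (σ : Ty) (a : ℕ) (A : Tm [] σ), R P Q →
    Step P (.out cs σ a A) P' →
    ∃ (ds : List Ty) (B : Tm [] σ) (Q' : Proc), WStep Q (.out ds σ a B) Q' ∧
      ∀ E : Tm [σ] Ty.proc,
        R (Tm.ress cs (.par ((E.ren (ups cs)).inst A) P'))
          (Tm.ress ds (.par ((E.ren (ups ds)).inst B) Q'))

/-- Context bisimilarity of closed processes. -/
def BisimProc (P Q : Proc) : Prop := ∃ R, IsContextBisim R ∧ R P Q

/-- Context bisimilarity of closed terms: abstractions are compared on all closed arguments. -/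
def BisimClosed : {τ : Ty} → Tm [] τ → Tm [] τ → Prop
  | .proc, P, Q => BisimProc P Q
  | .arr σ _, F, G => ∀ B : Tm [] σ, BisimClosed (.app F B) (.app G B)

/-- Context bisimilarity `≈` of arbitrary terms: all closed instances are compared. -/
def Bisim {Γ : List Ty} {τ : Ty} (T T' : Tm Γ τ) : Prop :=
  ∀ θ : Sub Γ [], BisimClosed (T.sub θ) (T'.sub θ)

/-! Triggers, replication, and iterated parameterization. -/

/-- The trigger `⟨Z⟩` followed by the output of `Z` on `m`, for a name `m` of sort `σ`. -/
def trig {Γ : List Ty} (σ : Ty) (m : ℕ) : Tm Γ (Ty.arr σ Ty.proc) :=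
  .lam (.out σ m (.var .zero) .nil)

/-- The process `Q_c = c(X).(m(Z).(X | P) | c̄X)` in the scope of a fresh name `c` (which is
the name `0` of the sort of processes), for `P` with the variable `Z` bound last. -/
def repQ {Γ : List Ty} (σ : Ty) (m : ℕ) (P : Tm (σ :: Γ) Ty.proc) : Tm Γ Ty.proc :=
  .inp .proc 0 (.par
    (.inp σ (up .proc σ m) (.par (.var (.succ .zero))
      ((P.ren (up .proc)).vren (VRen.lift (fun _ x => Var.succ x) σ))))
    (.out .proc 0 (.var .zero) .nil))

/-- The replication `!m(Z).P = (c)(Q_c | c̄Q_c)`. -/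
def rep {Γ : List Ty} (σ : Ty) (m : ℕ) (P : Tm (σ :: Γ) Ty.proc) : Tm Γ Ty.proc :=
  .res .proc (.par (repQ σ m P) (.out .proc 0 (repQ σ m P) .nil))

/-- The replicated trigger handler `!m(Z).A⟨Z⟩`. -/
def handler {Γ : List Ty} (σ : Ty) (m : ℕ) (A : Tm Γ (Ty.arr σ Ty.proc)) : Tm Γ Ty.proc :=
  rep σ m (.app (A.wk σ) (.var .zero))

/-- The type `ρ₁ → ⋯ → ρₖ → proc`. -/
def arrs : List Ty → Ty
  | [] => .proc
  | ρ :: ρs => .arr ρ (arrs ρs)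

/-- The context `Γ` extended by variables of types `ρ₁, …, ρₖ`, bound in this order. -/
def ext : List Ty → List Ty → List Ty
  | [], Γ => Γ
  | ρ :: ρs, Γ => ext ρs (ρ :: Γ)

/-- `⟨Y₁⟩⋯⟨Yₖ⟩T`. -/
def lams : (ρs : List Ty) → {Γ : List Ty} → Tm (ext ρs Γ) Ty.proc → Tm Γ (arrs ρs)
  | [], _, T => T
  | _ :: ρs, _, T => .lam (lams ρs T)

/-- Weakening by the variables `Y₁, …, Yₖ`. -/
def wks : (ρs : List Ty) → {Γ : List Ty} → {τ : Ty} → Tm Γ τ → Tm (ext ρs Γ) τ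
  | [], _, _, T => T
  | ρ :: ρs, _, _, T => wks ρs (T.wk ρ)

end PiD

/-! Fix a closed `A`. The relation `Factors A` pairs, up to `≡`, each `E[A]` with the processes
`(m)(E[Tr_m] | H)`, where `E` ranges over all contexts in one variable and `H` is one of the two
states of the handler. Its symmetric closure is a context bisimulation. A transition of `E[A]`
either belongs to `E` or goes through a copy of `A` at an exposed application `X⟨K⟩`. In the
factored process that application is an output of `K` on `m`, and the handler answers it on the
private name `m` by `A⟨K⟩`. Unfolding exposed copies is therefore matched by internal moves
(`Unfold.weak`), after which the transition belongs to the unfolded context and both sides can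
perform it. Conversely, a move of the factored process is a move of `E`, which `E[A]` shares, or it
is the handler getting ready or answering a trigger, which `E[A]` matches by no move at all. The
test context of an output is absorbed into `E`.

The obstacle is that transitions are closed under `≡`, which contains β at every type and in every
position, so they cannot be inverted on the syntax. The system `InpT`, `OutT`, `TauT` does without
`≡`: it only performs weak head reductions, inputs are late, outputs extrude every restricted name
they cross, and terms may be open, an exposed `X⟨K⟩` counting as an output on `X`. That `≡` is a
bisimulation for this system (`Struct.simulated`) is proved by a logical relation, since a
derivation of `P ≡ Q` may rewrite abstractions inside applications. Outputs are compared through the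
contexts receiving them, which hides differences in the extruded names. `Step.matches` translates
labelled transitions into this system; `InpT.step`, `OutT.exists_step` and `TauT.step` translate
back.

Abstractions reduce to processes by application to closed arguments, which become part of `E`. -/

namespace PiD

/-! Renaming of names. -/

theorem Ren.lift_id (d : Ty) : Ren.lift (fun _ n => n) d = fun _ n => n := by
  funext s n
  unfold Ren.lift
  split
  · cases n <;> rfl
  · rfl

theorem Ren.lift_comp (ρ ρ' : Ren) (d : Ty) :
    (fun s n => ρ'.lift d s (ρ.lift d s n)) = Ren.lift (fun s n => ρ' s (ρ s n)) d := by
  funext s n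
  unfold Ren.lift
  split
  · cases n <;> rfl
  · rfl

theorem Ren.lift_up (ρ : Ren) (d s : Ty) (n : ℕ) : ρ.lift d s (up d s n) = up d s (ρ s n) := by
  unfold Ren.lift up
  split <;> rfl

theorem Tm.ren_id {Γ : List Ty} {τ : Ty} (T : Tm Γ τ) : T.ren (fun _ n => n) = T := by
  induction T <;> simp_all [Tm.ren, Ren.lift_id]

theorem Tm.ren_ren {Γ : List Ty} {τ : Ty} (T : Tm Γ τ) (ρ ρ' : Ren) :
    (T.ren ρ).ren ρ' = T.ren (fun s n => ρ' s (ρ s n)) := by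
  induction T generalizing ρ ρ' <;> simp_all [Tm.ren, Ren.lift_comp]

theorem ups_nil : ups [] = fun _ n => n := by
  funext s n; simp [ups]

theorem ups_cons (d : Ty) (ds : List Ty) :
    ups (d :: ds) = fun s n => ups ds s (up d s n) := by
  funext s n
  simp only [ups, up, List.count_cons]
  by_cases h : s = d
  · subst h; simp; omega
  · have : (d == s) = false := by simpa using fun e => h e.symm
    simp [h, this]

theorem Ren.lifts_ups (ρ : Ren) (ds : List Ty) (s : Ty) (n : ℕ) :
    ρ.lifts ds s (ups ds s n) = ups ds s (ρ s n) := by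
  induction ds generalizing ρ n with
  | nil => simp [Ren.lifts, ups_nil]
  | cons d ds ih => simp only [Ren.lifts, ups_cons]; rw [ih, Ren.lift_up]

theorem exch_nil (d : Ty) : exch d [] = fun _ n => n := by
  funext s n
  cases n <;> simp [exch]

theorem up_inj (d s : Ty) : Function.Injective (up d s) := by
  intro a b h
  unfold up at h
  split at h <;> omega

theorem ups_inj (ds : List Ty) (s : Ty) : Function.Injective (ups ds s) := by
  intro a b h
  unfold ups at h
  omega

theorem Ren.lift_inj {ρ : Ren} (h : ∀ s, Function.Injective (ρ s)) (d s : Ty) :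
    Function.Injective (ρ.lift d s) := by
  intro a b e
  unfold Ren.lift at e
  split at e
  · cases a <;> cases b <;> simp at e ⊢
    exact h s e
  · exact h s e

/-- Only the bound name `0` of sort `d` lies outside the range of `up d`, and a lifted renaming
sends no other name of that sort to it. This lets transitions under a restriction be pulled back
along a renaming. -/
theorem Ren.lift_eq_up {ρ : Ren} {d s : Ty} {n a : ℕ} (e : ρ.lift d s n = up d s a) :
    ∃ k, n = up d s k ∧ ρ s k = a := by
  unfold Ren.lift up at *
  split at e
  · cases n with
    | zero => simp at e
    | succ k => exact ⟨k, by simp [*], by simpa using e⟩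
  · exact ⟨n, by simp [*], e⟩

/-! Renaming of variables and substitution. -/

theorem VRen.lift_comp {Γ Γ' Γ'' : List Ty} (ξ : VRen Γ Γ') (ξ' : VRen Γ' Γ'') (ρ : Ty) :
    (fun s x => ξ'.lift ρ s (ξ.lift ρ s x)) = VRen.lift (fun s x => ξ' s (ξ s x)) ρ := by
  funext s x; cases x <;> rfl

theorem Tm.vren_vren {Γ Γ' Γ'' : List Ty} {τ : Ty} (T : Tm Γ τ) (ξ : VRen Γ Γ')
    (ξ' : VRen Γ' Γ'') : (T.vren ξ).vren ξ' = T.vren (fun s x => ξ' s (ξ s x)) := by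
  induction T generalizing Γ' Γ'' <;> simp_all [Tm.vren, VRen.lift_comp]

theorem Tm.vren_ren {Γ Γ' : List Ty} {τ : Ty} (T : Tm Γ τ) (ξ : VRen Γ Γ') (ρ : Ren) :
    (T.vren ξ).ren ρ = (T.ren ρ).vren ξ := by
  induction T generalizing Γ' ρ <;> simp_all [Tm.vren, Tm.ren]

theorem Tm.wk_ren {Γ : List Ty} {τ : Ty} (T : Tm Γ τ) (σ : Ty) (ρ : Ren) :
    (T.wk σ).ren ρ = (T.ren ρ).wk σ := T.vren_ren _ ρ

theorem Tm.wk_vren_lift {Γ Γ' : List Ty} {τ : Ty} (T : Tm Γ τ) (ξ : VRen Γ Γ') (σ : Ty) :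
    (T.wk σ).vren (ξ.lift σ) = (T.vren ξ).wk σ := by
  simp only [Tm.wk, Tm.vren_vren]; rfl

/-- Renaming of the names in a substitution. -/
def Sub.ren {Γ Γ' : List Ty} (θ : Sub Γ Γ') (ρ : Ren) : Sub Γ Γ' := fun s x => (θ s x).ren ρ

theorem Sub.up_eq {Γ Γ' : List Ty} (θ : Sub Γ Γ') (d : Ty) : θ.up d = θ.ren (PiD.up d) := rfl

theorem Sub.ren_lift {Γ Γ' : List Ty} (θ : Sub Γ Γ') (ρ : Ren) (σ : Ty) :
    (θ.ren ρ).lift σ = (θ.lift σ).ren ρ := by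
  funext s x
  cases x with
  | zero => rfl
  | succ x => exact (Tm.wk_ren _ _ _).symm

theorem Sub.ren_ren {Γ Γ' : List Ty} (θ : Sub Γ Γ') (ρ ρ' : Ren) :
    (θ.ren ρ).ren ρ' = θ.ren (fun s n => ρ' s (ρ s n)) := by
  funext s x; exact Tm.ren_ren _ _ _

theorem Sub.ren_up {Γ Γ' : List Ty} (θ : Sub Γ Γ') (ρ : Ren) (d : Ty) :
    (θ.ren ρ).up d = (θ.up d).ren (ρ.lift d) := by
  simp only [Sub.up_eq, Sub.ren_ren, Ren.lift_up]

/-- Substitution weakens names when it passes a restriction, so the `res` case rests on `ρ.lift d`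
commuting with `up d`. -/
theorem Tm.sub_ren {Γ Γ' : List Ty} {τ : Ty} (T : Tm Γ τ) (θ : Sub Γ Γ') (ρ : Ren) :
    (T.sub θ).ren ρ = (T.ren ρ).sub (θ.ren ρ) := by
  induction T generalizing Γ' ρ with
  | var x => rfl
  | nil => rfl
  | inp σ a T ih => simp only [Tm.sub, Tm.ren, Sub.ren_lift, ih]
  | out σ a K T ih ih' => simp only [Tm.sub, Tm.ren, ih, ih']
  | par T T' ih ih' => simp only [Tm.sub, Tm.ren, ih, ih']
  | res d T ih => simp only [Tm.sub, Tm.ren, Sub.ren_up, ih]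
  | lam T ih => simp only [Tm.sub, Tm.ren, Sub.ren_lift, ih]
  | app F K ih ih' => simp only [Tm.sub, Tm.ren, ih, ih']

theorem Tm.vren_sub {Γ Γ' Γ'' : List Ty} {τ : Ty} (T : Tm Γ τ) (ξ : VRen Γ Γ')
    (θ : Sub Γ' Γ'') : (T.vren ξ).sub θ = T.sub (fun s x => θ s (ξ s x)) := by
  have key : ∀ {Γ Γ' Γ'' : List Ty} (ξ : VRen Γ Γ') (θ : Sub Γ' Γ'') (ρ : Ty),
      (fun s x => θ.lift ρ s (ξ.lift ρ s x)) = Sub.lift (fun s x => θ s (ξ s x)) ρ := by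
    intros; funext s x; cases x <;> rfl
  induction T generalizing Γ' Γ'' with
  | res d T ih => simp only [Tm.vren, Tm.sub, ih]; rfl
  | var x => rfl
  | nil => rfl
  | inp σ a T ih => simp only [Tm.vren, Tm.sub, ih, key]
  | out σ a K T ih ih' => simp only [Tm.vren, Tm.sub, ih, ih']
  | par T T' ih ih' => simp only [Tm.vren, Tm.sub, ih, ih']
  | lam T ih => simp only [Tm.vren, Tm.sub, ih, key]
  | app F K ih ih' => simp only [Tm.vren, Tm.sub, ih, ih']

theorem Tm.sub_vren {Γ Γ' Γ'' : List Ty} {τ : Ty} (T : Tm Γ τ) (θ : Sub Γ Γ')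
    (ξ : VRen Γ' Γ'') : (T.sub θ).vren ξ = T.sub (fun s x => (θ s x).vren ξ) := by
  have key : ∀ {Γ Γ' Γ'' : List Ty} (θ : Sub Γ Γ') (ξ : VRen Γ' Γ'') (ρ : Ty),
      (fun s x => (θ.lift ρ s x).vren (ξ.lift ρ)) = Sub.lift (fun s x => (θ s x).vren ξ) ρ := by
    intros; funext s x
    cases x with
    | zero => rfl
    | succ x => exact Tm.wk_vren_lift _ _ _
  induction T generalizing Γ' Γ'' with
  | res d T ih =>
    simp only [Tm.vren, Tm.sub, ih]
    congr 2
    funext s x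
    exact (Tm.vren_ren _ _ _).symm
  | var x => rfl
  | nil => rfl
  | inp σ a T ih => simp only [Tm.vren, Tm.sub, ih, key]
  | out σ a K T ih ih' => simp only [Tm.vren, Tm.sub, ih, ih']
  | par T T' ih ih' => simp only [Tm.vren, Tm.sub, ih, ih']
  | lam T ih => simp only [Tm.vren, Tm.sub, ih, key]
  | app F K ih ih' => simp only [Tm.vren, Tm.sub, ih, ih']

theorem Tm.wk_sub_lift {Γ Γ' : List Ty} {τ : Ty} (T : Tm Γ τ) (θ : Sub Γ Γ') (σ : Ty) :
    (T.wk σ).sub (θ.lift σ) = (T.sub θ).wk σ := by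
  simp only [Tm.wk, Tm.vren_sub, Tm.sub_vren]; rfl

theorem Tm.sub_sub {Γ Γ' Γ'' : List Ty} {τ : Ty} (T : Tm Γ τ) (θ : Sub Γ Γ')
    (θ' : Sub Γ' Γ'') : (T.sub θ).sub θ' = T.sub (fun s x => (θ s x).sub θ') := by
  have key : ∀ {Γ Γ' Γ'' : List Ty} (θ : Sub Γ Γ') (θ' : Sub Γ' Γ'') (ρ : Ty),
      (fun s x => (θ.lift ρ s x).sub (θ'.lift ρ)) = Sub.lift (fun s x => (θ s x).sub θ') ρ := by
    intros; funext s x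
    cases x with
    | zero => rfl
    | succ x => exact Tm.wk_sub_lift _ _ _
  induction T generalizing Γ' Γ'' with
  | res d T ih =>
    simp only [Tm.sub, ih]
    congr 2
    funext s x
    exact (Tm.sub_ren _ _ _).symm
  | var x => rfl
  | nil => rfl
  | inp σ a T ih => simp only [Tm.sub, ih, key]
  | out σ a K T ih ih' => simp only [Tm.sub, ih, ih']
  | par T T' ih ih' => simp only [Tm.sub, ih, ih']
  | lam T ih => simp only [Tm.sub, ih, key]
  | app F K ih ih' => simp only [Tm.sub, ih, ih']

theorem Sub.lift_id {Γ : List Ty} (ρ : Ty) :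
    Sub.lift (fun _ (x : Var Γ _) => Tm.var x) ρ = fun _ x => Tm.var x := by
  funext s x; cases x <;> rfl

theorem Tm.sub_id {Γ : List Ty} {τ : Ty} (T : Tm Γ τ) : T.sub (fun _ x => Tm.var x) = T := by
  induction T with
  | res d T ih => exact congrArg (Tm.res d) ih
  | _ => simp_all [Tm.sub, Sub.lift_id]

/-! ### Instantiation and extended substitutions. -/

/-- A substitution extended by a term for a new variable. -/
def Sub.cons {Γ Γ' : List Ty} {σ : Ty} (θ : Sub Γ Γ') (A : Tm Γ' σ) : Sub (σ :: Γ) Γ'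
  | _, .zero => A
  | _, .succ x => θ _ x

theorem Tm.wk_sub_cons {Γ Γ' : List Ty} {σ τ : Ty} (T : Tm Γ τ) (θ : Sub Γ Γ') (A : Tm Γ' σ) :
    (T.wk σ).sub (θ.cons A) = T.sub θ := by
  simp only [Tm.wk, Tm.vren_sub]; rfl

theorem Tm.wk_inst {Γ : List Ty} {σ τ : Ty} (T : Tm Γ τ) (A : Tm Γ σ) : (T.wk σ).inst A = T := by
  simp only [Tm.wk, Tm.inst, Tm.vren_sub]
  exact T.sub_id

theorem Tm.sub_lift_inst {Γ Γ' : List Ty} {σ τ : Ty} (T : Tm (σ :: Γ) τ) (θ : Sub Γ Γ')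
    (A : Tm Γ' σ) : (T.sub (θ.lift σ)).inst A = T.sub (θ.cons A) := by
  unfold Tm.inst
  rw [Tm.sub_sub]
  congr 1
  funext s x
  cases x with
  | zero => rfl
  | succ x => exact Tm.wk_inst _ _

theorem Tm.inst_sub {Γ Γ' : List Ty} {σ τ : Ty} (T : Tm (σ :: Γ) τ) (θ : Sub Γ Γ')
    (A : Tm Γ σ) : (T.inst A).sub θ = (T.sub (θ.lift σ)).inst (A.sub θ) := by
  rw [Tm.sub_lift_inst, Tm.inst, Tm.sub_sub]
  congr 1
  funext s x
  cases x <;> rfl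

theorem Sub.single_ren {Γ : List Ty} {σ : Ty} (A : Tm Γ σ) (ρ : Ren) :
    (Sub.single A).ren ρ = Sub.single (A.ren ρ) := by
  funext s x; cases x <;> rfl

theorem Sub.single_up {Γ : List Ty} {σ : Ty} (A : Tm Γ σ) (d : Ty) :
    (Sub.single A).up d = Sub.single (A.ren (PiD.up d)) := Sub.single_ren _ _

theorem Tm.inst_ren {Γ : List Ty} {σ τ : Ty} (T : Tm (σ :: Γ) τ) (A : Tm Γ σ) (ρ : Ren) :
    (T.inst A).ren ρ = (T.ren ρ).inst (A.ren ρ) := by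
  unfold Tm.inst
  rw [Tm.sub_ren, Sub.single_ren]

theorem Tm.inst_par {Γ : List Ty} {σ : Ty} (T S : Tm (σ :: Γ) Ty.proc) (A : Tm Γ σ) :
    (Tm.par T S).inst A = .par (T.inst A) (S.inst A) := rfl

theorem Tm.inst_app {Γ : List Ty} {σ τ υ : Ty} (T : Tm (σ :: Γ) (.arr τ υ)) (S : Tm (σ :: Γ) τ)
    (A : Tm Γ σ) : (Tm.app T S).inst A = .app (T.inst A) (S.inst A) := rfl

theorem Tm.inst_res {Γ : List Ty} {σ : Ty} (d : Ty) (T : Tm (σ :: Γ) Ty.proc) (A : Tm Γ σ) :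
    (Tm.res d T).inst A = .res d (T.inst (A.ren (up d))) := by
  simp only [Tm.inst, Tm.sub, Sub.single_up]

theorem Tm.inst_ress {Γ : List Ty} {σ : Ty} (ds : List Ty) (T : Tm (σ :: Γ) Ty.proc)
    (A : Tm Γ σ) : (Tm.ress ds T).inst A = Tm.ress ds (T.inst (A.ren (ups ds))) := by
  induction ds generalizing A with
  | nil => simp [Tm.ress, ups_nil, Tm.ren_id]
  | cons d ds ih => simp only [Tm.ress, Tm.inst_res, ih, Tm.ren_ren, ups_cons]

theorem Tm.ress_sub {Γ Γ' : List Ty} (ds : List Ty) (T : Tm Γ Ty.proc) (θ : Sub Γ Γ') :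
    (Tm.ress ds T).sub θ = Tm.ress ds (T.sub (θ.ren (ups ds))) := by
  induction ds generalizing θ with
  | nil =>
    have : θ.ren (ups []) = θ := by funext s x; simp [Sub.ren, ups_nil, Tm.ren_id]
    rw [this]; rfl
  | cons d ds ih => simp only [Tm.ress, Tm.sub, ih, Sub.up_eq, Sub.ren_ren, ups_cons]

theorem Tm.ress_ren {Γ : List Ty} (ds : List Ty) (T : Tm Γ Ty.proc) (ρ : Ren) :
    (Tm.ress ds T).ren ρ = Tm.ress ds (T.ren (ρ.lifts ds)) := by
  induction ds generalizing ρ with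
  | nil => rfl
  | cons d ds ih => simp only [Tm.ress, Tm.ren, ih, Ren.lifts]

theorem Tm.ren_lifts_ups {Γ : List Ty} {τ : Ty} (T : Tm Γ τ) (ρ : Ren) (ds : List Ty) :
    (T.ren (ups ds)).ren (ρ.lifts ds) = (T.ren ρ).ren (ups ds) := by
  simp only [Tm.ren_ren, Ren.lifts_ups]

theorem Tm.ren_lift_up {Γ : List Ty} {τ : Ty} (T : Tm Γ τ) (ρ : Ren) (d : Ty) :
    (T.ren (up d)).ren (ρ.lift d) = (T.ren ρ).ren (up d) := by
  simp only [Tm.ren_ren, Ren.lift_up]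

theorem Tm.ren_ups_nil {Γ : List Ty} {τ : Ty} (T : Tm Γ τ) : T.ren (ups []) = T := by
  rw [ups_nil, Tm.ren_id]

theorem Tm.ren_ups_cons {Γ : List Ty} {τ : Ty} (T : Tm Γ τ) (d : Ty) (ds : List Ty) :
    T.ren (ups (d :: ds)) = (T.ren (up d)).ren (ups ds) := by
  rw [Tm.ren_ren, ups_cons]

theorem Sub.ren_ups_nil {Γ Γ' : List Ty} (θ : Sub Γ Γ') : θ.ren (ups []) = θ := by
  funext s x; exact Tm.ren_ups_nil _

/-! The renaming `exch`. -/

theorem exch_singleton_lift (c d : Ty) (ρ : Ren) :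
    (fun s n => ((ρ.lift d).lift c) s (exch c [d] s n)) =
      fun s n => exch c [d] s (((ρ.lift c).lift d) s n) := by
  funext s n
  simp only [exch, Ren.lift, List.count_cons, List.count_nil]
  by_cases h1 : s = c <;> by_cases h2 : d = c
  · subst h1 h2
    rcases n with _ | _ | n <;> simp
  · subst h1
    have : ¬ s = d := fun e => h2 e.symm
    rcases n with _ | n <;> simp [h2, this]
  · subst h2
    simp [h1]
  · simp [h1]

theorem exch_singleton_invol (c d : Ty) :
    (fun s n => exch d [c] s (exch c [d] s n)) = fun _ n => n := by
  funext s n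
  simp only [exch, List.count_cons, List.count_nil]
  by_cases h1 : s = c <;> by_cases h2 : d = c
  · subst h1 h2
    rcases n with _ | _ | n <;> simp
  · subst h1
    have : ¬ s = d := fun e => h2 e.symm
    rcases n with _ | n <;> simp [h2, this]
  · subst h2
    simp [h1]
  · by_cases h3 : s = d
    · subst h3
      have : ¬ c = s := fun e => h2 e.symm
      rcases n with _ | n <;> simp [h1, this]
    · simp [h1, h3]

theorem exch_singleton_up (c d s : Ty) (n : ℕ) :
    exch c [d] s (up d s (up c s n)) = up c s (up d s n) := by
  simp only [exch, up, List.count_cons, List.count_nil]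
  by_cases h1 : s = c <;> by_cases h2 : d = c
  · subst h1 h2
    simp
  · subst h1
    have : ¬ s = d := fun e => h2 e.symm
    simp [h2, this]
  · subst h2
    simp [h1]
  · by_cases h3 : s = d
    · subst h3
      simp [h1]
    · simp [h1, h3]

/-- Below `cs`, the names of sort `s` under `cs.count s` are the bound ones and all others are
offset by that number. The closed form turns identities about iterated lifting into arithmetic. -/
theorem Ren.lifts_apply (cs : List Ty) (ρ : Ren) (s : Ty) (n : ℕ) : ρ.lifts cs s n =
    if n < cs.count s then n else ρ s (n - cs.count s) + cs.count s := by
  revert cs ρ s n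
  intro cs
  induction cs with
  | nil => intro ρ s n; simp [Ren.lifts]
  | cons c cs ih =>
    intro ρ s n
    simp only [Ren.lifts, ih, List.count_cons]
    by_cases h : s = c
    · subst h
      simp only [Ren.lift, beq_self_eq_true, if_true]
      rcases lt_trichotomy n (cs.count s) with h | h | h
      · have : n < cs.count s + 1 := by omega
        simp [h, this]
      · subst h; simp
      · have h1 : ¬ n < cs.count s := by omega
        have h2 : ¬ n < cs.count s + 1 := by omega
        obtain ⟨k, rfl⟩ : ∃ k, n = k + 1 + cs.count s := ⟨n - 1 - cs.count s, by omega⟩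
        have h3 : k + 1 + cs.count s - cs.count s = k + 1 := by omega
        have h4 : k + 1 + cs.count s - (cs.count s + 1) = k := by omega
        simp only [h1, h2, h3, h4, if_false]
        omega
    · have : (c == s) = false := by simpa using fun e => h e.symm
      simp [h, this, Ren.lift]

theorem exch_lifts_up (d : Ty) (cs : List Ty) (s : Ty) (n : ℕ) :
    exch d cs s ((up d).lifts cs s n) = up d s n := by
  rw [Ren.lifts_apply]
  simp only [exch, up]
  by_cases h : s = d
  · subst h
    simp only [if_true]
    split_ifs <;> omega
  · simp only [h, if_false]
    split_ifs <;> omega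

theorem exch_ups_up (d : Ty) (cs : List Ty) (s : Ty) (n : ℕ) :
    exch d cs s (ups cs s (up d s n)) = up d s (ups cs s n) := by
  rw [← Ren.lifts_ups, exch_lifts_up]

/-- A binder crosses `c :: cs` by crossing `c` and then `cs`, which drives the induction in
`Struct.res_ress`. -/
theorem exch_cons (d c : Ty) (cs : List Ty) :
    exch d (c :: cs) = fun s n => exch d cs s ((exch d [c]).lifts cs s n) := by
  funext s n
  rw [Ren.lifts_apply]
  simp only [exch, List.count_cons, List.count_nil]
  by_cases h : s = d
  · subst h
    by_cases h' : c = s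
    · subst h'
      simp only [beq_self_eq_true, if_true]
      split_ifs <;> omega
    · simp only [beq_iff_eq, h', if_true, if_false]
      split_ifs <;> omega
  · simp only [h, if_false]
    split_ifs <;> omega

/-! Structural congruence is closed under renaming and substitution. -/

theorem Struct.of_eq {Γ : List Ty} {τ : Ty} {T T' : Tm Γ τ} (h : T = T') : Struct T T' :=
  h ▸ .refl T

/-- The laws of structural congruence between processes, other than the congruence rules. -/
inductive Law : {Γ : List Ty} → Tm Γ .proc → Tm Γ .proc → Prop
  | par_nil {Γ : List Ty} (T : Tm Γ .proc) : Law (.par T .nil) T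
  | par_assoc {Γ : List Ty} (T T' T'' : Tm Γ .proc) :
      Law (.par T (.par T' T'')) (.par (.par T T') T'')
  | par_comm {Γ : List Ty} (T T' : Tm Γ .proc) : Law (.par T T') (.par T' T)
  | res_comm {Γ : List Ty} (c d : Ty) (T : Tm Γ .proc) :
      Law (.res c (.res d T)) (.res d (.res c (T.ren (exch c [d]))))
  | res_inp {Γ : List Ty} (c : Ty) (T : Tm (c :: Γ) .proc) : Law (.res c (.inp c 0 T)) .nil
  | res_out {Γ : List Ty} (c : Ty) (K : Tm Γ c) (T : Tm Γ .proc) :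
      Law (.res c (.out c 0 K T)) .nil
  | res_par {Γ : List Ty} (c : Ty) (T T' : Tm Γ .proc) :
      Law (.res c (.par T (T'.ren (up c)))) (.par (.res c T) T')

theorem Law.struct {Γ : List Ty} {T T' : Tm Γ .proc} (h : Law T T') : Struct T T' := by
  cases h
  · exact .par_nil _
  · exact .par_assoc _ _ _
  · exact .par_comm _ _
  · exact .res_comm _ _ _
  · exact .res_inp _ _
  · exact .res_out _ _ _
  · exact .res_par _ _ _

theorem Law.ren {Γ : List Ty} {T T' : Tm Γ .proc} (h : Law T T') (ρ : Ren) :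
    Law (T.ren ρ) (T'.ren ρ) := by
  have lift_zero : ∀ c, ρ.lift c c 0 = 0 := fun c => by simp [Ren.lift]
  cases h with
  | par_nil T => exact .par_nil _
  | par_assoc T T' T'' => exact .par_assoc _ _ _
  | par_comm T T' => exact .par_comm _ _
  | res_comm c d T =>
    have := Law.res_comm c d (T.ren ((ρ.lift c).lift d))
    simp only [Tm.ren_ren, ← exch_singleton_lift] at this
    simpa only [Tm.ren, Tm.ren_ren] using this
  | res_inp c T => simp only [Tm.ren, lift_zero]; exact .res_inp _ _
  | res_out c K T => simp only [Tm.ren, lift_zero]; exact .res_out _ _ _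
  | res_par c T T' => simp only [Tm.ren, Tm.ren_lift_up]; exact .res_par _ _ _

theorem Law.sub {Γ Γ' : List Ty} {T T' : Tm Γ .proc} (h : Law T T') (θ : Sub Γ Γ') :
    Law (T.sub θ) (T'.sub θ) := by
  cases h with
  | par_nil T => exact .par_nil _
  | par_assoc T T' T'' => exact .par_assoc _ _ _
  | par_comm T T' => exact .par_comm _ _
  | res_comm c d T =>
    have := Law.res_comm c d (T.sub ((θ.up c).up d))
    rw [Tm.sub_ren] at this
    simp only [Sub.up_eq, Sub.ren_ren, exch_singleton_up] at this
    simpa only [Tm.sub, Sub.up_eq, Sub.ren_ren] using this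
  | res_inp c T => exact .res_inp _ _
  | res_out c K T => exact .res_out _ _ _
  | res_par c T T' => simp only [Tm.sub, Sub.up_eq, ← Tm.sub_ren]; exact .res_par _ _ _

theorem Struct.ren {Γ : List Ty} {τ : Ty} {T T' : Tm Γ τ} (h : Struct T T') (ρ : Ren) :
    Struct (T.ren ρ) (T'.ren ρ) := by
  induction h generalizing ρ with
  | refl T => exact .refl _
  | symm _ ih => exact (ih ρ).symm
  | trans _ _ ih ih' => exact (ih ρ).trans (ih' ρ)
  | inp σ a _ ih => exact .inp _ _ (ih ρ)
  | out σ a _ _ ih ih' => exact .out _ _ (ih ρ) (ih' ρ)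
  | par _ _ ih ih' => exact .par (ih ρ) (ih' ρ)
  | res σ _ ih => exact .res _ (ih _)
  | lam _ ih => exact .lam (ih ρ)
  | app _ _ ih ih' => exact .app (ih ρ) (ih' ρ)
  | par_nil T => exact ((Law.par_nil T).ren ρ).struct
  | par_assoc T T' T'' => exact ((Law.par_assoc T T' T'').ren ρ).struct
  | par_comm T T' => exact ((Law.par_comm T T').ren ρ).struct
  | res_comm c d T => exact ((Law.res_comm c d T).ren ρ).struct
  | res_inp c T => exact ((Law.res_inp c T).ren ρ).struct
  | res_out c K T => exact ((Law.res_out c K T).ren ρ).struct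
  | res_par c T T' => exact ((Law.res_par c T T').ren ρ).struct
  | beta T K => rw [Tm.inst_ren]; exact .beta _ _

theorem Struct.sub {Γ Γ' : List Ty} {τ : Ty} {T T' : Tm Γ τ} (h : Struct T T')
    (θ : Sub Γ Γ') : Struct (T.sub θ) (T'.sub θ) := by
  induction h generalizing Γ' with
  | refl T => exact .refl _
  | symm _ ih => exact (ih θ).symm
  | trans _ _ ih ih' => exact (ih θ).trans (ih' θ)
  | inp σ a _ ih => exact .inp _ _ (ih _)
  | out σ a _ _ ih ih' => exact .out _ _ (ih θ) (ih' θ)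
  | par _ _ ih ih' => exact .par (ih θ) (ih' θ)
  | res σ _ ih => exact .res _ (ih _)
  | lam _ ih => exact .lam (ih _)
  | app _ _ ih ih' => exact .app (ih θ) (ih' θ)
  | par_nil T => exact ((Law.par_nil T).sub θ).struct
  | par_assoc T T' T'' => exact ((Law.par_assoc T T' T'').sub θ).struct
  | par_comm T T' => exact ((Law.par_comm T T').sub θ).struct
  | res_comm c d T => exact ((Law.res_comm c d T).sub θ).struct
  | res_inp c T => exact ((Law.res_inp c T).sub θ).struct
  | res_out c K T => exact ((Law.res_out c K T).sub θ).struct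
  | res_par c T T' => exact ((Law.res_par c T T').sub θ).struct
  | beta T K => rw [Tm.inst_sub]; exact .beta _ _

theorem Struct.wk {Γ : List Ty} {τ : Ty} {T T' : Tm Γ τ} (h : Struct T T') (σ : Ty) :
    Struct (T.wk σ) (T'.wk σ) := by
  have key : ∀ T : Tm Γ τ, T.wk σ = T.sub (fun _ x => .var (.succ x)) := by
    intro T
    conv_lhs => rw [← T.sub_id]
    exact Tm.sub_vren _ _ _
  rw [key, key]
  exact h.sub _

/-- Complements `Struct.sub`, where the term varies and the substitution is fixed; together they
give congruence of instantiation in both arguments. -/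
theorem Struct.sub_congr {Γ Γ' : List Ty} {τ : Ty} (T : Tm Γ τ) {θ θ' : Sub Γ Γ'}
    (h : ∀ s x, Struct (θ s x) (θ' s x)) : Struct (T.sub θ) (T.sub θ') := by
  have lift : ∀ {Γ Γ' : List Ty} {θ θ' : Sub Γ Γ'} (σ : Ty),
      (∀ s x, Struct (θ s x) (θ' s x)) →
      ∀ s x, Struct (θ.lift σ s x) (θ'.lift σ s x) := by
    intro Γ Γ' θ θ' σ h s x
    cases x with
    | zero => exact .refl _
    | succ x => exact (h _ x).wk _
  induction T generalizing Γ' with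
  | var x => exact h _ x
  | nil => exact .refl _
  | inp σ a T ih => exact .inp _ _ (ih (lift _ h))
  | out σ a K T ih ih' => exact .out _ _ (ih h) (ih' h)
  | par T T' ih ih' => exact .par (ih h) (ih' h)
  | res d T ih => exact .res _ (ih fun s x => (h s x).ren _)
  | lam T ih => exact .lam (ih (lift _ h))
  | app F K ih ih' => exact .app (ih h) (ih' h)

theorem Struct.inst {Γ : List Ty} {σ τ : Ty} {T T' : Tm (σ :: Γ) τ} {A A' : Tm Γ σ}
    (h : Struct T T') (h' : Struct A A') : Struct (T.inst A) (T'.inst A') := by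
  refine (h.sub _).trans (Struct.sub_congr _ ?_)
  intro s x
  cases x with
  | zero => exact h'
  | succ x => exact .refl _

theorem Struct.ress {Γ : List Ty} (ds : List Ty) {T T' : Tm Γ Ty.proc} (h : Struct T T') :
    Struct (Tm.ress ds T) (Tm.ress ds T') := by
  induction ds with
  | nil => exact h
  | cons d ds ih => exact .res _ ih

theorem Struct.res_ress {Γ : List Ty} (d : Ty) (cs : List Ty) (T : Tm Γ Ty.proc) :
    Struct (.res d (Tm.ress cs T)) (Tm.ress cs (.res d (T.ren (exch d cs)))) := by
  induction cs generalizing T with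
  | nil => exact .of_eq (by simp only [Tm.ress, exch_nil, Tm.ren_id])
  | cons c cs ih =>
    refine (Struct.res_comm d c _).trans (.res c ?_)
    rw [Tm.ress_ren]
    refine (ih _).trans (.of_eq ?_)
    rw [Tm.ren_ren, exch_cons d c cs]

theorem Struct.par_res {Γ : List Ty} (c : Ty) (T T' : Tm Γ Ty.proc) :
    Struct (.res c (.par (T'.ren (up c)) T)) (.par T' (.res c T)) :=
  (Struct.res _ (.par_comm _ _)).trans ((Struct.res_par _ _ _).trans (.par_comm _ _))

theorem Struct.ress_par {Γ : List Ty} (cs : List Ty) (T T' : Tm Γ Ty.proc) :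
    Struct (Tm.ress cs (.par T (T'.ren (ups cs)))) (.par (Tm.ress cs T) T') := by
  induction cs generalizing T' with
  | nil => exact .of_eq (by simp only [Tm.ress, Tm.ren_ups_nil])
  | cons c cs ih =>
    rw [Tm.ren_ups_cons]
    exact (Struct.res c (ih _)).trans (.res_par _ _ _)

theorem Struct.par_ress {Γ : List Ty} (cs : List Ty) (T T' : Tm Γ Ty.proc) :
    Struct (Tm.ress cs (.par (T'.ren (ups cs)) T)) (.par T' (Tm.ress cs T)) :=
  (Struct.ress _ (.par_comm _ _)).trans ((Struct.ress_par _ _ _).trans (.par_comm _ _))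

theorem Struct.par_right_comm {Γ : List Ty} (T T' T'' : Tm Γ Ty.proc) :
    Struct (.par (.par T T') T'') (.par (.par T T'') T') :=
  (Struct.par_assoc _ _ _).symm.trans
    ((Struct.par (.refl _) (.par_comm _ _)).trans (.par_assoc _ _ _))

theorem Struct.par_left_comm {Γ : List Ty} (T T' T'' : Tm Γ Ty.proc) :
    Struct (.par T (.par T' T'')) (.par T' (.par T T'')) :=
  (Struct.par_assoc _ _ _).trans
    ((Struct.par (.par_comm _ _) (.refl _)).trans (Struct.par_assoc _ _ _).symm)

theorem exch_ups (d : Ty) (cs : List Ty) (s : Ty) (n : ℕ) :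
    exch d cs s (ups cs s n) = (ups cs).lift d s n := by
  unfold exch ups Ren.lift
  by_cases h : s = d
  · subst h
    cases n <;> simp
    omega
  · simp [h]

/-! Weak head reduction, and transitions of open terms without structural congruence. -/

/-- Weak head reduction. -/
inductive Head {Γ : List Ty} : {τ : Ty} → Tm Γ τ → Tm Γ τ → Prop
  | beta {σ τ : Ty} (T : Tm (σ :: Γ) τ) (K : Tm Γ σ) :
      Head (.app (.lam T) K) (T.inst K)
  | app {σ τ : Ty} {F F' : Tm Γ (.arr σ τ)} (K : Tm Γ σ) :
      Head F F' → Head (.app F K) (.app F' K)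

/-- Subjects of outputs: a name, or a variable whose application is exposed. -/
inductive Chan (Γ : List Ty) : Ty → Type
  | nm {σ : Ty} (a : ℕ) : Chan Γ σ
  | vr {σ : Ty} (x : Var Γ (.arr σ .proc)) : Chan Γ σ

/-- Renaming of a subject. -/
def Chan.ren {Γ : List Ty} {σ : Ty} (ρ : Ren) : Chan Γ σ → Chan Γ σ
  | .nm a => .nm (ρ σ a)
  | .vr x => .vr x

/-- Late input transitions. -/
inductive InpT {Γ : List Ty} : Tm Γ .proc → (σ : Ty) → ℕ → Tm (σ :: Γ) .proc → Prop
  | inp (σ : Ty) (a : ℕ) (T : Tm (σ :: Γ) .proc) : InpT (.inp σ a T) σ a T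
  | parL {T : Tm Γ .proc} {σ : Ty} {a : ℕ} {F : Tm (σ :: Γ) .proc}
      (S : Tm Γ .proc) : InpT T σ a F → InpT (.par T S) σ a (.par F (S.wk σ))
  | parR {T : Tm Γ .proc} {σ : Ty} {a : ℕ} {F : Tm (σ :: Γ) .proc}
      (S : Tm Γ .proc) : InpT T σ a F → InpT (.par S T) σ a (.par (S.wk σ) F)
  | res (d : Ty) {T : Tm Γ .proc} {σ : Ty} {a : ℕ} {F : Tm (σ :: Γ) .proc} :
      InpT T σ (up d σ a) F → InpT (.res d T) σ a (.res d F)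
  | head {T T' : Tm Γ .proc} {σ : Ty} {a : ℕ} {F : Tm (σ :: Γ) .proc} :
      Head T T' → InpT T' σ a F → InpT T σ a F

/-- Output transitions, which extrude every restricted name. -/
inductive OutT {Γ : List Ty} : Tm Γ .proc → {σ : Ty} → Chan Γ σ → List Ty → Tm Γ σ →
    Tm Γ .proc → Prop
  | out (σ : Ty) (a : ℕ) (K : Tm Γ σ) (T : Tm Γ .proc) :
      OutT (.out σ a K T) (.nm a) [] K T
  | app {σ : Ty} (x : Var Γ (.arr σ .proc)) (K : Tm Γ σ) :
      OutT (.app (.var x) K) (.vr x) [] K .nil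
  | parL {T : Tm Γ .proc} {σ : Ty} {α : Chan Γ σ} {cs : List Ty} {K : Tm Γ σ}
      {T' : Tm Γ .proc} (S : Tm Γ .proc) :
      OutT T α cs K T' → OutT (.par T S) α cs K (.par T' (S.ren (ups cs)))
  | parR {T : Tm Γ .proc} {σ : Ty} {α : Chan Γ σ} {cs : List Ty} {K : Tm Γ σ}
      {T' : Tm Γ .proc} (S : Tm Γ .proc) :
      OutT T α cs K T' → OutT (.par S T) α cs K (.par (S.ren (ups cs)) T')
  | res (d : Ty) {T : Tm Γ .proc} {σ : Ty} {α : Chan Γ σ} {cs : List Ty}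
      {K : Tm Γ σ} {T' : Tm Γ .proc} :
      OutT T (α.ren (up d)) cs K T' → OutT (.res d T) α (d :: cs) K T'
  | head {T T' : Tm Γ .proc} {σ : Ty} {α : Chan Γ σ} {cs : List Ty}
      {K : Tm Γ σ} {T'' : Tm Γ .proc} :
      Head T T' → OutT T' α cs K T'' → OutT T α cs K T''

/-- The process `(cs)(E[K] | T)`. -/
def conc {Γ : List Ty} {σ : Ty} (cs : List Ty) (K : Tm Γ σ) (T : Tm Γ .proc)
    (E : Tm (σ :: Γ) .proc) : Tm Γ .proc :=
  Tm.ress cs (.par ((E.ren (ups cs)).inst K) T)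

/-- The process `(cs)(T | E[K])`. -/
def conc' {Γ : List Ty} {σ : Ty} (cs : List Ty) (K : Tm Γ σ) (T : Tm Γ .proc)
    (E : Tm (σ :: Γ) .proc) : Tm Γ .proc :=
  Tm.ress cs (.par T ((E.ren (ups cs)).inst K))

/-- Internal transitions. -/
inductive TauT {Γ : List Ty} : Tm Γ .proc → Tm Γ .proc → Prop
  | comL {T₁ T₂ : Tm Γ .proc} {σ : Ty} {a : ℕ} {F : Tm (σ :: Γ) .proc}
      {cs : List Ty} {K : Tm Γ σ} {T' : Tm Γ .proc} :
      InpT T₁ σ a F → OutT T₂ (.nm a) cs K T' → TauT (.par T₁ T₂) (conc cs K T' F)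
  | comR {T₁ T₂ : Tm Γ .proc} {σ : Ty} {a : ℕ} {F : Tm (σ :: Γ) .proc}
      {cs : List Ty} {K : Tm Γ σ} {T' : Tm Γ .proc} :
      OutT T₁ (.nm a) cs K T' → InpT T₂ σ a F → TauT (.par T₁ T₂) (conc' cs K T' F)
  | parL {T T' : Tm Γ .proc} (S : Tm Γ .proc) :
      TauT T T' → TauT (.par T S) (.par T' S)
  | parR {T T' : Tm Γ .proc} (S : Tm Γ .proc) :
      TauT T T' → TauT (.par S T) (.par S T')
  | res (d : Ty) {T T' : Tm Γ .proc} : TauT T T' → TauT (.res d T) (.res d T')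
  | head {T T' T'' : Tm Γ .proc} : Head T T' → TauT T' T'' → TauT T T''

/-! ### Outputs placed in a receiving context. -/

theorem conc_comm {Γ : List Ty} {σ : Ty} (cs : List Ty) (K : Tm Γ σ) (T : Tm Γ .proc)
    (E : Tm (σ :: Γ) .proc) : Struct (conc' cs K T E) (conc cs K T E) :=
  .ress _ (.par_comm _ _)

theorem conc_congr {Γ : List Ty} {σ : Ty} (cs : List Ty) {K K' : Tm Γ σ} {T T' : Tm Γ .proc}
    {E E' : Tm (σ :: Γ) .proc} (hK : Struct K K') (hT : Struct T T') (hE : Struct E E') :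
    Struct (conc cs K T E) (conc cs K' T' E') :=
  .ress _ (.par ((hE.ren _).inst hK) hT)

theorem conc_cons {Γ : List Ty} {σ : Ty} (d : Ty) (cs : List Ty) (K : Tm Γ σ) (T : Tm Γ .proc)
    (E : Tm (σ :: Γ) .proc) : conc (d :: cs) K T E = .res d (conc cs K T (E.ren (up d))) := by
  simp only [conc, Tm.ress, Tm.ren_ups_cons]

theorem conc_ren {Γ : List Ty} {σ : Ty} (cs : List Ty) (K : Tm Γ σ) (T : Tm Γ .proc)
    (E : Tm (σ :: Γ) .proc) (ρ : Ren) : (conc cs K T E).ren ρ =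
      conc cs (K.ren (ρ.lifts cs)) (T.ren (ρ.lifts cs)) (E.ren ρ) := by
  simp only [conc, Tm.ress_ren, Tm.ren, Tm.inst_ren, Tm.ren_lifts_ups]

theorem conc'_ren {Γ : List Ty} {σ : Ty} (cs : List Ty) (K : Tm Γ σ) (T : Tm Γ .proc)
    (E : Tm (σ :: Γ) .proc) (ρ : Ren) : (conc' cs K T E).ren ρ =
      conc' cs (K.ren (ρ.lifts cs)) (T.ren (ρ.lifts cs)) (E.ren ρ) := by
  simp only [conc', Tm.ress_ren, Tm.ren, Tm.inst_ren, Tm.ren_lifts_ups]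

theorem conc_sub {Γ Γ' : List Ty} {σ : Ty} (cs : List Ty) (K : Tm Γ σ) (T : Tm Γ .proc)
    (E : Tm (σ :: Γ) .proc) (θ : Sub Γ Γ') : (conc cs K T E).sub θ =
      conc cs (K.sub (θ.ren (ups cs))) (T.sub (θ.ren (ups cs))) (E.sub (θ.lift σ)) := by
  simp only [conc, Tm.ress_sub, Tm.sub, Tm.inst_sub, Tm.sub_ren, Sub.ren_lift]

theorem conc'_sub {Γ Γ' : List Ty} {σ : Ty} (cs : List Ty) (K : Tm Γ σ) (T : Tm Γ .proc)
    (E : Tm (σ :: Γ) .proc) (θ : Sub Γ Γ') : (conc' cs K T E).sub θ =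
      conc' cs (K.sub (θ.ren (ups cs))) (T.sub (θ.ren (ups cs))) (E.sub (θ.lift σ)) := by
  simp only [conc', Tm.ress_sub, Tm.sub, Tm.inst_sub, Tm.sub_ren, Sub.ren_lift]

theorem conc_par_left {Γ : List Ty} {σ : Ty} (cs : List Ty) (K : Tm Γ σ) (T S : Tm Γ .proc)
    (E : Tm (σ :: Γ) .proc) :
    Struct (conc cs K (.par (S.ren (ups cs)) T) E) (.par S (conc cs K T E)) :=
  (Struct.ress _ (Struct.par_left_comm _ _ _)).trans (.par_ress _ _ _)

theorem conc_par_right {Γ : List Ty} {σ : Ty} (cs : List Ty) (K : Tm Γ σ) (T S : Tm Γ .proc)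
    (E : Tm (σ :: Γ) .proc) :
    Struct (conc cs K (.par T (S.ren (ups cs))) E) (.par (conc cs K T E) S) :=
  (Struct.ress _ (Struct.par_assoc _ _ _)).trans (.ress_par _ _ _)

/-- A bystander of the receiver mentions neither the received variable nor the extruded names, so it
can leave the scope of the communication. -/
theorem conc_input_par {Γ : List Ty} {σ : Ty} (cs : List Ty) (K : Tm Γ σ) (T S : Tm Γ .proc)
    (E : Tm (σ :: Γ) .proc) :
    Struct (conc cs K T (.par E (S.wk σ))) (.par (conc cs K T E) S) := by
  refine Struct.trans ?_ (conc_par_right _ _ _ _ _)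
  simp only [conc, Tm.ren, Tm.inst_par, Tm.wk_ren, Tm.wk_inst]
  exact .ress _ ((Struct.par_right_comm _ _ _).trans (Struct.par_assoc _ _ _).symm)

theorem conc_input_par' {Γ : List Ty} {σ : Ty} (cs : List Ty) (K : Tm Γ σ) (T S : Tm Γ .proc)
    (E : Tm (σ :: Γ) .proc) :
    Struct (conc cs K T (.par (S.wk σ) E)) (.par S (conc cs K T E)) :=
  (conc_congr _ (.refl _) (.refl _) (.par_comm _ _)).trans
    ((conc_input_par _ _ _ _ _).trans (.par_comm _ _))

/-- A restriction around the receiver moves out over the extruded names. Message and continuation do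
not know `d`, whence their weakening below `cs`. -/
theorem conc_input_res {Γ : List Ty} {σ : Ty} (d : Ty) (cs : List Ty) (K : Tm Γ σ)
    (T : Tm Γ .proc) (E : Tm (σ :: Γ) .proc) :
    Struct (conc cs K T (.res d E))
      (.res d (conc cs (K.ren ((up d).lifts cs)) (T.ren ((up d).lifts cs)) E)) := by
  refine Struct.symm ((Struct.res_ress _ _ _).trans (.ress _ ?_))
  simp only [Tm.ren, Tm.ren_ren, exch_lifts_up, Tm.inst_ren, Tm.inst_res]
  refine (Struct.res_par _ _ _).trans (.par (.res _ (.of_eq ?_)) (.refl _))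
  congr 2
  funext s n
  exact exch_ups d cs s n

/-! Transitions are closed under renaming. -/

theorem Head.ren {Γ : List Ty} {τ : Ty} {T T' : Tm Γ τ} (h : Head T T') (ρ : Ren) :
    Head (T.ren ρ) (T'.ren ρ) := by
  induction h with
  | beta T K => rw [Tm.inst_ren]; exact .beta _ _
  | app K _ ih => exact .app _ ih

theorem Head.sub {Γ Γ' : List Ty} {τ : Ty} {T T' : Tm Γ τ} (h : Head T T') (θ : Sub Γ Γ') :
    Head (T.sub θ) (T'.sub θ) := by
  induction h generalizing Γ' with
  | beta T K => rw [Tm.inst_sub]; exact .beta _ _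
  | app K _ ih => exact .app _ (ih θ)

theorem Head.struct {Γ : List Ty} {τ : Ty} {T T' : Tm Γ τ} (h : Head T T') : Struct T T' := by
  induction h with
  | beta T K => exact .beta _ _
  | app K _ ih => exact .app ih (.refl _)

theorem Head.det {Γ : List Ty} {τ : Ty} {T T₁ T₂ : Tm Γ τ} (h₁ : Head T T₁) (h₂ : Head T T₂) :
    T₁ = T₂ := by
  induction h₁ with
  | beta T K =>
    cases h₂ with
    | beta => rfl
    | app _ h => cases h
  | app K h ih =>
    cases h₂ with
    | beta => cases h
    | app _ h' => rw [ih h']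

theorem Head.exists_ren {Γ : List Ty} {τ : Ty} {T S : Tm Γ τ} {ρ : Ren}
    (h : Head (T.ren ρ) S) : ∃ T', Head T T' ∧ T'.ren ρ = S := by
  induction T with
  | app F K ih _ =>
    cases F with
    | lam T =>
      cases h with
      | beta => exact ⟨_, .beta _ _, Tm.inst_ren _ _ _⟩
      | app _ h => cases h
    | var x => cases h with
      | app _ h => cases h
    | app F K' =>
      cases h with
      | app _ h =>
        obtain ⟨F', h', rfl⟩ := ih h
        exact ⟨_, .app _ h', rfl⟩
  | _ => cases h

theorem Chan.ren_lift_up {Γ : List Ty} {σ : Ty} (α : Chan Γ σ) (ρ : Ren) (d : Ty) :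
    (α.ren (up d)).ren (ρ.lift d) = (α.ren ρ).ren (up d) := by
  cases α <;> simp [Chan.ren, Ren.lift_up]

theorem InpT.ren {Γ : List Ty} {T : Tm Γ .proc} {σ : Ty} {a : ℕ} {F : Tm (σ :: Γ) .proc}
    (h : InpT T σ a F) (ρ : Ren) : InpT (T.ren ρ) σ (ρ σ a) (F.ren ρ) := by
  induction h generalizing ρ with
  | inp σ a T => exact .inp _ _ _
  | parL S _ ih => simp only [Tm.ren, Tm.wk_ren]; exact .parL _ (ih ρ)
  | parR S _ ih => simp only [Tm.ren, Tm.wk_ren]; exact .parR _ (ih ρ)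
  | res d _ ih => exact .res _ (by simpa only [Ren.lift_up] using ih (ρ.lift d))
  | head h _ ih => exact .head (h.ren ρ) (ih ρ)

theorem OutT.ren {Γ : List Ty} {T : Tm Γ .proc} {σ : Ty} {α : Chan Γ σ} {cs : List Ty}
    {K : Tm Γ σ} {T' : Tm Γ .proc} (h : OutT T α cs K T') (ρ : Ren) :
    OutT (T.ren ρ) (α.ren ρ) cs (K.ren (ρ.lifts cs)) (T'.ren (ρ.lifts cs)) := by
  induction h generalizing ρ with
  | out σ a K T => exact .out _ _ _ _
  | app x K => exact .app _ _
  | parL S _ ih => simp only [Tm.ren, Tm.ren_lifts_ups]; exact .parL _ (ih ρ)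
  | parR S _ ih => simp only [Tm.ren, Tm.ren_lifts_ups]; exact .parR _ (ih ρ)
  | res d _ ih =>
    have := ih (ρ.lift d)
    rw [Chan.ren_lift_up] at this
    exact .res _ this
  | head h _ ih => exact .head (h.ren ρ) (ih ρ)

theorem TauT.ren {Γ : List Ty} {T T' : Tm Γ .proc} (h : TauT T T') (ρ : Ren) :
    TauT (T.ren ρ) (T'.ren ρ) := by
  induction h generalizing ρ with
  | comL h h' => rw [conc_ren]; exact .comL (h.ren ρ) (h'.ren ρ)
  | comR h h' => rw [conc'_ren]; exact .comR (h.ren ρ) (h'.ren ρ)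
  | parL S _ ih => exact .parL _ (ih ρ)
  | parR S _ ih => exact .parR _ (ih ρ)
  | res d _ ih => exact .res _ (ih _)
  | head h _ ih => exact .head (h.ren ρ) (ih ρ)

/-! Transitions are reflected by injective renamings. -/

/-- Injectivity is not needed for a single input: a renaming changes subjects but creates neither
prefixes nor head redexes. -/
theorem InpT.exists_ren {Γ : List Ty} {T : Tm Γ .proc} {ρ : Ren} {σ : Ty} {a : ℕ}
    {F : Tm (σ :: Γ) .proc} (h : InpT (T.ren ρ) σ a F) :
    ∃ b F', ρ σ b = a ∧ InpT T σ b F' ∧ F'.ren ρ = F := by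
  generalize hS : T.ren ρ = S at h
  induction h generalizing ρ T with
  | inp σ a S =>
    cases T <;> simp only [Tm.ren, reduceCtorEq, Tm.inp.injEq] at hS
    obtain ⟨rfl, rfl, hS⟩ := hS
    cases hS
    exact ⟨_, _, rfl, .inp _ _ _, rfl⟩
  | parL S _ ih =>
    cases T <;> simp only [Tm.ren, reduceCtorEq, Tm.par.injEq] at hS
    obtain ⟨rfl, rfl⟩ := hS
    obtain ⟨b, F', h, h', rfl⟩ := ih rfl
    exact ⟨b, _, h, .parL _ h', by simp only [Tm.ren, Tm.wk_ren]⟩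
  | parR S _ ih =>
    cases T <;> simp only [Tm.ren, reduceCtorEq, Tm.par.injEq] at hS
    obtain ⟨rfl, rfl⟩ := hS
    obtain ⟨b, F', h, h', rfl⟩ := ih rfl
    exact ⟨b, _, h, .parR _ h', by simp only [Tm.ren, Tm.wk_ren]⟩
  | res d _ ih =>
    cases T <;> simp only [Tm.ren, reduceCtorEq, Tm.res.injEq] at hS
    obtain ⟨rfl, rfl⟩ := hS
    obtain ⟨b, F', h, h', rfl⟩ := ih rfl
    obtain ⟨k, rfl, hk⟩ := Ren.lift_eq_up h
    exact ⟨k, _, hk, .res _ h', rfl⟩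
  | head h _ ih =>
    subst hS
    obtain ⟨T', h', rfl⟩ := h.exists_ren
    obtain ⟨b, F', hb, hF, rfl⟩ := ih rfl
    exact ⟨b, _, hb, .head h' hF, rfl⟩

theorem Chan.ren_lift_eq {Γ : List Ty} {σ : Ty} {α β : Chan Γ σ} {ρ : Ren} {d : Ty}
    (e : α.ren (ρ.lift d) = β.ren (up d)) : ∃ γ : Chan Γ σ, α = γ.ren (up d) ∧ γ.ren ρ = β := by
  cases α <;> cases β <;> simp only [Chan.ren, Chan.nm.injEq, Chan.vr.injEq, reduceCtorEq] at e
  · obtain ⟨k, rfl, rfl⟩ := Ren.lift_eq_up e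
    exact ⟨.nm k, rfl, rfl⟩
  · exact ⟨.vr _, rfl, by rw [e]; rfl⟩

theorem OutT.exists_ren {Γ : List Ty} {T : Tm Γ .proc} {ρ : Ren} {σ : Ty} {α : Chan Γ σ}
    {cs : List Ty} {K : Tm Γ σ} {T' : Tm Γ .proc} (h : OutT (T.ren ρ) α cs K T') :
    ∃ β K' T'', Chan.ren ρ β = α ∧ OutT T β cs K' T'' ∧ K'.ren (ρ.lifts cs) = K ∧
      T''.ren (ρ.lifts cs) = T' := by
  generalize hS : T.ren ρ = S at h
  induction h generalizing ρ T with
  | out σ a K S =>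
    cases T <;> simp only [Tm.ren, reduceCtorEq, Tm.out.injEq] at hS
    obtain ⟨rfl, rfl, hK, rfl⟩ := hS
    cases hK
    exact ⟨_, _, _, rfl, .out _ _ _ _, rfl, rfl⟩
  | app x K =>
    cases T with
    | app F K =>
      simp only [Tm.ren, Tm.app.injEq] at hS
      obtain ⟨rfl, hF, hK⟩ := hS
      cases hK
      cases F <;> simp only [Tm.ren, heq_eq_eq, reduceCtorEq, Tm.var.injEq] at hF
      subst hF
      exact ⟨_, _, _, rfl, .app _ _, rfl, rfl⟩
    | _ => simp only [Tm.ren, reduceCtorEq] at hS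
  | parL S _ ih =>
    cases T <;> simp only [Tm.ren, reduceCtorEq, Tm.par.injEq] at hS
    obtain ⟨rfl, rfl⟩ := hS
    obtain ⟨b, K', T', h, h', rfl, rfl⟩ := ih rfl
    exact ⟨b, _, _, h, .parL _ h', rfl, by simp only [Tm.ren, Tm.ren_lifts_ups]⟩
  | parR S _ ih =>
    cases T <;> simp only [Tm.ren, reduceCtorEq, Tm.par.injEq] at hS
    obtain ⟨rfl, rfl⟩ := hS
    obtain ⟨b, K', T', h, h', rfl, rfl⟩ := ih rfl
    exact ⟨b, _, _, h, .parR _ h', rfl, by simp only [Tm.ren, Tm.ren_lifts_ups]⟩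
  | res d _ ih =>
    cases T <;> simp only [Tm.ren, reduceCtorEq, Tm.res.injEq] at hS
    obtain ⟨rfl, rfl⟩ := hS
    obtain ⟨b, K', T', h, h', rfl, rfl⟩ := ih rfl
    obtain ⟨k, rfl, hk⟩ := Chan.ren_lift_eq h
    exact ⟨k, _, _, hk, .res _ h', rfl, rfl⟩
  | head h _ ih =>
    subst hS
    obtain ⟨T', h', rfl⟩ := h.exists_ren
    obtain ⟨b, K', T', hb, hF, rfl, rfl⟩ := ih rfl
    exact ⟨b, _, _, hb, .head h' hF, rfl, rfl⟩

/-- Injectivity matters here, as identifying two names could create a communication. -/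
theorem TauT.exists_ren {Γ : List Ty} {T : Tm Γ .proc} {ρ : Ren}
    (hρ : ∀ s, Function.Injective (ρ s)) {T' : Tm Γ .proc} (h : TauT (T.ren ρ) T') :
    ∃ T'', TauT T T'' ∧ T''.ren ρ = T' := by
  generalize hS : T.ren ρ = S at h
  induction h generalizing ρ T with
  | comL h h' =>
    cases T <;> simp only [Tm.ren, reduceCtorEq, Tm.par.injEq] at hS
    obtain ⟨rfl, rfl⟩ := hS
    obtain ⟨b, F', rfl, hF, rfl⟩ := h.exists_ren
    obtain ⟨β, K', T', hβ, hK, rfl, rfl⟩ := h'.exists_ren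
    cases β <;> simp only [Chan.ren, Chan.nm.injEq, reduceCtorEq] at hβ
    cases hρ _ hβ
    exact ⟨_, .comL hF hK, conc_ren _ _ _ _ _⟩
  | comR h' h =>
    cases T <;> simp only [Tm.ren, reduceCtorEq, Tm.par.injEq] at hS
    obtain ⟨rfl, rfl⟩ := hS
    obtain ⟨b, F', rfl, hF, rfl⟩ := h.exists_ren
    obtain ⟨β, K', T', hβ, hK, rfl, rfl⟩ := h'.exists_ren
    cases β <;> simp only [Chan.ren, Chan.nm.injEq, reduceCtorEq] at hβ
    cases hρ _ hβ
    exact ⟨_, .comR hK hF, conc'_ren _ _ _ _ _⟩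
  | parL S _ ih =>
    cases T <;> simp only [Tm.ren, reduceCtorEq, Tm.par.injEq] at hS
    obtain ⟨rfl, rfl⟩ := hS
    obtain ⟨T', h, rfl⟩ := ih hρ rfl
    exact ⟨_, .parL _ h, rfl⟩
  | parR S _ ih =>
    cases T <;> simp only [Tm.ren, reduceCtorEq, Tm.par.injEq] at hS
    obtain ⟨rfl, rfl⟩ := hS
    obtain ⟨T', h, rfl⟩ := ih hρ rfl
    exact ⟨_, .parR _ h, rfl⟩
  | res d _ ih =>
    cases T <;> simp only [Tm.ren, reduceCtorEq, Tm.res.injEq] at hS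
    obtain ⟨rfl, rfl⟩ := hS
    obtain ⟨T', h, rfl⟩ := ih (Ren.lift_inj hρ _) rfl
    exact ⟨_, .res _ h, rfl⟩
  | head h _ ih =>
    subst hS
    obtain ⟨T', h', rfl⟩ := h.exists_ren
    obtain ⟨T', h, rfl⟩ := ih hρ rfl
    exact ⟨_, .head h' h, rfl⟩

/-! Transitions are closed under substitution. -/

theorem InpT.sub {Γ Γ' : List Ty} {T : Tm Γ .proc} {σ : Ty} {a : ℕ} {F : Tm (σ :: Γ) .proc}
    (h : InpT T σ a F) (θ : Sub Γ Γ') : InpT (T.sub θ) σ a (F.sub (θ.lift σ)) := by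
  induction h generalizing Γ' with
  | inp σ a T => exact .inp _ _ _
  | parL S _ ih => simp only [Tm.sub, Tm.wk_sub_lift]; exact .parL _ (ih θ)
  | parR S _ ih => simp only [Tm.sub, Tm.wk_sub_lift]; exact .parR _ (ih θ)
  | res d _ ih => simp only [Tm.sub, Sub.up_eq, ← Sub.ren_lift]; exact .res _ (ih _)
  | head h _ ih => exact .head (h.sub θ) (ih θ)

/-- Only subjects that are names are preserved: a substitution may put at an exposed variable a term
that does not output at all. -/
theorem OutT.sub {Γ Γ' : List Ty} {T : Tm Γ .proc} {σ : Ty} {a : ℕ} {cs : List Ty}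
    {K : Tm Γ σ} {T' : Tm Γ .proc} (h : OutT T (.nm a) cs K T') (θ : Sub Γ Γ') :
    OutT (T.sub θ) (.nm a) cs (K.sub (θ.ren (ups cs))) (T'.sub (θ.ren (ups cs))) := by
  generalize hα : Chan.nm a = α at h
  induction h generalizing Γ' a with
  | out σ a K T => cases hα; simp only [Sub.ren_ups_nil]; exact .out _ _ _ _
  | app x K => cases hα
  | parL S _ ih => simp only [Tm.sub, ← Tm.sub_ren]; exact .parL _ (ih θ hα)
  | parR S _ ih => simp only [Tm.sub, ← Tm.sub_ren]; exact .parR _ (ih θ hα)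
  | res d _ ih =>
    subst hα
    have := ih (θ.up d) rfl
    simp only [Sub.up_eq, Sub.ren_ren, ← ups_cons] at this
    exact .res _ this
  | head h _ ih => exact .head (h.sub θ) (ih θ hα)

theorem TauT.sub {Γ Γ' : List Ty} {T T' : Tm Γ .proc} (h : TauT T T') (θ : Sub Γ Γ') :
    TauT (T.sub θ) (T'.sub θ) := by
  induction h generalizing Γ' with
  | comL h h' => rw [conc_sub]; exact .comL (h.sub θ) (h'.sub θ)
  | comR h h' => rw [conc'_sub]; exact .comR (h.sub θ) (h'.sub θ)
  | parL S _ ih => exact .parL _ (ih θ)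
  | parR S _ ih => exact .parR _ (ih θ)
  | res d _ ih => exact .res _ (ih _)
  | head h _ ih => exact .head (h.sub θ) (ih θ)

theorem Chan.ren_up_inj {Γ : List Ty} {σ d : Ty} {α β : Chan Γ σ} (h : α.ren (up d) = β.ren (up d)) :
    α = β := by
  cases α <;> cases β <;> simp only [Chan.ren, Chan.nm.injEq, Chan.vr.injEq, reduceCtorEq] at h ⊢
  · exact up_inj _ _ h
  · exact h

/-- The message comes from a component that does not know `c`. Whether `c` is extruded with it or
stays around its owner `T` is invisible once the output has been received. -/
theorem conc_res_par (c : Ty) {Γ : List Ty} {σ : Ty} (T : Tm Γ .proc) (cs : List Ty)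
    (K : Tm Γ σ) (T' : Tm Γ .proc) (E : Tm (σ :: Γ) .proc) :
    Struct (conc (c :: cs) (K.ren ((up c).lifts cs))
        (.par (T.ren (ups cs)) (T'.ren ((up c).lifts cs))) E)
      (conc cs K (.par ((Tm.res c T).ren (ups cs)) T') E) := by
  refine Struct.trans ?_ (conc_par_left _ _ _ _ _).symm
  rw [conc_cons]
  refine (Struct.res _ (conc_par_left _ _ _ _ _)).trans ?_
  rw [← conc_ren]
  exact .res_par _ _ _

/-! Structural congruence is a bisimulation for the transitions of closed processes. -/

/-- Every transition of `P` is matched by `Q` up to structural congruence. Outputs are compared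
through the contexts that receive them. -/
structure Simulated (P Q : Proc) : Prop where
  inp : ∀ {σ : Ty} {a : ℕ} {F : Tm [σ] .proc}, InpT P σ a F → ∃ F', InpT Q σ a F' ∧ Struct F F'
  out : ∀ {σ : Ty} {α : Chan [] σ} {cs : List Ty} {K : Tm [] σ} {T : Proc}, OutT P α cs K T →
    ∃ cs' K' T', OutT Q α cs' K' T' ∧ ∀ E, Struct (conc cs K T E) (conc cs' K' T' E)
  tau : ∀ {P' : Proc}, TauT P P' → ∃ Q', TauT Q Q' ∧ Struct P' Q'

namespace Simulated

theorem refl (P : Proc) : Simulated P P :=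
  ⟨fun h => ⟨_, h, .refl _⟩, fun h => ⟨_, _, _, h, fun _ => .refl _⟩, fun h => ⟨_, h, .refl _⟩⟩

theorem trans {P Q R : Proc} (h : Simulated P Q) (h' : Simulated Q R) : Simulated P R where
  inp t := by
    obtain ⟨F, t, e⟩ := h.inp t
    obtain ⟨F', t, e'⟩ := h'.inp t
    exact ⟨F', t, e.trans e'⟩
  out t := by
    obtain ⟨cs, K, T, t, e⟩ := h.out t
    obtain ⟨cs', K', T', t, e'⟩ := h'.out t
    exact ⟨cs', K', T', t, fun E => (e E).trans (e' E)⟩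
  tau t := by
    obtain ⟨F, t, e⟩ := h.tau t
    obtain ⟨F', t, e'⟩ := h'.tau t
    exact ⟨F', t, e.trans e'⟩

theorem nil (Q : Proc) : Simulated .nil Q where
  inp t := by cases t with | head h _ => cases h
  out t := by cases t with | head h _ => cases h
  tau t := by cases t with | head h _ => cases h

theorem inp_congr {σ : Ty} (a : ℕ) {T T' : Tm [σ] .proc} (h : Struct T T') :
    Simulated (.inp σ a T) (.inp σ a T') where
  inp t := by
    cases t with
    | inp => exact ⟨_, .inp _ _ _, h⟩
    | head h _ => cases h
  out t := by cases t with | head h _ => cases h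
  tau t := by cases t with | head h _ => cases h

theorem out_congr {σ : Ty} (a : ℕ) {K K' : Tm [] σ} {T T' : Proc} (h : Struct K K')
    (h' : Struct T T') : Simulated (.out σ a K T) (.out σ a K' T') where
  inp t := by cases t with | head h _ => cases h
  out t := by
    cases t with
    | out => exact ⟨_, _, _, .out _ _ _ _, fun E => conc_congr _ h h' (.refl _)⟩
    | head h _ => cases h
  tau t := by cases t with | head h _ => cases h

/-- The congruences `e` and `e'` are needed besides the simulations because an idle component
survives unchanged in the derivative. -/
theorem par_congr {P P' Q Q' : Proc} (h : Simulated P Q) (h' : Simulated P' Q')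
    (e : Struct P Q) (e' : Struct P' Q') : Simulated (.par P P') (.par Q Q') where
  inp t := by
    cases t with
    | parL S t =>
      obtain ⟨F, t, e⟩ := h.inp t
      exact ⟨_, .parL _ t, .par e (e'.wk _)⟩
    | parR S t =>
      obtain ⟨F, t, e'⟩ := h'.inp t
      exact ⟨_, .parR _ t, .par (e.wk _) e'⟩
    | head h _ => cases h
  out t := by
    cases t with
    | parL S t =>
      obtain ⟨cs, K, T, t, e⟩ := h.out t
      exact ⟨_, _, _, .parL _ t, fun E => (conc_par_right _ _ _ _ _).trans
        ((Struct.par (e E) e').trans (conc_par_right _ _ _ _ _).symm)⟩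
    | parR S t =>
      obtain ⟨cs, K, T, t, e'⟩ := h'.out t
      exact ⟨_, _, _, .parR _ t, fun E => (conc_par_left _ _ _ _ _).trans
        ((Struct.par e (e' E)).trans (conc_par_left _ _ _ _ _).symm)⟩
    | head h _ => cases h
  tau t := by
    cases t with
    | comL t t' =>
      obtain ⟨F, t, e⟩ := h.inp t
      obtain ⟨cs, K, T, t', e'⟩ := h'.out t'
      exact ⟨_, .comL t t', (conc_congr _ (.refl _) (.refl _) e).trans (e' _)⟩
    | comR t t' =>
      obtain ⟨cs, K, T, t, e⟩ := h.out t
      obtain ⟨F, t', e'⟩ := h'.inp t'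
      exact ⟨_, .comR t t', (conc_comm _ _ _ _).trans
        (((conc_congr _ (.refl _) (.refl _) e').trans (e _)).trans (conc_comm _ _ _ _).symm)⟩
    | parL S t =>
      obtain ⟨F, t, e⟩ := h.tau t
      exact ⟨_, .parL _ t, .par e e'⟩
    | parR S t =>
      obtain ⟨F, t, e'⟩ := h'.tau t
      exact ⟨_, .parR _ t, .par e e'⟩
    | head h _ => cases h

theorem res_congr (d : Ty) {P Q : Proc} (h : Simulated P Q) :
    Simulated (.res d P) (.res d Q) where
  inp t := by
    cases t with
    | res _ t =>
      obtain ⟨F, t, e⟩ := h.inp t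
      exact ⟨_, .res _ t, .res _ e⟩
    | head h _ => cases h
  out t := by
    cases t with
    | res _ t =>
      obtain ⟨cs, K, T, t, e⟩ := h.out t
      exact ⟨_, _, _, .res _ t, fun E => by rw [conc_cons, conc_cons]; exact .res _ (e _)⟩
    | head h _ => cases h
  tau t := by
    cases t with
    | res _ t =>
      obtain ⟨F, t, e⟩ := h.tau t
      exact ⟨_, .res _ t, .res _ e⟩
    | head h _ => cases h

/-- Weak head reduction is deterministic, so a closed redex has exactly the transitions of its
reduct. -/
theorem head_left {P P' Q : Proc} (h : Simulated P' Q) (e : Head P P') : Simulated P Q where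
  inp t := by
    cases t with
    | head e' t => cases e.det e'; exact h.inp t
    | _ => cases e
  out t := by
    cases t with
    | head e' t => cases e.det e'; exact h.out t
    | app x => cases x
    | _ => cases e
  tau t := by
    cases t with
    | head e' t => cases e.det e'; exact h.tau t
    | _ => cases e

theorem head_right {P Q Q' : Proc} (h : Simulated P Q') (e : Head Q Q') : Simulated P Q where
  inp t := by
    obtain ⟨F, t, e'⟩ := h.inp t
    exact ⟨F, .head e t, e'⟩
  out t := by
    obtain ⟨cs, K, T, t, e'⟩ := h.out t
    exact ⟨cs, K, T, .head e t, e'⟩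
  tau t := by
    obtain ⟨F, t, e'⟩ := h.tau t
    exact ⟨F, .head e t, e'⟩

theorem par_nil (P : Proc) : Simulated (.par P .nil) P where
  inp t := by
    cases t with
    | parL S t => exact ⟨_, t, .par_nil _⟩
    | parR S t => obtain ⟨F, t, _⟩ := (nil .nil).inp t; cases t with | head h _ => cases h
    | head h _ => cases h
  out t := by
    cases t with
    | parL S t => exact ⟨_, _, _, t, fun E => (conc_par_right _ _ _ _ _).trans (.par_nil _)⟩
    | parR S t => cases t with | head h _ => cases h
    | head h _ => cases h
  tau t := by
    cases t with
    | comL _ t => cases t with | head h _ => cases h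
    | comR _ t => cases t with | head h _ => cases h
    | parL S t => exact ⟨_, t, .par_nil _⟩
    | parR S t => cases t with | head h _ => cases h
    | head h _ => cases h

theorem nil_par (P : Proc) : Simulated P (.par P .nil) where
  inp t := ⟨_, .parL _ t, (Struct.par_nil _).symm⟩
  out t := ⟨_, _, _, .parL _ t,
    fun _ => ((conc_par_right _ _ _ _ _).trans (.par_nil _)).symm⟩
  tau t := ⟨_, .parL _ t, (Struct.par_nil _).symm⟩

theorem par_comm (P Q : Proc) : Simulated (.par P Q) (.par Q P) where
  inp t := by
    cases t with
    | parL S t => exact ⟨_, .parR _ t, .par_comm _ _⟩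
    | parR S t => exact ⟨_, .parL _ t, .par_comm _ _⟩
    | head h _ => cases h
  out t := by
    cases t with
    | parL S t => exact ⟨_, _, _, .parR _ t,
        fun E => conc_congr _ (.refl _) (.par_comm _ _) (.refl _)⟩
    | parR S t => exact ⟨_, _, _, .parL _ t,
        fun E => conc_congr _ (.refl _) (.par_comm _ _) (.refl _)⟩
    | head h _ => cases h
  tau t := by
    cases t with
    | comL t t' => exact ⟨_, .comR t' t, (conc_comm _ _ _ _).symm⟩
    | comR t t' => exact ⟨_, .comL t' t, conc_comm _ _ _ _⟩
    | parL S t => exact ⟨_, .parR _ t, .par_comm _ _⟩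
    | parR S t => exact ⟨_, .parL _ t, .par_comm _ _⟩
    | head h _ => cases h

theorem par_assoc (P Q R : Proc) : Simulated (.par P (.par Q R)) (.par (.par P Q) R) where
  inp t := by
    cases t with
    | parL S t => exact ⟨_, .parL _ (.parL _ t), .par_assoc _ _ _⟩
    | parR S t =>
      cases t with
      | parL S t => exact ⟨_, .parL _ (.parR _ t), .par_assoc _ _ _⟩
      | parR S t => exact ⟨_, .parR _ t, .par_assoc _ _ _⟩
      | head h _ => cases h
    | head h _ => cases h
  out t := by
    cases t with
    | parL S t => exact ⟨_, _, _, .parL _ (.parL _ t),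
        fun E => conc_congr _ (.refl _) (.par_assoc _ _ _) (.refl _)⟩
    | parR S t =>
      cases t with
      | parL S t => exact ⟨_, _, _, .parL _ (.parR _ t),
          fun E => conc_congr _ (.refl _) (.par_assoc _ _ _) (.refl _)⟩
      | parR S t => exact ⟨_, _, _, .parR _ t,
          fun E => conc_congr _ (.refl _) (.par_assoc _ _ _) (.refl _)⟩
      | head h _ => cases h
    | head h _ => cases h
  tau t := by
    cases t with
    | comL t t' =>
      cases t' with
      | parL S t' => exact ⟨_, .parL _ (.comL t t'), conc_par_right _ _ _ _ _⟩
      | parR S t' => exact ⟨_, .comL (.parL _ t) t', ((conc_par_left _ _ _ _ _).trans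
          (.par_comm _ _)).trans (conc_input_par _ _ _ _ _).symm⟩
      | head h _ => cases h
    | comR t t' =>
      cases t' with
      | parL S t' => exact ⟨_, .parL _ (.comR t t'), ((conc_comm _ _ _ _).trans
          (conc_input_par _ _ _ _ _)).trans (.par (conc_comm _ _ _ _).symm (.refl _))⟩
      | parR S t' => exact ⟨_, .comR (.parL _ t) t', (((conc_comm _ _ _ _).trans
          (conc_input_par' _ _ _ _ _)).trans (.par_comm _ _)).trans
          ((conc_comm _ _ _ _).trans (conc_par_right _ _ _ _ _)).symm⟩
      | head h _ => cases h
    | parL S t => exact ⟨_, .parL _ (.parL _ t), .par_assoc _ _ _⟩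
    | parR S t =>
      cases t with
      | comL t t' => exact ⟨_, .comL (.parR _ t) t', (conc_input_par' _ _ _ _ _).symm⟩
      | comR t t' => exact ⟨_, .comR (.parR _ t) t', (Struct.par (.refl _)
          (conc_comm _ _ _ _)).trans ((conc_comm _ _ _ _).trans (conc_par_left _ _ _ _ _)).symm⟩
      | parL S t => exact ⟨_, .parL _ (.parR _ t), .par_assoc _ _ _⟩
      | parR S t => exact ⟨_, .parR _ t, .par_assoc _ _ _⟩
      | head h _ => cases h
    | head h _ => cases h

/-- The mirror image of `par_assoc`, obtained by conjugation with `par_comm`. -/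
theorem assoc_par (P Q R : Proc) : Simulated (.par (.par P Q) R) (.par P (.par Q R)) := by
  refine (par_comm _ _).trans (((refl R).par_congr (par_comm P Q) (.refl _)
    (.par_comm _ _)).trans ((par_assoc _ _ _).trans ((par_comm _ _).trans
    ((refl P).par_congr (par_comm _ _) (.refl _) (.par_comm _ _)))))

theorem res_comm (c d : Ty) (P : Proc) :
    Simulated (.res c (.res d P)) (.res d (.res c (P.ren (exch c [d])))) where
  inp t := by
    cases t with
    | res _ t =>
      cases t with
      | res _ t =>
        have t := t.ren (exch c [d])
        rw [exch_singleton_up] at t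
        exact ⟨_, .res _ (.res _ t), .res_comm _ _ _⟩
      | head h _ => cases h
    | head h _ => cases h
  out t := by
    rename_i α _ _ _
    cases t with
    | res _ t =>
      cases t with
      | res _ t =>
        have t := t.ren (exch c [d])
        have e : ((α.ren (up c)).ren (up d)).ren (exch c [d]) = (α.ren (up d)).ren (up c) := by
          cases α <;> simp only [Chan.ren, exch_singleton_up]
        rw [e] at t
        refine ⟨_, _, _, .res _ (.res _ t), fun E => ?_⟩
        simp only [conc_cons]
        refine (Struct.res_comm _ _ _).trans (.of_eq ?_)
        rw [conc_ren]
        simp only [Tm.ren_ren, exch_singleton_up]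
      | head h _ => cases h
    | head h _ => cases h
  tau t := by
    cases t with
    | res _ t =>
      cases t with
      | res _ t => exact ⟨_, .res _ (.res _ (t.ren _)), .res_comm _ _ _⟩
      | head h _ => cases h
    | head h _ => cases h

theorem res_inp (c : Ty) (T : Tm [c] .proc) (Q : Proc) : Simulated (.res c (.inp c 0 T)) Q where
  inp t := by
    cases t with
    | res _ t =>
      generalize hb : up c _ _ = b at t
      cases t with
      | inp => simp [up] at hb
      | head h _ => cases h
    | head h _ => cases h
  out t := by
    cases t with
    | res _ t => cases t with | head h _ => cases h
    | head h _ => cases h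
  tau t := by
    cases t with
    | res _ t => cases t with | head h _ => cases h
    | head h _ => cases h

theorem res_out (c : Ty) (K : Tm [] c) (T Q : Proc) : Simulated (.res c (.out c 0 K T)) Q where
  inp t := by
    cases t with
    | res _ t => cases t with | head h _ => cases h
    | head h _ => cases h
  out t := by
    rename_i α _ _ _
    cases t with
    | res _ t =>
      generalize hb : α.ren (up c) = b at t
      cases t with
      | out => cases α <;> simp [Chan.ren, up] at hb
      | head h _ => cases h
    | head h _ => cases h
  tau t := by
    cases t with
    | res _ t => cases t with | head h _ => cases h
    | head h _ => cases h

/-- `Q` is weakened past `c`, so its transitions are pulled back along the injective `up c`, and its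
subjects are never `c`. -/
theorem res_par (c : Ty) (P Q : Proc) :
    Simulated (.res c (.par P (Q.ren (up c)))) (.par (.res c P) Q) where
  inp t := by
    cases t with
    | res _ t =>
      cases t with
      | parL S t =>
        refine ⟨_, .parL _ (.res _ t), ?_⟩
        rw [← Tm.wk_ren]
        exact .res_par _ _ _
      | parR S t =>
        obtain ⟨b, F, hb, t, rfl⟩ := t.exists_ren
        cases up_inj _ _ hb
        exact ⟨_, .parR _ t, .res_par _ _ _⟩
      | head h _ => cases h
    | head h _ => cases h
  out t := by
    cases t with
    | res _ t =>
      cases t with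
      | parL S t =>
        refine ⟨_, _, _, .parL _ (.res _ t), fun E => ?_⟩
        rw [Tm.ren_ups_cons]
        exact .refl _
      | parR S t =>
        obtain ⟨b, K, T, hb, t, rfl, rfl⟩ := t.exists_ren
        cases Chan.ren_up_inj hb
        exact ⟨_, _, _, .parR _ t, fun E => conc_res_par _ _ _ _ _ _⟩
      | head h _ => cases h
    | head h _ => cases h
  tau t := by
    cases t with
    | res _ t =>
      cases t with
      | comL t t' =>
        obtain ⟨β, K, T, hb, u, rfl, rfl⟩ := t'.exists_ren
        cases β <;> cases hb
        exact ⟨_, .comL (.res _ t) u, (conc_input_res _ _ _ _ _).symm⟩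
      | comR t t' =>
        obtain ⟨b, F, rfl, u, rfl⟩ := t'.exists_ren
        refine ⟨_, .comR (.res _ t) u, (Struct.res _ (conc_comm _ _ _ _)).trans
          (.trans ?_ (conc_comm _ _ _ _).symm)⟩
        rw [conc_cons]
        exact .refl _
      | parL S t => exact ⟨_, .parL _ (.res _ t), .res_par _ _ _⟩
      | parR S t =>
        obtain ⟨T', u, rfl⟩ := t.exists_ren (up_inj _)
        exact ⟨_, .parR _ u, .res_par _ _ _⟩
      | head h _ => cases h
    | head h _ => cases h

theorem par_res (c : Ty) (P Q : Proc) :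
    Simulated (.par (.res c P) Q) (.res c (.par P (Q.ren (up c)))) where
  inp t := by
    cases t with
    | parL S t =>
      cases t with
      | res _ t =>
        refine ⟨_, .res _ (.parL _ t), ?_⟩
        rw [← Tm.wk_ren]
        exact (Struct.res_par _ _ _).symm
      | head h _ => cases h
    | parR S t => exact ⟨_, .res _ (.parR _ (t.ren _)), (Struct.res_par _ _ _).symm⟩
    | head h _ => cases h
  out t := by
    cases t with
    | parL S t =>
      cases t with
      | res _ t =>
        refine ⟨_, _, _, .res _ (.parL _ t), fun E => ?_⟩
        rw [Tm.ren_ups_cons]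
        exact .refl _
      | head h _ => cases h
    | parR S t =>
      exact ⟨_, _, _, .res _ (.parR _ (t.ren _)), fun E => (conc_res_par _ _ _ _ _ _).symm⟩
    | head h _ => cases h
  tau t := by
    cases t with
    | comL t t' =>
      cases t with
      | res _ t => exact ⟨_, .res _ (.comL t (t'.ren _)), conc_input_res _ _ _ _ _⟩
      | head h _ => cases h
    | comR t t' =>
      cases t with
      | res _ t =>
        refine ⟨_, .res _ (.comR t (t'.ren _)), .trans ?_
          (Struct.res _ (conc_comm _ _ _ _)).symm⟩
        rw [← conc_cons]
        exact conc_comm _ _ _ _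
      | head h _ => cases h
    | parL S t =>
      cases t with
      | res _ t => exact ⟨_, .res _ (.parL _ t), (Struct.res_par _ _ _).symm⟩
      | head h _ => cases h
    | parR S t => exact ⟨_, .res _ (.parR _ (t.ren _)), (Struct.res_par _ _ _).symm⟩
    | head h _ => cases h

end Simulated

/-- Each process simulates the other up to structural congruence. -/
def Similar (P Q : Proc) : Prop := Simulated P Q ∧ Simulated Q P

theorem Law.similar {P Q : Proc} (h : Law P Q) : Similar P Q := by
  cases h with
  | par_nil T => exact ⟨.par_nil _, .nil_par _⟩
  | par_assoc T T' T'' => exact ⟨.par_assoc _ _ _, .assoc_par _ _ _⟩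
  | par_comm T T' => exact ⟨.par_comm _ _, .par_comm _ _⟩
  | res_comm c d T =>
    refine ⟨.res_comm _ _ _, ?_⟩
    -- Exchanging twice is the identity, so the converse is the same law with `c` and `d` swapped.
    have := Simulated.res_comm d c (T.ren (exch c [d]))
    rwa [Tm.ren_ren, exch_singleton_invol, Tm.ren_id] at this
  | res_inp c T => exact ⟨.res_inp _ _ _, .nil _⟩
  | res_out c K T => exact ⟨.res_out _ _ _ _, .nil _⟩
  | res_par c T T' => exact ⟨.res_par _ _ _, .par_res _ _ _⟩

/-- The logical relation over `Similar`, closed under renaming of names. -/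
def LogEq : {τ : Ty} → Tm [] τ → Tm [] τ → Prop
  | .proc, P, Q => Struct P Q ∧ ∀ ρ : Ren, Similar (P.ren ρ) (Q.ren ρ)
  | .arr σ _, F, G => Struct F G ∧ ∀ (ρ : Ren) (K K' : Tm [] σ), LogEq K K' →
      LogEq (.app (F.ren ρ) K) (.app (G.ren ρ) K')

/-! ### The logical relation: closure properties and the fundamental lemma. -/

namespace LogEq

theorem struct : {τ : Ty} → {F G : Tm [] τ} → LogEq F G → Struct F G
  | .proc, _, _, h => h.1
  | .arr _ _, _, _, h => h.1

theorem ren {τ : Ty} {F G : Tm [] τ} (h : LogEq F G) (ρ : Ren) : LogEq (F.ren ρ) (G.ren ρ) := by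
  refine (match τ, F, G, h with
  | .proc, P, Q, h => ⟨h.1.ren ρ, fun _ => ?_⟩
  | .arr _ _, F, G, h => ⟨h.1.ren ρ, fun _ _ _ hK => ?_⟩)
  · simp only [Tm.ren_ren]; exact h.2 _
  · simp only [Tm.ren_ren]; exact h.2 _ _ _ hK

theorem symm {τ : Ty} {F G : Tm [] τ} (h : LogEq F G) : LogEq G F := by
  induction τ with
  | proc => exact ⟨h.1.symm, fun ρ => (h.2 ρ).symm⟩
  | arr σ τ ihσ ihτ => exact ⟨h.1.symm, fun ρ K K' hK => ihτ (h.2 ρ _ _ (ihσ hK))⟩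

theorem trans {τ : Ty} {F G H : Tm [] τ} (h : LogEq F G) (h' : LogEq G H) : LogEq F H := by
  induction τ with
  | proc => exact ⟨h.1.trans h'.1,
      fun ρ => ⟨(h.2 ρ).1.trans (h'.2 ρ).1, (h'.2 ρ).2.trans (h.2 ρ).2⟩⟩
  | arr σ τ ihσ ihτ => exact ⟨h.1.trans h'.1,
      -- Reflexivity is not yet available, but `K'` is related to itself by way of `K`.
      fun ρ K K' hK => ihτ (h.2 ρ _ _ hK) (h'.2 ρ _ _ (ihσ hK.symm hK))⟩

/-- Closure under head expansion makes β sound at every type: a redex of abstraction type receives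
arguments until it is a process, and there it has the transitions of its reduct. -/
theorem head {τ : Ty} {F F' G : Tm [] τ} (h : LogEq F' G) (e : Head F F') : LogEq F G := by
  induction τ with
  | proc => exact ⟨e.struct.trans h.1,
      fun ρ => ⟨(h.2 ρ).1.head_left (e.ren ρ), (h.2 ρ).2.head_right (e.ren ρ)⟩⟩
  | arr σ τ _ ihτ => exact ⟨e.struct.trans h.1,
      fun ρ K K' hK => ihτ (h.2 ρ _ _ hK) (.app _ (e.ren ρ))⟩

theorem nil : LogEq .nil .nil := ⟨.refl _, fun _ => ⟨.refl _, .refl _⟩⟩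

/-- Congruent bodies suffice: a late input exposes the body without running it, and derivatives are
only compared up to `≡`. The relation is thus never needed below an input. -/
theorem inp {σ : Ty} (a : ℕ) {T T' : Tm [σ] .proc} (h : Struct T T') :
    LogEq (.inp σ a T) (.inp σ a T') :=
  ⟨.inp _ _ h, fun _ => ⟨.inp_congr _ (h.ren _), .inp_congr _ (h.symm.ren _)⟩⟩

theorem out {σ : Ty} (a : ℕ) {K K' : Tm [] σ} {T T' : Proc} (h : LogEq K K') (h' : LogEq T T') :
    LogEq (.out σ a K T) (.out σ a K' T') :=
  ⟨.out _ _ h.struct h'.1, fun ρ => ⟨.out_congr _ (h.struct.ren ρ) (h'.1.ren ρ),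
    .out_congr _ (h.struct.symm.ren ρ) (h'.1.symm.ren ρ)⟩⟩

theorem par {P P' Q Q' : Proc} (h : LogEq P Q) (h' : LogEq P' Q') :
    LogEq (.par P P') (.par Q Q') :=
  ⟨.par h.1 h'.1, fun ρ => ⟨.par_congr (h.2 ρ).1 (h'.2 ρ).1 (h.1.ren ρ) (h'.1.ren ρ),
    .par_congr (h.2 ρ).2 (h'.2 ρ).2 (h.1.symm.ren ρ) (h'.1.symm.ren ρ)⟩⟩

theorem res (d : Ty) {P Q : Proc} (h : LogEq P Q) : LogEq (.res d P) (.res d Q) :=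
  ⟨.res _ h.1, fun _ => ⟨.res_congr _ (h.2 _).1, .res_congr _ (h.2 _).2⟩⟩

theorem app {σ τ : Ty} {F F' : Tm [] (.arr σ τ)} {K K' : Tm [] σ} (h : LogEq F F')
    (h' : LogEq K K') : LogEq (.app F K) (.app F' K') := by
  simpa only [Tm.ren_id] using h.2 (fun _ n => n) _ _ h'

theorem law {P Q : Proc} (h : Law P Q) : LogEq P Q := ⟨h.struct, fun ρ => (h.ren ρ).similar⟩

/-- Pointwise related substitutions. -/
def Subs {Γ : List Ty} (θ θ' : Sub Γ []) : Prop := ∀ s x, LogEq (θ s x) (θ' s x)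

theorem Subs.ren {Γ : List Ty} {θ θ' : Sub Γ []} (h : Subs θ θ') (ρ : Ren) :
    Subs (θ.ren ρ) (θ'.ren ρ) := fun s x => (h s x).ren ρ

theorem Subs.cons {Γ : List Ty} {θ θ' : Sub Γ []} (h : Subs θ θ') {σ : Ty} {K K' : Tm [] σ}
    (h' : LogEq K K') : Subs (θ.cons K) (θ'.cons K') := by
  intro s x
  cases x with
  | zero => exact h'
  | succ x => exact h _ x

theorem Subs.left {Γ : List Ty} {θ θ' : Sub Γ []} (h : Subs θ θ') : Subs θ θ :=
  fun s x => (h s x).trans (h s x).symm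

theorem Subs.symm {Γ : List Ty} {θ θ' : Sub Γ []} (h : Subs θ θ') : Subs θ' θ :=
  fun s x => (h s x).symm

theorem struct_sub_lift {Γ : List Ty} {σ τ : Ty} {T T' : Tm (σ :: Γ) τ} (e : Struct T T')
    {θ θ' : Sub Γ []} (h : Subs θ θ') : Struct (T.sub (θ.lift σ)) (T'.sub (θ'.lift σ)) := by
  refine (e.sub _).trans (Struct.sub_congr _ ?_)
  intro s x
  cases x with
  | zero => exact .refl _
  | succ x => exact (h _ x).struct.wk _

/-- Applied to related arguments, both abstractions head reduce to their bodies under extended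
substitutions. The renaming `ρ'` is absorbed because `ih` quantifies over all renamings. -/
theorem lam {Γ : List Ty} {σ τ : Ty} {T T' : Tm (σ :: Γ) τ} (e : Struct T T')
    (ih : ∀ (ρ : Ren) (θ θ' : Sub (σ :: Γ) []), Subs θ θ' →
      LogEq ((T.ren ρ).sub θ) ((T'.ren ρ).sub θ'))
    (ρ : Ren) {θ θ' : Sub Γ []} (h : Subs θ θ') :
    LogEq (((Tm.lam T).ren ρ).sub θ) (((Tm.lam T').ren ρ).sub θ') := by
  refine ⟨.lam (struct_sub_lift (e.ren ρ) h), fun ρ' K K' hK => ?_⟩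
  have key : ∀ (T : Tm (σ :: Γ) τ) (θ : Sub Γ []) (K : Tm [] σ),
      Head (.app ((((Tm.lam T).ren ρ).sub θ).ren ρ') K)
        (((T.ren ρ).ren ρ').sub ((θ.ren ρ').cons K)) := by
    intro T θ K
    rw [← Tm.sub_lift_inst, Sub.ren_lift, ← Tm.sub_ren]
    exact .beta _ _
  refine LogEq.head (LogEq.symm (LogEq.head (LogEq.symm ?_) (key T' θ' K'))) (key T θ K)
  simp only [Tm.ren_ren]
  exact ih _ _ _ ((h.ren ρ').cons hK)

/-- The fundamental lemma for a single term; it supplies the reflexivity that a logical relation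
lacks by construction. -/
theorem of_tm {Γ : List Ty} {τ : Ty} (T : Tm Γ τ) (ρ : Ren) (θ θ' : Sub Γ []) (h : Subs θ θ') :
    LogEq ((T.ren ρ).sub θ) ((T.ren ρ).sub θ') := by
  induction T generalizing ρ with
  | var x => exact h _ x
  | nil => exact nil
  | inp σ a T ih => exact inp _ (struct_sub_lift (.refl _) h)
  | out σ a K T ih ih' => exact out _ (ih _ _ _ h) (ih' _ _ _ h)
  | par T T' ih ih' => exact par (ih _ _ _ h) (ih' _ _ _ h)
  | res d T ih => exact res _ (ih _ _ _ (h.ren _))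
  | lam T ih => exact lam (.refl _) (fun ρ θ θ' h => ih ρ θ θ' h) ρ h
  | app F K ih ih' => exact app (ih _ _ _ h) (ih' _ _ _ h)

theorem of_law {Γ : List Ty} {T T' : Tm Γ .proc} (e : Law T T') (ρ : Ren) (θ θ' : Sub Γ [])
    (h : Subs θ θ') : LogEq ((T.ren ρ).sub θ) ((T'.ren ρ).sub θ') :=
  (law ((e.ren ρ).sub θ)).trans (of_tm _ _ _ _ h)

/-- The fundamental lemma for `≡`. Congruence may rewrite the function of an application, a position
where `Similar` is not even defined, so the induction has to carry the relation at all types. -/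
theorem of_struct {Γ : List Ty} {τ : Ty} {T T' : Tm Γ τ} (e : Struct T T') (ρ : Ren)
    (θ θ' : Sub Γ []) (h : Subs θ θ') : LogEq ((T.ren ρ).sub θ) ((T'.ren ρ).sub θ') := by
  induction e generalizing ρ with
  | refl T => exact of_tm _ _ _ _ h
  | symm _ ih => exact (ih _ _ _ h.symm).symm
  | trans _ _ ih ih' => exact (ih _ _ _ h.left).trans (ih' _ _ _ h)
  | inp σ a e ih => exact inp _ (struct_sub_lift (e.ren _) h)
  | out σ a _ _ ih ih' => exact out _ (ih _ _ _ h) (ih' _ _ _ h)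
  | par _ _ ih ih' => exact par (ih _ _ _ h) (ih' _ _ _ h)
  | res d _ ih => exact res _ (ih _ _ _ (h.ren _))
  | lam e ih => exact lam e (fun ρ θ θ' h => ih ρ θ θ' h) ρ h
  | app _ _ ih ih' => exact app (ih _ _ _ h) (ih' _ _ _ h)
  | par_nil T => exact of_law (.par_nil _) _ _ _ h
  | par_assoc T T' T'' => exact of_law (.par_assoc _ _ _) _ _ _ h
  | par_comm T T' => exact of_law (.par_comm _ _) _ _ _ h
  | res_comm c d T => exact of_law (.res_comm _ _ _) _ _ _ h
  | res_inp c T => exact of_law (.res_inp _ _) _ _ _ h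
  | res_out c K T => exact of_law (.res_out _ _ _) _ _ _ h
  | res_par c T T' => exact of_law (.res_par _ _ _) _ _ _ h
  | beta T K =>
    -- β is the head expansion of reflexivity for the contracted term.
    refine head (F' := ((T.inst K).ren ρ).sub θ) (of_tm _ _ _ _ h) ?_
    rw [Tm.inst_ren, Tm.inst_sub]
    exact .beta _ _

end LogEq

theorem Struct.simulated {P Q : Proc} (h : Struct P Q) : Simulated P Q := by
  have := ((LogEq.of_struct h (fun _ n => n) (fun _ x => .var x) (fun _ x => .var x)
    (fun s x => by cases x)).2 (fun _ n => n)).1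
  simpa only [Tm.ren_id, Tm.sub_id] using this

/-! The labelled transitions are those above, up to structural congruence. -/

theorem Tm.ren_exch_nil {Γ : List Ty} {τ : Ty} (T : Tm Γ τ) (d : Ty) : T.ren (exch d []) = T := by
  rw [exch_nil, Tm.ren_id]

theorem Step.of_struct_left {P Q R : Proc} {act : Act} (h : Struct P Q) (t : Step Q act R) :
    Step P act R := .struct _ h t (.refl _)

theorem Step.of_struct_right {P Q R : Proc} {act : Act} (t : Step P act Q) (h : Struct Q R) :
    Step P act R := .struct _ (.refl _) t h

theorem InpT.step {P : Proc} {σ : Ty} {a : ℕ} {F : Tm [σ] .proc} (h : InpT P σ a F)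
    (A : Tm [] σ) : Step P (.inp σ a A) (F.inst A) := by
  induction h with
  | inp σ a T => exact .inp _ _ _ _
  | parL S _ ih =>
    have := Step.parL _ S (ih A)
    rw [Tm.inst_par, Tm.wk_inst]
    simpa only [Act.bn, Tm.ren_ups_nil] using this
  | parR S _ ih =>
    have := Step.parR _ S (ih A)
    rw [Tm.inst_par, Tm.wk_inst]
    simpa only [Act.bn, Tm.ren_ups_nil] using this
  | res d _ ih =>
    have := Step.res d (.inp _ _ A) (ih (A.ren (up d)))
    rw [Tm.inst_res]
    simpa only [Act.bn, Tm.ren_exch_nil] using this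
  | head h _ ih => exact (ih A).of_struct_left h.struct

/-- Opening a restriction requires its name to occur in the message, whereas `OutT` extrudes every
restricted name. Hence the message is exchanged for a congruent `K'` in which all of them occur. -/
theorem OutT.step {P : Proc} {σ : Ty} {a : ℕ} {cs : List Ty} {K T : Tm [] _}
    (h : OutT P (.nm (σ := σ) a) cs K T) (K' : Tm [] σ) (hK : Struct K K')
    (hn : ∀ d i, i < cs.count d → K'.HasFn d i) : Step P (.out cs σ a K') T := by
  generalize hα : Chan.nm a = α at h
  induction h generalizing a with
  | out σ b K T =>
    cases hα
    exact (Step.out _ _ _ _).of_struct_left (.out _ _ hK (.refl _))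
  | app x => cases x
  | parL S _ ih => exact .parL _ _ (ih K' hK hn hα)
  | parR S _ ih => exact .parR _ _ (ih K' hK hn hα)
  | @res d _ _ _ cs _ _ _ ih =>
    subst hα
    refine .opn _ _ _ _ _ (ih K' hK (fun s i hi => hn s i ?_) rfl) (hn d _ (by simp))
    exact hi.trans_le (by rw [List.count_cons]; omega)
  | head h _ ih => exact (ih K' hK hn hα).of_struct_left h.struct

/-- A term is structurally congruent to one in which given names occur. -/
theorem exists_struct_hasFn {σ : Ty} (K : Tm [] σ) (cs : List Ty) :
    ∃ K', Struct K K' ∧ ∀ d i, i < cs.count d → K'.HasFn d i := by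
  have : ∃ D : Proc, ∀ d i, i < cs.count d → D.HasFn d i := by
    induction cs with
    | nil => exact ⟨.nil, fun d i h => by simp at h⟩
    | cons c cs ih =>
      obtain ⟨D, hD⟩ := ih
      -- `c` is bound outside `cs`, so below `cs` it is the name `cs.count c` of its sort.
      refine ⟨.par D (.inp c (cs.count c) .nil), fun d i h => ?_⟩
      rw [List.count_cons] at h
      by_cases hi : i < cs.count d
      · exact .inl (hD d i hi)
      · by_cases hc : c = d
        · subst hc
          refine .inr (.inl ⟨rfl, ?_⟩)
          simp only [beq_self_eq_true, if_true] at h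
          omega
        · simp [hc] at h
          omega
  obtain ⟨D, hD⟩ := this
  -- Free names are not invariant under `≡`: a vacuous β-redex with argument `D` is congruent to `K`
  -- and mentions all names of `D`.
  refine ⟨.app (.lam (K.wk .proc)) D, ?_, fun d i h => .inr (hD d i h)⟩
  have := Struct.beta (K.wk .proc) D
  rw [Tm.wk_inst] at this
  exact this.symm

theorem OutT.exists_step {P : Proc} {σ : Ty} {a : ℕ} {cs : List Ty} {K T : Tm [] _}
    (h : OutT P (.nm (σ := σ) a) cs K T) : ∃ K', Struct K K' ∧ Step P (.out cs σ a K') T := by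
  obtain ⟨K', hK, hn⟩ := exists_struct_hasFn K cs
  exact ⟨K', hK, h.step K' hK hn⟩

theorem TauT.step {P P' : Proc} (h : TauT P P') : Step P .tau P' := by
  induction h with
  | comL h h' =>
    obtain ⟨K', hK, t⟩ := h'.exists_step
    exact (Step.comL _ _ _ _ ((h.ren (ups _)).step K') t).of_struct_right
      (conc_congr _ hK.symm (.refl _) (.refl _))
  | comR h' h =>
    obtain ⟨K', hK, t⟩ := h'.exists_step
    exact (Step.comR _ _ _ _ t ((h.ren (ups _)).step K')).of_struct_right
      (.ress _ (.par (.refl _) (.inst (.refl _) hK.symm)))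
  | parL S _ ih => simpa only [Act.bn, Tm.ren_ups_nil] using Step.parL _ S ih
  | parR S _ ih => simpa only [Act.bn, Tm.ren_ups_nil] using Step.parR _ S ih
  | res d _ ih => simpa only [Act.bn, Tm.ren_exch_nil] using Step.res d .tau ih
  | head h _ ih => exact ih.of_struct_left h.struct

/-- `P` has a transition with the label `act` to `P'` up to structural congruence. -/
def Matches (P : Proc) : Act → Proc → Prop
  | .tau, P' => ∃ Q, TauT P Q ∧ Struct Q P'
  | .inp σ a A, P' => ∃ F, InpT P σ a F ∧ Struct (F.inst A) P'
  | .out cs σ a A, P' => ∃ cs' K T, OutT P (.nm (σ := σ) a) cs' K T ∧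
      ∀ E, Struct (conc cs' K T E) (conc cs A P' E)

/-- Here `Struct.simulated` absorbs the closure of labelled transitions under `≡`. -/
theorem Matches.struct {P Q Q' R : Proc} {act : Act} (h : Struct P Q) (t : Matches Q act Q')
    (h' : Struct Q' R) : Matches P act R := by
  have s := h.symm.simulated
  cases act with
  | tau =>
    obtain ⟨_, t, e⟩ := t
    obtain ⟨_, t, e'⟩ := s.tau t
    exact ⟨_, t, e'.symm.trans (e.trans h')⟩
  | inp σ a A =>
    obtain ⟨_, t, e⟩ := t
    obtain ⟨_, t, e'⟩ := s.inp t
    exact ⟨_, t, (Struct.inst e'.symm (.refl _)).trans (e.trans h')⟩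
  | out cs σ a A =>
    obtain ⟨_, _, _, t, e⟩ := t
    obtain ⟨_, _, _, t, e'⟩ := s.out t
    exact ⟨_, _, _, t, fun E => (e' E).symm.trans
      ((e E).trans (conc_congr _ (.refl _) h' (.refl _)))⟩

/-- `Step.res` keeps a restriction absent from the message where `OutT` extrudes it; in a receiving
context the two placements are congruent. -/
theorem conc_res_ren_exch {σ : Ty} (d : Ty) (cs : List Ty) (A : Tm [] σ) (T : Proc)
    (E : Tm [σ] .proc) :
    Struct (.res d (conc cs (A.ren ((up d).lifts cs)) T (E.ren (up d))))
      (conc cs A (.res d (T.ren (exch d cs))) E) := by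
  refine (Struct.res_ress _ _ _).trans (.ress _ (.trans (.of_eq ?_) (.par_res _ _ _)))
  simp only [Tm.ren, Tm.inst_ren, Tm.ren_ren, exch_lifts_up, exch_ups_up]

theorem Step.matches {P P' : Proc} {act : Act} (h : Step P act P') : Matches P act P' := by
  induction h with
  | inp σ a T A => exact ⟨_, .inp _ _ _, .refl _⟩
  | out σ a A T => exact ⟨_, _, _, .out _ _ _ _, fun _ => .refl _⟩
  | res d act _ ih =>
    cases act with
    | tau =>
      obtain ⟨_, t, e⟩ := ih
      exact ⟨_, .res _ t, .res _ (by simpa only [Act.bn, Tm.ren_exch_nil] using e)⟩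
    | inp σ a A =>
      obtain ⟨_, t, e⟩ := ih
      refine ⟨_, .res _ t, ?_⟩
      rw [Tm.inst_res]
      exact .res _ (by simpa only [Act.bn, Tm.ren_exch_nil] using e)
    | out cs σ a A =>
      obtain ⟨_, _, _, t, e⟩ := ih
      refine ⟨_, _, _, .res _ t, fun E => ?_⟩
      rw [conc_cons]
      exact (Struct.res _ (e _)).trans (conc_res_ren_exch _ _ _ _ _)
  | opn d cs σ a A _ _ ih =>
    obtain ⟨_, _, _, t, e⟩ := ih
    refine ⟨_, _, _, .res _ t, fun E => ?_⟩
    rw [conc_cons, conc_cons]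
    exact .res _ (e _)
  | parL act S _ ih =>
    cases act with
    | tau =>
      obtain ⟨_, t, e⟩ := ih
      exact ⟨_, .parL _ t, .par e (.of_eq (Tm.ren_ups_nil _).symm)⟩
    | inp σ a A =>
      obtain ⟨_, t, e⟩ := ih
      refine ⟨_, .parL _ t, ?_⟩
      rw [Tm.inst_par, Tm.wk_inst]
      exact .par e (.of_eq (Tm.ren_ups_nil _).symm)
    | out cs σ a A =>
      obtain ⟨_, _, _, t, e⟩ := ih
      exact ⟨_, _, _, .parL _ t, fun E => (conc_par_right _ _ _ _ _).trans
        ((Struct.par (e E) (.refl _)).trans (conc_par_right _ _ _ _ _).symm)⟩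
  | parR act S _ ih =>
    cases act with
    | tau =>
      obtain ⟨_, t, e⟩ := ih
      exact ⟨_, .parR _ t, .par (.of_eq (Tm.ren_ups_nil _).symm) e⟩
    | inp σ a A =>
      obtain ⟨_, t, e⟩ := ih
      refine ⟨_, .parR _ t, ?_⟩
      rw [Tm.inst_par, Tm.wk_inst]
      exact .par (.of_eq (Tm.ren_ups_nil _).symm) e
    | out cs σ a A =>
      obtain ⟨_, _, _, t, e⟩ := ih
      exact ⟨_, _, _, .parR _ t, fun E => (conc_par_left _ _ _ _ _).trans
        ((Struct.par (.refl _) (e E)).trans (conc_par_left _ _ _ _ _).symm)⟩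
  | comL cs σ a A _ _ ih ih' =>
    obtain ⟨_, t, e⟩ := ih
    obtain ⟨_, _, _, t', e'⟩ := ih'
    -- The receiver was weakened past the extruded names, so its input exists before the weakening.
    obtain ⟨b, F, hb, u, rfl⟩ := t.exists_ren
    cases ups_inj _ _ hb
    exact ⟨_, .comL u t', (e' _).trans (.ress _ (.par e (.refl _)))⟩
  | comR cs σ a A _ _ ih' ih =>
    obtain ⟨_, t, e⟩ := ih
    obtain ⟨_, _, _, t', e'⟩ := ih'
    obtain ⟨b, F, hb, u, rfl⟩ := t.exists_ren
    cases ups_inj _ _ hb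
    exact ⟨_, .comR t' u, (conc_comm _ _ _ _).trans
      ((e' _).trans (.ress _ ((Struct.par_comm _ _).trans (.par (.refl _) e))))⟩
  | struct act h _ h' ih => exact ih.struct h h'

/-! Weak internal moves up to structural congruence. -/

/-- `P` reaches `Q` by internal transitions, up to structural congruence. -/
def Weak (P Q : Proc) : Prop := ∃ P', Taus P P' ∧ Struct P' Q

namespace Weak

theorem of_struct {P Q : Proc} (h : Struct P Q) : Weak P Q := ⟨P, .refl, h⟩

theorem of_step {P Q : Proc} (h : Step P .tau Q) : Weak P Q := ⟨Q, .single h, .refl _⟩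

/-- A congruence can be absorbed into a first step, but an empty sequence has none; hence the final
congruence allowed in `Weak`. -/
theorem of_struct_taus {P Q R : Proc} (h : Struct P Q) (t : Taus Q R) : Weak P R := by
  rcases Relation.ReflTransGen.cases_head t with rfl | ⟨Q', s, t⟩
  · exact of_struct h
  · exact ⟨R, .head (s.of_struct_left h) t, .refl _⟩

theorem trans {P Q R : Proc} (h : Weak P Q) (h' : Weak Q R) : Weak P R := by
  obtain ⟨P', t, e⟩ := h
  obtain ⟨Q', t', e'⟩ := h'
  obtain ⟨P'', t'', e''⟩ := of_struct_taus e t'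
  exact ⟨P'', t.trans t'', e''.trans e'⟩

theorem par {P Q : Proc} (h : Weak P Q) (R : Proc) : Weak (.par P R) (.par Q R) := by
  obtain ⟨P', t, e⟩ := h
  refine ⟨.par P' R, t.lift (fun P => Tm.par P R) ?_, .par e (.refl _)⟩
  intro P Q s
  simpa only [Act.bn, Tm.ren_ups_nil] using Step.parL _ R s

theorem res {P Q : Proc} (d : Ty) (h : Weak P Q) : Weak (.res d P) (.res d Q) := by
  obtain ⟨P', t, e⟩ := h
  refine ⟨.res d P', t.lift (Tm.res d) ?_, .res _ e⟩
  intro P Q s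
  simpa only [Act.bn, Tm.ren_exch_nil] using Step.res d .tau s

theorem step {P Q R : Proc} {act : Act} (h : Weak P Q) (s : Step Q act R) :
    ∃ P', Taus P P' ∧ Step P' act R := by
  obtain ⟨P', t, e⟩ := h
  exact ⟨P', t, s.of_struct_left e⟩

end Weak

/-! Terms headed by a variable. -/

/-- Iterated applications of a variable. -/
inductive Neutral {Γ : List Ty} : {τ : Ty} → Tm Γ τ → Prop
  | var {τ : Ty} (x : Var Γ τ) : Neutral (.var x)
  | app {σ τ : Ty} {F : Tm Γ (.arr σ τ)} (K : Tm Γ σ) : Neutral F → Neutral (.app F K)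

theorem Neutral.of_vren {Γ Γ' : List Ty} {τ : Ty} {T : Tm Γ τ} {ξ : VRen Γ Γ'}
    (h : Neutral (T.vren ξ)) : Neutral T := by
  generalize hS : T.vren ξ = S at h
  induction h with
  | var x =>
    cases T <;> simp only [Tm.vren, reduceCtorEq] at hS
    exact .var _
  | app K h ih =>
    cases T <;> simp only [Tm.vren, reduceCtorEq, Tm.app.injEq] at hS
    obtain ⟨rfl, hF, -⟩ := hS
    exact .app _ (ih (eq_of_heq hF))

theorem Neutral.not_closed {τ : Ty} {T : Tm [] τ} (h : Neutral T) : False := by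
  induction h with
  | var x => cases x
  | app K h ih => exact ih

/-- The only variable has type `σ → proc`, so it can be applied at most once. -/
theorem Neutral.type_eq {σ τ : Ty} {T : Tm [.arr σ .proc] τ} (h : Neutral T) :
    τ = .arr σ .proc ∨ τ = .proc := by
  induction h with
  | var x =>
    cases x with
    | zero => exact .inl rfl
    | succ x => cases x
  | app K h ih =>
    rcases ih with h | h
    · cases h; exact .inr rfl
    · cases h

theorem Neutral.eq_app {σ : Ty} {T : Tm [.arr σ .proc] .proc} (h : Neutral T) :
    ∃ K, T = .app (.var .zero) K := by
  cases h with
  | var x => cases x with | succ x => cases x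
  | app K h =>
    cases h with
    | var x =>
      cases x with
      | zero => exact ⟨K, rfl⟩
      | succ x => cases x
    | app K' h => rcases h.type_eq with h | h <;> cases h

/-- A substitution creates a head redex only by filling a variable in head position. -/
theorem Head.exists_sub {Γ Γ' : List Ty} {τ : Ty} {T : Tm Γ τ} {θ : Sub Γ Γ'} {S : Tm Γ' τ}
    (h : Head (T.sub θ) S) : (∃ T', Head T T' ∧ T'.sub θ = S) ∨ Neutral T := by
  induction T with
  | var x => exact .inr (.var _)
  | app F K ih _ =>
    cases F with
    | lam T =>
      cases h with
      | beta => exact .inl ⟨_, .beta _ _, Tm.inst_sub _ _ _⟩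
      | app _ h => cases h
    | var x => exact .inr (.app _ (.var _))
    | app F K' =>
      cases h with
      | app _ h =>
        rcases ih h with ⟨F', h', rfl⟩ | h
        · exact .inl ⟨_, .app _ h', rfl⟩
        · exact .inr (.app _ h)
  | _ => cases h

theorem Head.exists_inst {σ : Ty} {E : Tm [.arr σ .proc] .proc} {A : Tm [] (.arr σ .proc)}
    {S : Proc} (h : Head (E.inst A) S) :
    (∃ E', Head E E' ∧ E'.inst A = S) ∨ ∃ K, E = .app (.var .zero) K :=
  h.exists_sub.imp id Neutral.eq_app

/-! Inversion of instances. -/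

section
variable {σ : Ty} {E : Tm [.arr σ .proc] .proc} {A : Tm [] (.arr σ .proc)}

theorem Tm.inst_eq_inp {s : Ty} {a : ℕ} {T : Tm [s] .proc} (h : E.inst A = .inp s a T) :
    ∃ E', E = .inp s a E' ∧ E'.sub ((Sub.single A).lift s) = T := by
  cases E with
  | var x => cases x with | succ x => cases x
  | inp s' a' E' =>
    simp only [Tm.inst, Tm.sub, Tm.inp.injEq] at h
    obtain ⟨rfl, rfl, h⟩ := h
    exact ⟨E', rfl, eq_of_heq h⟩
  | _ => simp only [Tm.inst, Tm.sub, reduceCtorEq] at h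

theorem Tm.inst_eq_out {s : Ty} {a : ℕ} {K : Tm [] s} {T : Proc} (h : E.inst A = .out s a K T) :
    ∃ K' E', E = .out s a K' E' ∧ K'.inst A = K ∧ E'.inst A = T := by
  cases E with
  | var x => cases x with | succ x => cases x
  | out s' a' K' E' =>
    simp only [Tm.inst, Tm.sub, Tm.out.injEq] at h
    obtain ⟨rfl, rfl, h, h'⟩ := h
    exact ⟨K', E', rfl, eq_of_heq h, h'⟩
  | _ => simp only [Tm.inst, Tm.sub, reduceCtorEq] at h

theorem Tm.inst_eq_par {T T' : Proc} (h : E.inst A = .par T T') :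
    ∃ E₁ E₂, E = .par E₁ E₂ ∧ E₁.inst A = T ∧ E₂.inst A = T' := by
  cases E with
  | var x => cases x with | succ x => cases x
  | par E₁ E₂ =>
    simp only [Tm.inst, Tm.sub, Tm.par.injEq] at h
    exact ⟨E₁, E₂, rfl, h.1, h.2⟩
  | _ => simp only [Tm.inst, Tm.sub, reduceCtorEq] at h

theorem Tm.inst_eq_res {d : Ty} {T : Proc} (h : E.inst A = .res d T) :
    ∃ E', E = .res d E' ∧ E'.inst (A.ren (up d)) = T := by
  cases E with
  | var x => cases x with | succ x => cases x
  | res d' E' =>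
    rw [Tm.inst_res] at h
    cases h
    exact ⟨E', rfl, rfl⟩
  | _ => simp only [Tm.inst, Tm.sub, reduceCtorEq] at h

theorem Tm.inst_inst_eq_conc {s : Ty} (cs : List Ty) (K : Tm [.arr σ .proc] s)
    (T : Tm [.arr σ .proc] .proc) (F : Tm [s, .arr σ .proc] .proc) (A : Tm [] (.arr σ .proc)) :
    (conc cs K T F).inst A = conc cs (K.inst (A.ren (ups cs))) (T.inst (A.ren (ups cs)))
      (F.sub ((Sub.single A).lift s)) := by
  rw [Tm.inst, conc_sub, Sub.single_ren]; rfl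

theorem Tm.inst_inst_eq_conc' {s : Ty} (cs : List Ty) (K : Tm [.arr σ .proc] s)
    (T : Tm [.arr σ .proc] .proc) (F : Tm [s, .arr σ .proc] .proc) (A : Tm [] (.arr σ .proc)) :
    (conc' cs K T F).inst A = conc' cs (K.inst (A.ren (ups cs))) (T.inst (A.ren (ups cs)))
      (F.sub ((Sub.single A).lift s)) := by
  rw [Tm.inst, conc'_sub, Sub.single_ren]; rfl

end

/-! Unfolding the exposed occurrences of the variable. -/

/-- `Unfold A E E'`: in `E`, head redexes outside prefixes are reduced and exposed applications of
the variable are replaced by applications of `A`. -/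
inductive Unfold {σ : Ty} : Tm [] (.arr σ .proc) → Tm [.arr σ .proc] .proc →
    Tm [.arr σ .proc] .proc → Prop
  | refl (A : Tm [] (.arr σ .proc)) (E : Tm [.arr σ .proc] .proc) : Unfold A E E
  | head {A : Tm [] (.arr σ .proc)} {E E' E'' : Tm [.arr σ .proc] .proc} :
      Head E E' → Unfold A E' E'' → Unfold A E E''
  | app {A : Tm [] (.arr σ .proc)} {K : Tm [.arr σ .proc] σ} {E : Tm [.arr σ .proc] .proc} :
      Unfold A (.app (A.wk _) K) E → Unfold A (.app (.var .zero) K) E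
  | par {A : Tm [] (.arr σ .proc)} {E₁ E₂ E₁' E₂' : Tm [.arr σ .proc] .proc} :
      Unfold A E₁ E₁' → Unfold A E₂ E₂' → Unfold A (.par E₁ E₂) (.par E₁' E₂')
  | res (d : Ty) {A : Tm [] (.arr σ .proc)} {E E' : Tm [.arr σ .proc] .proc} :
      Unfold (A.ren (up d)) E E' → Unfold A (.res d E) (.res d E')

/-- A head reduction of an instance comes from the context, after unfolding. -/
theorem Head.exists_unfold {σ : Ty} {E : Tm [.arr σ .proc] .proc} {A : Tm [] (.arr σ .proc)}
    {S : Proc} (h : Head (E.inst A) S) :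
    ∃ E', E'.inst A = S ∧ ∀ E'', Unfold A E' E'' → Unfold A E E'' := by
  rcases h.exists_inst with ⟨E', h, e⟩ | ⟨K, rfl⟩
  · exact ⟨E', e, fun _ => .head h⟩
  · have e : (Tm.app (.var .zero) K).inst A = (Tm.app (A.wk _) K).inst A := by
      rw [Tm.inst_app, Tm.inst_app, Tm.wk_inst]; rfl
    rw [e] at h
    -- With the closed `A` in place of the exposed variable, the term is no longer headed by a
    -- variable, so the reduction is one of the context.
    rcases Head.exists_sub h with ⟨E', h, e⟩ | h
    · exact ⟨E', e, fun _ u => .app (.head h u)⟩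
    · cases h with | app _ h => exact h.of_vren.not_closed.elim

section
variable {σ : Ty} {E : Tm [.arr σ .proc] .proc} {A : Tm [] (.arr σ .proc)}

/-- A copy of `A` is unfolded only when the derivation head reduces through it. Induction on the
transition therefore suffices, without any termination argument for unfolding. -/
theorem InpT.exists_unfold {s : Ty} {a : ℕ} {F : Tm [s] .proc} (h : InpT (E.inst A) s a F) :
    ∃ E' F', Unfold A E E' ∧ InpT E' s a F' ∧ F'.sub ((Sub.single A).lift s) = F := by
  generalize hS : E.inst A = S at h
  induction h generalizing E A with
  | inp s a T =>
    obtain ⟨E, rfl, rfl⟩ := Tm.inst_eq_inp hS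
    exact ⟨_, _, .refl _ _, .inp _ _ _, rfl⟩
  | parL S _ ih =>
    obtain ⟨E₁, E₂, rfl, rfl, rfl⟩ := Tm.inst_eq_par hS
    obtain ⟨E', F', u, t, rfl⟩ := ih rfl
    exact ⟨_, _, .par u (.refl _ _), .parL _ t, by simp only [Tm.sub, Tm.wk_sub_lift]; rfl⟩
  | parR S _ ih =>
    obtain ⟨E₁, E₂, rfl, rfl, rfl⟩ := Tm.inst_eq_par hS
    obtain ⟨E', F', u, t, rfl⟩ := ih rfl
    exact ⟨_, _, .par (.refl _ _) u, .parR _ t, by simp only [Tm.sub, Tm.wk_sub_lift]; rfl⟩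
  | res d _ ih =>
    obtain ⟨E, rfl, rfl⟩ := Tm.inst_eq_res hS
    obtain ⟨E', F', u, t, rfl⟩ := ih rfl
    exact ⟨_, _, .res _ u, .res _ t,
      by simp only [Tm.sub, Sub.up_eq, ← Sub.ren_lift, Sub.single_ren]⟩
  | head h _ ih =>
    subst hS
    obtain ⟨E₁, e, u⟩ := h.exists_unfold
    obtain ⟨E', F', u', t, rfl⟩ := ih e
    exact ⟨_, _, u _ u', t, rfl⟩

theorem OutT.exists_unfold {s : Ty} {a : ℕ} {cs : List Ty} {K : Tm [] s} {T : Proc}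
    (h : OutT (E.inst A) (.nm a) cs K T) :
    ∃ E' K' T', Unfold A E E' ∧ OutT E' (.nm a) cs K' T' ∧ K'.inst (A.ren (ups cs)) = K ∧
      T'.inst (A.ren (ups cs)) = T := by
  generalize hS : E.inst A = S at h
  generalize hα : Chan.nm a = α at h
  induction h generalizing E A a with
  | out s a K T =>
    cases hα
    obtain ⟨K, E, rfl, rfl, rfl⟩ := Tm.inst_eq_out hS
    exact ⟨_, _, _, .refl _ _, .out _ _ _ _, by rw [Tm.ren_ups_nil], by rw [Tm.ren_ups_nil]⟩
  | app x => cases x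
  | parL S _ ih =>
    obtain ⟨E₁, E₂, rfl, rfl, rfl⟩ := Tm.inst_eq_par hS
    obtain ⟨E', K', T', u, t, rfl, rfl⟩ := ih rfl hα
    exact ⟨_, _, _, .par u (.refl _ _), .parL _ t, rfl, by rw [Tm.inst_par, Tm.inst_ren]⟩
  | parR S _ ih =>
    obtain ⟨E₁, E₂, rfl, rfl, rfl⟩ := Tm.inst_eq_par hS
    obtain ⟨E', K', T', u, t, rfl, rfl⟩ := ih rfl hα
    exact ⟨_, _, _, .par (.refl _ _) u, .parR _ t, rfl, by rw [Tm.inst_par, Tm.inst_ren]⟩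
  | res d _ ih =>
    subst hα
    obtain ⟨E, rfl, rfl⟩ := Tm.inst_eq_res hS
    obtain ⟨E', K', T', u, t, rfl, rfl⟩ := ih rfl rfl
    exact ⟨_, _, _, .res _ u, .res _ t, by rw [Tm.ren_ups_cons], by rw [Tm.ren_ups_cons]⟩
  | head h _ ih =>
    subst hS
    obtain ⟨E₁, e, u⟩ := h.exists_unfold
    obtain ⟨E', K', T', u', t, rfl, rfl⟩ := ih e hα
    exact ⟨_, _, _, u _ u', t, rfl, rfl⟩

theorem TauT.exists_unfold {T : Proc} (h : TauT (E.inst A) T) :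
    ∃ E' E'', Unfold A E E' ∧ TauT E' E'' ∧ E''.inst A = T := by
  generalize hS : E.inst A = S at h
  induction h generalizing E A with
  | comL h h' =>
    obtain ⟨E₁, E₂, rfl, rfl, rfl⟩ := Tm.inst_eq_par hS
    obtain ⟨E', F', u, t, rfl⟩ := h.exists_unfold
    obtain ⟨E'', K', T', u', t', rfl, rfl⟩ := h'.exists_unfold
    exact ⟨_, _, .par u u', .comL t t', Tm.inst_inst_eq_conc _ _ _ _ _⟩
  | comR h' h =>
    obtain ⟨E₁, E₂, rfl, rfl, rfl⟩ := Tm.inst_eq_par hS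
    obtain ⟨E', F', u, t, rfl⟩ := h.exists_unfold
    obtain ⟨E'', K', T', u', t', rfl, rfl⟩ := h'.exists_unfold
    exact ⟨_, _, .par u' u, .comR t' t, Tm.inst_inst_eq_conc' _ _ _ _ _⟩
  | parL S _ ih =>
    obtain ⟨E₁, E₂, rfl, rfl, rfl⟩ := Tm.inst_eq_par hS
    obtain ⟨E', E'', u, t, rfl⟩ := ih rfl
    exact ⟨_, _, .par u (.refl _ _), .parL _ t, rfl⟩
  | parR S _ ih =>
    obtain ⟨E₁, E₂, rfl, rfl, rfl⟩ := Tm.inst_eq_par hS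
    obtain ⟨E', E'', u, t, rfl⟩ := ih rfl
    exact ⟨_, _, .par (.refl _ _) u, .parR _ t, rfl⟩
  | res d _ ih =>
    obtain ⟨E, rfl, rfl⟩ := Tm.inst_eq_res hS
    obtain ⟨E', E'', u, t, rfl⟩ := ih rfl
    exact ⟨_, _, .res _ u, .res _ t, Tm.inst_res _ _ _⟩
  | head h _ ih =>
    subst hS
    obtain ⟨E₁, e, u⟩ := h.exists_unfold
    obtain ⟨E', E'', u', t, rfl⟩ := ih e
    exact ⟨_, _, u _ u', t, rfl⟩

end

/-! Transitions of `E[Tr_m]`. -/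

theorem trig_ren {Γ : List Ty} (σ : Ty) (m : ℕ) (ρ : Ren) :
    (trig σ m : Tm Γ _).ren ρ = trig σ (ρ σ m) := rfl

/-- The subject obtained by the substitution of `Tr_m` for the variable. -/
def Chan.close {σ s : Ty} (m : ℕ) : Chan [.arr σ .proc] s → Chan [] s
  | .nm a => .nm a
  | .vr _ => .nm m

theorem Var.eq_of_singleton {σ s : Ty} (x : Var [.arr σ .proc] (.arr s .proc)) : s = σ := by
  cases x with
  | zero => rfl
  | succ x => cases x

theorem Chan.close_eq_ren_up {σ s d : Ty} {m : ℕ} {α : Chan [.arr σ .proc] s} {β : Chan [] s}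
    (h : α.close (up d σ m) = β.ren (up d)) :
    ∃ γ : Chan [.arr σ .proc] s, α = γ.ren (up d) ∧ γ.close m = β := by
  cases β with
  | vr x => cases x
  | nm b =>
    cases α with
    | nm a => cases h; exact ⟨.nm b, rfl, rfl⟩
    | vr x =>
      cases x.eq_of_singleton
      simp only [Chan.close, Chan.ren, Chan.nm.injEq] at h
      exact ⟨.vr x, rfl, by rw [Chan.close, up_inj _ _ h]⟩

section
variable {σ : Ty} {E : Tm [.arr σ .proc] .proc} {m : ℕ}

/-- A head reduction of `E[Tr_m]` comes from `E`, or exposes an output on `m`. -/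
theorem Head.exists_trig {S : Proc} (h : Head (E.inst (trig σ m)) S) :
    (∃ E', Head E E' ∧ E'.inst (trig σ m) = S) ∨
      ∃ K, E = .app (.var .zero) K ∧ S = .out σ m (K.inst (trig σ m)) .nil := by
  rcases h.exists_inst with h | ⟨K, rfl⟩
  · exact .inl h
  · exact .inr ⟨K, rfl, h.det (.beta _ _)⟩

/-- Triggers contribute only outputs, so every input comes from `E`. -/
theorem InpT.exists_trig {s : Ty} {a : ℕ} {F : Tm [s] .proc}
    (h : InpT (E.inst (trig σ m)) s a F) :
    ∃ F', InpT E s a F' ∧ F'.sub ((Sub.single (trig σ m)).lift s) = F := by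
  generalize hS : E.inst (trig σ m) = S at h
  induction h generalizing E m with
  | inp s a T =>
    obtain ⟨E, rfl, rfl⟩ := Tm.inst_eq_inp hS
    exact ⟨_, .inp _ _ _, rfl⟩
  | parL S _ ih =>
    obtain ⟨E₁, E₂, rfl, rfl, rfl⟩ := Tm.inst_eq_par hS
    obtain ⟨F', t, rfl⟩ := ih rfl
    exact ⟨_, .parL _ t, by simp only [Tm.sub, Tm.wk_sub_lift]; rfl⟩
  | parR S _ ih =>
    obtain ⟨E₁, E₂, rfl, rfl, rfl⟩ := Tm.inst_eq_par hS
    obtain ⟨F', t, rfl⟩ := ih rfl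
    exact ⟨_, .parR _ t, by simp only [Tm.sub, Tm.wk_sub_lift]; rfl⟩
  | res d _ ih =>
    obtain ⟨E, rfl, rfl⟩ := Tm.inst_eq_res hS
    obtain ⟨F', t, rfl⟩ := ih (m := up d σ m) rfl
    exact ⟨_, .res _ t, by simp only [Tm.sub, Sub.up_eq, ← Sub.ren_lift, Sub.single_ren]; rfl⟩
  | head h t ih =>
    subst hS
    rcases h.exists_trig with ⟨E', h, e⟩ | ⟨K, rfl, rfl⟩
    · obtain ⟨F', u, rfl⟩ := ih e
      exact ⟨_, .head h u, rfl⟩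
    · cases t with | head h _ => cases h

/-- `Chan.close` merges the two origins of an output: a prefix of `E`, or an exposed `X⟨K⟩` that has
become an output on `m`. -/
theorem OutT.exists_trig {s : Ty} {α : Chan [] s} {cs : List Ty} {K : Tm [] s} {T : Proc}
    (h : OutT (E.inst (trig σ m)) α cs K T) :
    ∃ (β : Chan [.arr σ .proc] s) (K' : _) (T' : _), β.close m = α ∧ OutT E β cs K' T' ∧
      K'.inst (trig σ (ups cs σ m)) = K ∧ T'.inst (trig σ (ups cs σ m)) = T := by
  generalize hS : E.inst (trig σ m) = S at h
  induction h generalizing E m with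
  | out s a K T =>
    obtain ⟨K, E, rfl, rfl, rfl⟩ := Tm.inst_eq_out hS
    exact ⟨.nm a, _, _, rfl, .out _ _ _ _, by rw [ups_nil], by rw [ups_nil]⟩
  | app x => cases x
  | parL S _ ih =>
    obtain ⟨E₁, E₂, rfl, rfl, rfl⟩ := Tm.inst_eq_par hS
    obtain ⟨β, K', T', e, t, rfl, rfl⟩ := ih rfl
    exact ⟨_, _, _, e, .parL _ t, rfl, by rw [Tm.inst_par, Tm.inst_ren, trig_ren]⟩
  | parR S _ ih =>
    obtain ⟨E₁, E₂, rfl, rfl, rfl⟩ := Tm.inst_eq_par hS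
    obtain ⟨β, K', T', e, t, rfl, rfl⟩ := ih rfl
    exact ⟨_, _, _, e, .parR _ t, rfl, by rw [Tm.inst_par, Tm.inst_ren, trig_ren]⟩
  | res d _ ih =>
    obtain ⟨E, rfl, rfl⟩ := Tm.inst_eq_res hS
    obtain ⟨β, K', T', e, t, rfl, rfl⟩ := ih (m := up d σ m) rfl
    obtain ⟨γ, rfl, e'⟩ := Chan.close_eq_ren_up e
    exact ⟨_, _, _, e', .res _ t, by rw [ups_cons], by rw [ups_cons]⟩
  | head h t ih =>
    subst hS
    rcases h.exists_trig with ⟨E', h, e⟩ | ⟨K, rfl, rfl⟩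
    · obtain ⟨β, K', T', e', u, rfl, rfl⟩ := ih e
      exact ⟨_, _, _, e', .head h u, rfl, rfl⟩
    · cases t with
      | out => exact ⟨.vr .zero, _, _, rfl, .app _ _, by rw [ups_nil], rfl⟩
      | head h _ => cases h

/-- The second alternative allows for a trigger received by `E` itself; freshness of `m` excludes it
later. -/
theorem TauT.exists_trig {T : Proc} (h : TauT (E.inst (trig σ m)) T) :
    (∃ E', TauT E E' ∧ E'.inst (trig σ m) = T) ∨ ∃ F, InpT E σ m F := by
  generalize hS : E.inst (trig σ m) = S at h
  induction h generalizing E m with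
  | comL h h' =>
    obtain ⟨E₁, E₂, rfl, rfl, rfl⟩ := Tm.inst_eq_par hS
    obtain ⟨F', t, rfl⟩ := h.exists_trig
    obtain ⟨β, K', T', e, t', rfl, rfl⟩ := h'.exists_trig
    cases β with
    | nm b => cases e; exact .inl ⟨_, .comL t t', Tm.inst_inst_eq_conc _ _ _ _ _⟩
    | vr x => cases x.eq_of_singleton; cases e; exact .inr ⟨_, .parL _ t⟩
  | comR h' h =>
    obtain ⟨E₁, E₂, rfl, rfl, rfl⟩ := Tm.inst_eq_par hS
    obtain ⟨F', t, rfl⟩ := h.exists_trig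
    obtain ⟨β, K', T', e, t', rfl, rfl⟩ := h'.exists_trig
    cases β with
    | nm b => cases e; exact .inl ⟨_, .comR t' t, Tm.inst_inst_eq_conc' _ _ _ _ _⟩
    | vr x => cases x.eq_of_singleton; cases e; exact .inr ⟨_, .parR _ t⟩
  | parL S _ ih =>
    obtain ⟨E₁, E₂, rfl, rfl, rfl⟩ := Tm.inst_eq_par hS
    rcases ih rfl with ⟨E', t, rfl⟩ | ⟨F, t⟩
    · exact .inl ⟨_, .parL _ t, rfl⟩
    · exact .inr ⟨_, .parL _ t⟩
  | parR S _ ih =>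
    obtain ⟨E₁, E₂, rfl, rfl, rfl⟩ := Tm.inst_eq_par hS
    rcases ih rfl with ⟨E', t, rfl⟩ | ⟨F, t⟩
    · exact .inl ⟨_, .parR _ t, rfl⟩
    · exact .inr ⟨_, .parR _ t⟩
  | res d _ ih =>
    obtain ⟨E, rfl, rfl⟩ := Tm.inst_eq_res hS
    rcases ih (m := up d σ m) rfl with ⟨E', t, rfl⟩ | ⟨F, t⟩
    · exact .inl ⟨_, .res _ t, Tm.inst_res _ _ _⟩
    · exact .inr ⟨_, .res _ t⟩
  | head h t ih =>
    subst hS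
    rcases h.exists_trig with ⟨E', h, e⟩ | ⟨K, rfl, rfl⟩
    · rcases ih e with ⟨E', u, rfl⟩ | ⟨F, u⟩
      · exact .inl ⟨_, .head h u, rfl⟩
      · exact .inr ⟨_, .head h u⟩
    · cases t with | head h _ => cases h

end

/-- Exposing an application of a variable by structural congruence. -/
theorem OutT.struct_sub {Γ Γ' : List Ty} {E : Tm Γ .proc} {s : Ty} {x : Var Γ (.arr s .proc)}
    {cs : List Ty} {K : Tm Γ s} {T : Tm Γ .proc} (h : OutT E (.vr x) cs K T) (θ : Sub Γ Γ') :
    Struct (E.sub θ) (Tm.ress cs (.par (.app ((θ _ x).ren (ups cs)) (K.sub (θ.ren (ups cs))))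
      (T.sub (θ.ren (ups cs))))) := by
  generalize hα : Chan.vr x = α at h
  induction h generalizing θ with
  | out s a K T => cases hα
  | app x K =>
    cases hα
    simp only [Tm.ren_ups_nil, Sub.ren_ups_nil]
    exact (Struct.par_nil _).symm
  | parL S _ ih =>
    simp only [Tm.sub, ← Tm.sub_ren]
    refine (Struct.par (ih θ hα) (.refl _)).trans ((Struct.ress_par _ _ _).symm.trans
      (.ress _ (Struct.par_assoc _ _ _).symm))
  | parR S _ ih =>
    simp only [Tm.sub, ← Tm.sub_ren]
    refine (Struct.par (.refl _) (ih θ hα)).trans ((Struct.par_ress _ _ _).symm.trans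
      (.ress _ (.par_left_comm _ _ _)))
  | res d _ ih =>
    subst hα
    have := ih (θ.up d) rfl
    simp only [Sub.up_eq, Sub.ren_ren, ← ups_cons] at this
    rw [Tm.ren_ups_cons]
    exact .res _ this
  | head h _ ih => exact (h.sub θ).struct.trans (ih θ hα)

/-! The replicated trigger handler. -/

/-- The state of `!m(Z).P` in which the input on `m` is exposed. -/
def repReady (σ : Ty) (m : ℕ) (P : Tm [σ] .proc) : Proc :=
  .res .proc (.par (.inp σ (up .proc σ m) (.par ((repQ σ m P).wk σ) (P.ren (up .proc))))
    (.out .proc 0 (repQ σ m P) .nil))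

theorem repQ_ren {Γ : List Ty} (σ : Ty) (m : ℕ) (P : Tm (σ :: Γ) .proc) (ρ : Ren) :
    (repQ σ m P).ren (ρ.lift .proc) = repQ σ (ρ σ m) (P.ren ρ) := by
  simp only [repQ, Tm.ren, Ren.lift_up, Tm.vren_ren, Tm.ren_lift_up]
  simp [Ren.lift]

theorem rep_ren {Γ : List Ty} (σ : Ty) (m : ℕ) (P : Tm (σ :: Γ) .proc) (ρ : Ren) :
    (rep σ m P).ren ρ = rep σ (ρ σ m) (P.ren ρ) := by
  simp only [rep, Tm.ren, repQ_ren]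
  simp [Ren.lift]

theorem repReady_ren (σ : Ty) (m : ℕ) (P : Tm [σ] .proc) (ρ : Ren) :
    (repReady σ m P).ren ρ = repReady σ (ρ σ m) (P.ren ρ) := by
  simp only [repReady, Tm.ren, repQ_ren, Tm.wk_ren, Ren.lift_up, Tm.ren_lift_up]
  simp [Ren.lift]

theorem repQ_sub {Γ Γ' : List Ty} (σ : Ty) (m : ℕ) (P : Tm (σ :: Γ) .proc) (θ : Sub Γ Γ') :
    (repQ σ m P).sub (θ.up .proc) = repQ σ m (P.sub (θ.lift σ)) := by
  simp only [repQ, Tm.sub, Tm.vren_sub, Tm.sub_ren, Tm.sub_vren]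
  congr 5
  funext s x
  cases x with
  | zero => rfl
  | succ x =>
    change ((((θ _ x).ren (up .proc)).wk .proc).wk σ) =
      (((θ _ x).wk σ).ren (up .proc)).vren (VRen.lift (fun _ x => Var.succ x) σ)
    rw [Tm.wk_ren, Tm.wk_vren_lift]
    rfl

theorem rep_sub {Γ Γ' : List Ty} (σ : Ty) (m : ℕ) (P : Tm (σ :: Γ) .proc) (θ : Sub Γ Γ') :
    (rep σ m P).sub θ = rep σ m (P.sub (θ.lift σ)) := by
  simp only [rep, Tm.sub, repQ_sub]

theorem handler_sub {Γ Γ' : List Ty} (σ : Ty) (m : ℕ) (A : Tm Γ (.arr σ .proc)) (θ : Sub Γ Γ') :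
    (handler σ m A).sub θ = handler σ m (A.sub θ) := by
  rw [handler, rep_sub, Tm.sub, Tm.wk_sub_lift]
  rfl

theorem repQ_unfold (σ : Ty) (m : ℕ) (P : Tm [σ] .proc) :
    (Tm.par (.inp σ (up .proc σ m) (.par (.var (.succ .zero))
      ((P.ren (up .proc)).vren (VRen.lift (fun _ x => Var.succ x) σ))))
      (.out .proc 0 (.var .zero) .nil)).inst (repQ σ m P) =
    .par (.inp σ (up .proc σ m) (.par ((repQ σ m P).wk σ) (P.ren (up .proc))))
      (.out .proc 0 (repQ σ m P) .nil) := by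
  have e : ((P.ren (up .proc)).vren (VRen.lift (fun _ x => Var.succ x) σ)).sub
      ((Sub.single (repQ σ m P)).lift σ) = P.ren (up .proc) := by
    rw [Tm.vren_sub]
    conv_rhs => rw [← Tm.sub_id (P.ren (up .proc))]
    congr 1
    funext s x
    cases x with
    | zero => rfl
    | succ x => cases x
  rw [Tm.inst_par]
  simp only [Tm.inst, Tm.sub, e]
  rfl

/-- The replication has to pass `Q_c` to itself on the private name `c` before it can input on `m`.
-/
theorem tauT_rep (σ : Ty) (m : ℕ) (P : Tm [σ] .proc) :
    ∃ R, TauT (rep σ m P) R ∧ Struct R (repReady σ m P) := by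
  refine ⟨_, .res _ (.comL (.inp _ _ _) (.out _ _ _ _)), .res _ ((Struct.par_nil _).trans ?_)⟩
  rw [Tm.ren_ups_nil, repQ_unfold]
  exact .refl _

theorem TauT.of_rep {σ : Ty} {m : ℕ} {P : Tm [σ] .proc} {R : Proc} (h : TauT (rep σ m P) R) :
    Struct R (repReady σ m P) := by
  unfold rep at h
  cases h with
  | res _ h =>
    cases h with
    | comL h h' =>
      cases h' with
      | out =>
        cases h with
        | inp =>
          refine .res _ ((Struct.par_nil _).trans ?_)
          rw [Tm.ren_ups_nil, repQ_unfold]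
          exact .refl _
        | head h _ => cases h
      | head h _ => cases h
    | comR h h' => cases h' with | head h _ => cases h
    | parL _ h => cases h with | head h _ => cases h
    | parR _ h => cases h with | head h _ => cases h
    | head h _ => cases h
  | head h _ => cases h

theorem up_self_ne_zero (s : Ty) (n : ℕ) : up s s n ≠ 0 := by simp [up]

theorem InpT.not_rep {σ s : Ty} {m a : ℕ} {P : Tm [σ] .proc} {F : Tm [s] .proc}
    (h : InpT (rep σ m P) s a F) : False := by
  unfold rep at h
  cases h with
  | res _ h =>
    cases h with
    | parL _ h =>
      generalize hb : up _ _ _ = b at h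
      cases h with
      | inp => exact up_self_ne_zero _ _ hb
      | head h _ => cases h
    | parR _ h => cases h with | head h _ => cases h
    | head h _ => cases h
  | head h _ => cases h

theorem OutT.not_res_out {s : Ty} {c : Ty} {α β : Chan [] s} {K : Tm [] c} {K' : Tm [] s}
    {T T' : Proc} {cs : List Ty} (hβ : β = α.ren (up c)) (h : OutT (.out c 0 K T) β cs K' T') :
    False := by
  cases h with
  | out => cases α <;> simp [Chan.ren, up] at hβ
  | head h _ => cases h

theorem OutT.not_rep {σ s : Ty} {m : ℕ} {P : Tm [σ] .proc} {α : Chan [] s} {cs : List Ty}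
    {K : Tm [] s} {T : Proc} (h : OutT (rep σ m P) α cs K T) : False := by
  unfold rep at h
  cases h with
  | res _ h =>
    cases h with
    | parL _ h => cases h with | head h _ => cases h
    | parR _ h => exact OutT.not_res_out rfl h
    | head h _ => cases h
  | head h _ => cases h

theorem OutT.not_repReady {σ s : Ty} {m : ℕ} {P : Tm [σ] .proc} {α : Chan [] s} {cs : List Ty}
    {K : Tm [] s} {T : Proc} (h : OutT (repReady σ m P) α cs K T) : False := by
  unfold repReady at h
  cases h with
  | res _ h =>
    cases h with
    | parL _ h => cases h with | head h _ => cases h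
    | parR _ h => exact OutT.not_res_out rfl h
    | head h _ => cases h
  | head h _ => cases h

theorem TauT.not_repReady {σ : Ty} {m : ℕ} {P : Tm [σ] .proc} {R : Proc}
    (h : TauT (repReady σ m P) R) : False := by
  unfold repReady at h
  cases h with
  | res _ h =>
    cases h with
    | comL h h' =>
      generalize hb : up _ _ _ = b at h
      cases h with
      | inp =>
        generalize hα : Chan.nm _ = α at h'
        cases h' with
        | out => cases hα; exact up_self_ne_zero _ _ hb
        | head h _ => cases h
      | head h _ => cases h
    | comR h h' => cases h' with | head h _ => cases h
    | parL _ h => cases h with | head h _ => cases h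
    | parR _ h => cases h with | head h _ => cases h
    | head h _ => cases h
  | head h _ => cases h

/-- After the input on `m`, the received copy of `Q_c` stands beside the pending output of `Q_c`,
which is the initial state again; `P` does not know `c` and leaves its scope. -/
theorem repReady_derivative (σ : Ty) (m : ℕ) (P : Tm [σ] .proc) :
    Struct (Tm.res .proc (.par (.par ((repQ σ m P).wk σ) (P.ren (up .proc)))
      ((Tm.out .proc 0 (repQ σ m P) .nil).wk σ))) (.par ((rep σ m P).wk σ) P) :=
  (Struct.res _ (.par_right_comm _ _ _)).trans (.res_par _ _ _)

theorem inpT_repReady (σ : Ty) (m : ℕ) (P : Tm [σ] .proc) :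
    ∃ F, InpT (repReady σ m P) σ m F ∧ Struct F (.par ((rep σ m P).wk σ) P) :=
  ⟨_, .res _ (.parL _ (.inp _ _ _)), repReady_derivative _ _ _⟩

/-- The sort is an index of the transition, so the body is cast along `σ = s`. -/
theorem InpT.of_repReady {σ s : Ty} {m a : ℕ} {P : Tm [σ] .proc} {F : Tm [s] .proc}
    (h : InpT (repReady σ m P) s a F) :
    ∃ e : σ = s, a = m ∧ Struct F (e ▸ Tm.par ((rep σ m P).wk σ) P) := by
  unfold repReady at h
  cases h with
  | res _ h =>
    cases h with
    | parL _ h =>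
      generalize hb : up _ _ _ = b at h
      cases h with
      | inp => exact ⟨rfl, (up_inj _ _ hb).symm, repReady_derivative _ _ _⟩
      | head h _ => cases h
    | parR _ h => cases h with | head h _ => cases h
    | head h _ => cases h
  | head h _ => cases h

/-- The two states of the trigger handler for `A` on `m`. -/
def handlerState (b : Bool) (σ : Ty) (m : ℕ) (A : Tm [] (.arr σ .proc)) : Proc :=
  bif b then repReady σ m (.app (A.wk σ) (.var .zero)) else handler σ m A

theorem handlerState_ren (b : Bool) (σ : Ty) (m : ℕ) (A : Tm [] (.arr σ .proc)) (ρ : Ren) :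
    (handlerState b σ m A).ren ρ = handlerState b σ (ρ σ m) (A.ren ρ) := by
  cases b
  · simp only [handlerState, cond_false, handler, rep_ren, Tm.ren, Tm.wk_ren]
  · simp only [handlerState, cond_true, repReady_ren, Tm.ren, Tm.wk_ren]

theorem OutT.not_handlerState {b : Bool} {σ s : Ty} {m : ℕ} {A : Tm [] (.arr σ .proc)}
    {α : Chan [] s} {cs : List Ty} {K : Tm [] s} {T : Proc}
    (h : OutT (handlerState b σ m A) α cs K T) : False := by
  cases b
  · exact OutT.not_rep h
  · exact OutT.not_repReady h

theorem InpT.of_handlerState {b : Bool} {σ s : Ty} {m a : ℕ} {A : Tm [] (.arr σ .proc)}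
    {F : Tm [s] .proc} (h : InpT (handlerState b σ m A) s a F) :
    ∃ e : σ = s, a = m ∧
      Struct F (e ▸ Tm.par ((handler σ m A).wk σ) (.app (A.wk σ) (.var .zero))) := by
  cases b
  · exact (InpT.not_rep h).elim
  · exact InpT.of_repReady h

theorem TauT.of_handlerState {b : Bool} {σ : Ty} {m : ℕ} {A : Tm [] (.arr σ .proc)} {R : Proc}
    (h : TauT (handlerState b σ m A) R) : Struct R (handlerState true σ m A) := by
  cases b
  · exact TauT.of_rep h
  · exact (TauT.not_repReady h).elim

theorem Weak.handler_ready (b : Bool) (σ : Ty) (m : ℕ) (A : Tm [] (.arr σ .proc)) :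
    Weak (handlerState b σ m A) (handlerState true σ m A) := by
  cases b
  · obtain ⟨R, h, e⟩ := tauT_rep σ m (.app (A.wk σ) (.var .zero))
    exact .of_step (h.step.of_struct_right e)
  · exact .of_struct (.refl _)

theorem Weak.par_right {P Q : Proc} (h : Weak P Q) (R : Proc) : Weak (.par R P) (.par R Q) :=
  (Weak.of_struct (.par_comm _ _)).trans ((h.par R).trans (.of_struct (.par_comm _ _)))

/-- A trigger is answered by the handler. -/
theorem Weak.trigger (b : Bool) (σ : Ty) (m : ℕ) (A : Tm [] (.arr σ .proc)) (K : Tm [] σ) :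
    Weak (.par (.app (trig σ m) K) (handlerState b σ m A))
      (.par (.app A K) (handler σ m A)) := by
  refine ((Weak.handler_ready b σ m A).par_right _).trans ?_
  obtain ⟨F, h, e⟩ := inpT_repReady σ m (.app (A.wk σ) (.var .zero))
  have o : OutT (Tm.app (trig σ m) K) (.nm m) [] K .nil := .head (.beta _ _) (.out _ _ _ _)
  refine .of_step ((TauT.comR o h).step.of_struct_right ?_)
  refine (conc_comm _ _ _ _).trans ((Struct.par_nil _).trans ?_)
  rw [Tm.ren_ups_nil]
  refine (e.inst (.refl _)).trans ((Struct.par_comm _ _).trans (.of_eq ?_))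
  change Tm.par ((Tm.app (A.wk σ) (.var .zero)).inst K) (((handler σ m A).wk σ).inst K) = _
  rw [Tm.inst_app, Tm.wk_inst, Tm.wk_inst]
  rfl

/-- Unfolding is simulated by the handler. -/
theorem Unfold.weak {σ : Ty} {A : Tm [] (.arr σ .proc)} {E E' : Tm [.arr σ .proc] .proc}
    (h : Unfold A E E') (ρ : Ren) (m : ℕ) (b : Bool) :
    ∃ b', Weak (.par ((E.ren ρ).inst (trig σ m)) (handlerState b σ m (A.ren ρ)))
      (.par ((E'.ren ρ).inst (trig σ m)) (handlerState b' σ m (A.ren ρ))) := by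
  induction h generalizing ρ m b with
  | refl A E => exact ⟨b, .of_struct (.refl _)⟩
  | head h _ ih =>
    obtain ⟨b', w⟩ := ih ρ m b
    exact ⟨b', (Weak.of_struct (.par ((h.ren ρ).sub _).struct (.refl _))).trans w⟩
  | @app A K E _ ih =>
    -- After answering a trigger the handler is back in its initial state, whatever `b` was.
    obtain ⟨b', w⟩ := ih ρ m false
    refine ⟨b', .trans ?_ w⟩
    have := Weak.trigger b σ m (A.ren ρ) ((K.ren ρ).inst (trig σ m))
    simp only [Tm.ren, Tm.inst_app, Tm.wk_ren, Tm.wk_inst]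
    exact this
  | par _ _ ih ih' =>
    -- One handler serves both components in turn: its state after the first is passed to the
    -- second.
    obtain ⟨b', w⟩ := ih ρ m b
    obtain ⟨b'', w'⟩ := ih' ρ m b'
    refine ⟨b'', ?_⟩
    simp only [Tm.ren, Tm.inst_par]
    refine (Weak.of_struct (.par_right_comm _ _ _)).trans ((w.par _).trans ?_)
    refine (Weak.of_struct ((Struct.par_assoc _ _ _).symm.trans
      (.par (.refl _) (.par_comm _ _)))).trans ((w'.par_right _).trans ?_)
    exact .of_struct (.par_assoc _ _ _)
  | @res d A E E' _ ih =>
    -- The handler enters the scope of `d`, where `m` and `A` are weakened, and leaves it again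
    -- afterwards.
    obtain ⟨b', w⟩ := ih (ρ.lift d) (up d σ m) b
    refine ⟨b', ?_⟩
    simp only [Tm.ren_lift_up] at w
    rw [← handlerState_ren b σ m (A.ren ρ) (up d), ← handlerState_ren b' σ m (A.ren ρ) (up d)] at w
    simp only [Tm.ren, Tm.inst_res, trig_ren]
    exact (Weak.of_struct (Struct.res_par _ _ _).symm).trans
      ((w.res d).trans (.of_struct (.res_par _ _ _)))

/-! The factorization relation is a context bisimulation. -/

/-- The process `(m)(E[Tr_m] | H)`, where `H` is a state of the handler for `A`. -/
def factored {σ : Ty} (A : Tm [] (.arr σ .proc)) (E : Tm [.arr σ .proc] .proc) (b : Bool) : Proc :=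
  .res σ (.par ((E.ren (up σ)).inst (trig σ 0)) (handlerState b σ 0 (A.ren (up σ))))

/-- `Factors A P Q`: `P` is `E[A]` and `Q` is `(m)(E[Tr_m] | H)`, up to structural congruence. -/
def Factors {σ : Ty} (A : Tm [] (.arr σ .proc)) (P Q : Proc) : Prop :=
  ∃ E b, Struct P (E.inst A) ∧ Struct Q (factored A E b)

section
variable {σ : Ty} {A : Tm [] (.arr σ .proc)} {E : Tm [.arr σ .proc] .proc}

theorem Unfold.weak_factored {E' : Tm [.arr σ .proc] .proc} (h : Unfold A E E') (b : Bool) :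
    ∃ b', Weak (factored A E b) (factored A E' b') := by
  obtain ⟨b', w⟩ := h.weak (up σ) 0 b
  exact ⟨b', w.res σ⟩

theorem TauT.factored {E' : Tm [.arr σ .proc] .proc} (h : TauT E E') (b : Bool) :
    TauT (factored A E b) (factored A E' b) :=
  .res _ (.parL _ ((h.ren _).sub _))

/-- A context for a term of type `s` as a context with a further variable. -/
def Tm.wkUnder {s : Ty} (ρ : Ty) (C : Tm [s] .proc) : Tm [s, ρ] .proc :=
  C.vren (VRen.lift (fun _ x => Var.succ x) s)

theorem Tm.wkUnder_sub {s ρ : Ty} (C : Tm [s] .proc) (θ : Sub [ρ] []) :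
    (C.wkUnder ρ).sub (θ.lift s) = C := by
  rw [Tm.wkUnder, Tm.vren_sub]
  conv_rhs => rw [← C.sub_id]
  congr 1
  funext s x
  cases x with
  | zero => rfl
  | succ x => cases x

theorem Tm.inst_wk_inst {s ρ : Ty} (F : Tm [s, ρ] .proc) (B : Tm [] s) (K : Tm [] ρ) :
    (F.inst (B.wk ρ)).inst K = (F.sub ((Sub.single K).lift s)).inst B := by
  have : (B.wk ρ).sub (Sub.single K) = B := B.wk_inst K
  conv_lhs => rw [Tm.inst, Tm.inst_sub, this]

/-- The derivative of `(m)(E[Tr_m] | H)` under an input. -/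
theorem factored_input {s : Ty} (F : Tm [s, .arr σ .proc] .proc) (B : Tm [] s) (b : Bool) :
    (Tm.res σ (.par ((F.ren (up σ)).sub ((Sub.single (trig σ 0)).lift s))
      ((handlerState b σ 0 (A.ren (up σ))).wk s))).inst B = factored A (F.inst (B.wk _)) b := by
  rw [Tm.inst_res, Tm.inst_par, Tm.wk_inst, factored, Tm.inst_ren, Tm.wk_ren, Tm.inst_wk_inst]

/-- The derivative of `(m)(E[Tr_m] | H)` under an output. -/
theorem factored_output {s : Ty} (cs : List Ty) (K : Tm [.arr σ .proc] s)
    (T : Tm [.arr σ .proc] .proc) (C : Tm [s] .proc) (b : Bool) :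
    Struct (conc (σ :: cs)
        ((K.ren ((up σ).lifts cs)).inst (trig σ (ups cs σ 0)))
        (.par ((T.ren ((up σ).lifts cs)).inst (trig σ (ups cs σ 0)))
          ((handlerState b σ 0 (A.ren (up σ))).ren (ups cs))) C)
      (factored A (conc cs K T (C.wkUnder _)) b) := by
  rw [conc_cons, factored]
  refine .res _ ((conc_par_right _ _ _ _ _).trans (.par (.of_eq ?_) (.refl _)))
  rw [conc_ren, Tm.inst_inst_eq_conc, Tm.wkUnder, Tm.vren_ren]
  congr 1
  exact ((C.ren (up σ)).wkUnder_sub _).symm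

theorem InpT.factored {s : Ty} {a : ℕ} {F : Tm [s, .arr σ .proc] .proc} (h : InpT E s a F)
    (B : Tm [] s) (b : Bool) :
    Step (factored A E b) (.inp s a B) (factored A (F.inst (B.wk _)) b) := by
  rw [← factored_input]
  exact InpT.step (.res _ (.parL _ ((h.ren _).sub _))) B

/-- `m` is extruded along with `cs`, so the handler stays in its scope once the output is received,
and the test context becomes part of the new `E`. -/
theorem OutT.factored {s : Ty} {a : ℕ} {cs : List Ty} {K : Tm [.arr σ .proc] s}
    {T : Tm [.arr σ .proc] .proc} (h : OutT E (.nm a) cs K T) (b : Bool) :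
    ∃ ds B Q, Step (factored A E b) (.out ds s a B) Q ∧
      ∀ C, Struct (conc ds B Q C) (PiD.factored A (conc cs K T (C.wkUnder _)) b) := by
  have o := OutT.sub (h.ren (up σ)) (Sub.single (trig σ 0))
  rw [Sub.single_ren] at o
  obtain ⟨B, e, t⟩ := OutT.exists_step (a := a) (OutT.res σ (OutT.parL
    (handlerState b σ 0 (A.ren (up σ))) o))
  refine ⟨_, B, _, t, fun C => ?_⟩
  exact (conc_congr _ e.symm (.refl _) (.refl _)).trans (factored_output _ _ _ _ _)

/-- A context in which an application `X⟨K⟩` was exposed, with `A⟨K⟩` in its place. -/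
def triggered (A : Tm [] (.arr σ .proc)) (cs : List Ty) (K : Tm [.arr σ .proc] σ)
    (T : Tm [.arr σ .proc] .proc) : Tm [.arr σ .proc] .proc :=
  Tm.ress cs (.par (.app ((A.ren (ups cs)).wk _) K) T)

theorem triggered_inst (A : Tm [] (.arr σ .proc)) (cs : List Ty) (K : Tm [.arr σ .proc] σ)
    (T : Tm [.arr σ .proc] .proc) (B : Tm [] (.arr σ .proc)) :
    (triggered A cs K T).inst B = conc cs (K.inst (B.ren (ups cs))) (T.inst (B.ren (ups cs)))
      (.app (A.wk σ) (.var .zero)) := by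
  simp only [triggered, conc, Tm.inst_ress, Tm.inst_par, Tm.inst_app, Tm.wk_inst, Tm.ren,
    Tm.wk_ren]
  rfl

/-- The reason why the answer to a trigger costs `E[A]` no move: there `A` is already applied to
`K`, up to scope extrusion. -/
theorem OutT.struct_triggered {cs : List Ty} {K : Tm [.arr σ .proc] σ}
    {T : Tm [.arr σ .proc] .proc} (h : OutT E (.vr .zero) cs K T) (A : Tm [] (.arr σ .proc)) :
    Struct (E.inst A) ((triggered A cs K T).inst A) := by
  refine (h.struct_sub (Sub.single A)).trans (.of_eq ?_)
  simp only [triggered, Tm.inst_ress, Tm.inst_par, Tm.inst_app, Tm.wk_inst, Sub.single_ren]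
  rfl

theorem triggered_ren (A : Tm [] (.arr σ .proc)) (cs : List Ty) (K : Tm [.arr σ .proc] σ)
    (T : Tm [.arr σ .proc] .proc) (ρ : Ren) : (triggered A cs K T).ren ρ =
      triggered (A.ren ρ) cs (K.ren (ρ.lifts cs)) (T.ren (ρ.lifts cs)) := by
  simp only [triggered, Tm.ress_ren, Tm.ren, Tm.wk_ren, Tm.ren_lifts_ups]

/-- The result of the communication between `E[Tr_m]` and its handler. -/
theorem factored_trigger {cs : List Ty} {K : Tm [.arr σ .proc] σ} {T : Tm [.arr σ .proc] .proc}
    {F : Tm [σ] .proc} (h : Struct F (.par ((handler σ 0 (A.ren (up σ))).wk σ)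
      (.app ((A.ren (up σ)).wk σ) (.var .zero)))) :
    Struct (.res σ (conc' cs ((K.ren ((up σ).lifts cs)).inst (trig σ (ups cs σ 0)))
      ((T.ren ((up σ).lifts cs)).inst (trig σ (ups cs σ 0))) F))
      (factored A (triggered A cs K T) false) := by
  refine .res _ ((conc_comm _ _ _ _).trans ((conc_congr _ (.refl _) (.refl _) h).trans
    ((conc_input_par' _ _ _ _ _).trans ((Struct.par_comm _ _).trans
    (.par (.of_eq ?_) (.refl _))))))
  rw [triggered_ren, triggered_inst]
  rfl

/-! ### Matching transitions across the factorization. -/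

/-- Unfolding brings the move into the context itself, where it survives the replacement of `A` by
`Tr_m`; the triggers answered on the way are internal moves. -/
theorem Factors.step_tau_left {P Q P' : Proc} (h : Factors A P Q) (t : Step P .tau P') :
    ∃ Q', Taus Q Q' ∧ Factors A P' Q' := by
  obtain ⟨E, b, hP, hQ⟩ := h
  obtain ⟨R, t, e⟩ := t.matches.struct hP.symm (.refl _)
  obtain ⟨E', E'', u, v, rfl⟩ := t.exists_unfold
  obtain ⟨b', w⟩ := u.weak_factored b
  obtain ⟨Q', w, s⟩ := ((Weak.of_struct hQ).trans w).step (v.factored b').step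
  exact ⟨_, .tail w s, E'', b', e.symm, .refl _⟩

theorem Factors.step_inp_left {P Q P' : Proc} {s : Ty} {a : ℕ} {B : Tm [] s} (h : Factors A P Q)
    (t : Step P (.inp s a B) P') : ∃ Q', WStep Q (.inp s a B) Q' ∧ Factors A P' Q' := by
  obtain ⟨E, b, hP, hQ⟩ := h
  obtain ⟨F, t, e⟩ := t.matches.struct hP.symm (.refl _)
  obtain ⟨E', F, u, v, rfl⟩ := t.exists_unfold
  obtain ⟨b', w⟩ := u.weak_factored b
  obtain ⟨Q', w, s⟩ := ((Weak.of_struct hQ).trans w).step (v.factored B b')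
  refine ⟨_, ⟨_, _, w, s, .refl⟩, F.inst (B.wk _), b', ?_, .refl _⟩
  rw [Tm.inst_wk_inst]
  exact e.symm

theorem Factors.step_out_left {P Q P' : Proc} {cs : List Ty} {s : Ty} {a : ℕ} {B : Tm [] s}
    (h : Factors A P Q) (t : Step P (.out cs s a B) P') :
    ∃ ds B' Q', WStep Q (.out ds s a B') Q' ∧
      ∀ C, Factors A (conc cs B P' C) (conc ds B' Q' C) := by
  obtain ⟨E, b, hP, hQ⟩ := h
  obtain ⟨cs', K, T, t, e⟩ := t.matches.struct hP.symm (.refl _)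
  obtain ⟨E', K, T, u, v, rfl, rfl⟩ := t.exists_unfold
  obtain ⟨b', w⟩ := u.weak_factored b
  obtain ⟨ds, B', Q', s, e'⟩ := v.factored (A := A) b'
  obtain ⟨Q'', w, s⟩ := ((Weak.of_struct hQ).trans w).step s
  refine ⟨_, _, _, ⟨_, _, w, s, .refl⟩, fun C => ⟨_, b', (e C).symm.trans (.of_eq ?_), e' C⟩⟩
  rw [Tm.inst_inst_eq_conc, Tm.wkUnder_sub]

/-- The second alternative collects the moves that `E[A]` does not notice: the handler getting
ready, and its answer to a trigger. -/
theorem TauT.of_factored {b : Bool} {Q : Proc} (h : TauT (PiD.factored A E b) Q) :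
    (∃ E', TauT E E' ∧ Struct Q (PiD.factored A E' b)) ∨
      ∃ E' b', Struct (E.inst A) (E'.inst A) ∧ Struct Q (PiD.factored A E' b') := by
  unfold PiD.factored at h
  cases h with
  | res _ h =>
    cases h with
    | comL _ h => exact h.not_handlerState.elim
    | comR h h' =>
      obtain ⟨rfl, rfl, e⟩ := h'.of_handlerState
      obtain ⟨β, K, T, eβ, u, rfl, rfl⟩ := h.exists_trig
      obtain ⟨γ, K, T, rfl, v, rfl, rfl⟩ := u.exists_ren
      cases γ with
      | nm c =>
        simp only [Chan.ren, Chan.close, Chan.nm.injEq] at eβ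
        -- The names of `E` are shifted by `up σ`, so none of them is `m`, the name `0`.
        exact (up_self_ne_zero _ _ eβ).elim
      | vr x =>
        cases x with
        | zero => exact .inr ⟨_, false, v.struct_triggered A, factored_trigger e⟩
        | succ x => cases x
    | parL _ h =>
      rcases h.exists_trig with ⟨E', u, rfl⟩ | ⟨F, u⟩
      · obtain ⟨E', v, rfl⟩ := u.exists_ren (up_inj _)
        exact .inl ⟨_, v, .refl _⟩
      -- Here `E` would have to input on `m` itself.
      · obtain ⟨c, F, e, -⟩ := u.exists_ren
        exact (up_self_ne_zero _ _ e).elim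
    | parR _ h => exact .inr ⟨E, true, .refl _, .res _ (.par (.refl _) h.of_handlerState)⟩
    | head h _ => cases h
  | head h _ => cases h

theorem InpT.of_factored {b : Bool} {s : Ty} {a : ℕ} {F : Tm [s] .proc}
    (h : InpT (PiD.factored A E b) s a F) :
    ∃ F', InpT E s a F' ∧ ∀ B, F.inst B = PiD.factored A (F'.inst (B.wk _)) b := by
  unfold PiD.factored at h
  cases h with
  | res _ h =>
    generalize hc : up σ s a = c at h
    cases h with
    | parL _ h =>
      obtain ⟨F, u, rfl⟩ := h.exists_trig
      obtain ⟨d, F, rfl, v, rfl⟩ := u.exists_ren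
      cases up_inj _ _ hc
      exact ⟨F, v, fun _ => factored_input _ _ _⟩
    | parR _ h =>
      obtain ⟨rfl, rfl, -⟩ := h.of_handlerState
      exact (up_self_ne_zero _ _ hc).elim
    | head h _ => cases h
  | head h _ => cases h

theorem OutT.of_factored {b : Bool} {s : Ty} {a : ℕ} {cs : List Ty} {K : Tm [] s} {T : Proc}
    (h : OutT (PiD.factored A E b) (.nm a) cs K T) :
    ∃ cs' K' T', OutT E (.nm a) cs' K' T' ∧
      ∀ C, Struct (conc cs K T C) (PiD.factored A (conc cs' K' T' (C.wkUnder _)) b) := by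
  unfold PiD.factored at h
  cases h with
  | res _ h =>
    cases h with
    | parL _ h =>
      obtain ⟨β, K, T, e, u, rfl, rfl⟩ := h.exists_trig
      obtain ⟨γ, K, T, rfl, v, rfl, rfl⟩ := u.exists_ren
      cases γ with
      | nm c =>
        simp only [Chan.ren, Chan.close, Chan.nm.injEq] at e
        cases up_inj _ _ e
        exact ⟨_, _, _, v, fun _ => factored_output _ _ _ _ _⟩
      | vr x =>
        cases x.eq_of_singleton
        simp only [Chan.ren, Chan.close, Chan.nm.injEq] at e
        exact (up_self_ne_zero _ _ e.symm).elim
    | parR _ h => exact h.not_handlerState.elim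
    | head h _ => cases h
  | head h _ => cases h

/-- In this direction at most one step answers, since the copies of `A` in `E[A]` are already in
place. -/
theorem Factors.step_tau_right {P Q Q' : Proc} (h : Factors A P Q) (t : Step Q .tau Q') :
    ∃ P', Taus P P' ∧ Factors A P' Q' := by
  obtain ⟨E, b, hP, hQ⟩ := h
  obtain ⟨R, t, e⟩ := t.matches.struct hQ.symm (.refl _)
  rcases t.of_factored with ⟨E', t, e'⟩ | ⟨E', b', e', e''⟩
  · exact ⟨_, .single ((t.sub _).step.of_struct_left hP), E', b, .refl _, e.symm.trans e'⟩
  · exact ⟨P, .refl, E', b', hP.trans e', e.symm.trans e''⟩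

theorem Factors.step_inp_right {P Q Q' : Proc} {s : Ty} {a : ℕ} {B : Tm [] s}
    (h : Factors A P Q) (t : Step Q (.inp s a B) Q') :
    ∃ P', WStep P (.inp s a B) P' ∧ Factors A P' Q' := by
  obtain ⟨E, b, hP, hQ⟩ := h
  obtain ⟨R, t, e⟩ := t.matches.struct hQ.symm (.refl _)
  obtain ⟨F, t, e'⟩ := t.of_factored
  have t' := ((t.sub (Sub.single A)).step B).of_struct_left hP
  refine ⟨_, ⟨_, _, .refl, t', .refl⟩, F.inst (B.wk _), b, .of_eq ?_, ?_⟩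
  · rw [Tm.inst_wk_inst]
  · rw [← e']
    exact e.symm

theorem Factors.step_out_right {P Q Q' : Proc} {cs : List Ty} {s : Ty} {a : ℕ} {B : Tm [] s}
    (h : Factors A P Q) (t : Step Q (.out cs s a B) Q') :
    ∃ ds B' P', WStep P (.out ds s a B') P' ∧
      ∀ C, Factors A (conc ds B' P' C) (conc cs B Q' C) := by
  obtain ⟨E, b, hP, hQ⟩ := h
  obtain ⟨cs', K, T, t, e⟩ := t.matches.struct hQ.symm (.refl _)
  obtain ⟨ds, K', T', t, e'⟩ := t.of_factored
  obtain ⟨B', eB, t'⟩ := (t.sub (Sub.single A)).exists_step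
  refine ⟨ds, B', _, ⟨_, _, .refl, t'.of_struct_left hP, .refl⟩, fun C =>
    ⟨conc ds K' T' (C.wkUnder _), b, ?_, (e C).symm.trans (e' C)⟩⟩
  refine (conc_congr _ eB.symm (.refl _) (.refl _)).trans (.of_eq ?_)
  rw [Tm.inst_inst_eq_conc, Tm.wkUnder_sub, Sub.single_ren]
  rfl

end

theorem isContextBisim_factors {σ : Ty} (A : Tm [] (.arr σ .proc)) :
    IsContextBisim fun P Q => Factors A P Q ∨ Factors A Q P where
  symm _ _ h := h.symm
  tau _ _ _ h t := by
    rcases h with h | h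
    · obtain ⟨Q', w, h⟩ := h.step_tau_left t
      exact ⟨Q', w, .inl h⟩
    · obtain ⟨Q', w, h⟩ := h.step_tau_right t
      exact ⟨Q', w, .inr h⟩
  inp _ _ _ _ _ _ h t := by
    rcases h with h | h
    · obtain ⟨Q', w, h⟩ := h.step_inp_left t
      exact ⟨Q', w, .inl h⟩
    · obtain ⟨Q', w, h⟩ := h.step_inp_right t
      exact ⟨Q', w, .inr h⟩
  out _ _ _ _ _ _ _ h t := by
    rcases h with h | h
    · obtain ⟨ds, B, Q', w, h⟩ := h.step_out_left t
      exact ⟨ds, B, Q', w, fun C => .inl (h C)⟩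
    · obtain ⟨ds, B, Q', w, h⟩ := h.step_out_right t
      exact ⟨ds, B, Q', w, fun C => .inr (h C)⟩

/-! Factorization of abstractions, by application to closed arguments. -/

theorem Tm.app_wk_inst {Γ : List Ty} {υ ρ τ : Ty} (E : Tm (υ :: Γ) (.arr ρ τ)) (B : Tm Γ ρ)
    (K : Tm Γ υ) : (Tm.app E (B.wk υ)).inst K = .app (E.inst K) B := by
  rw [Tm.inst_app, Tm.wk_inst]

theorem Struct.beta_sub {Γ : List Ty} {ρ τ : Ty} (T : Tm (ρ :: Γ) τ) (θ : Sub Γ []) (B : Tm [] ρ) :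
    Struct (.app ((Tm.lam T).sub θ) B) (T.sub (θ.cons B)) := by
  rw [← Tm.sub_lift_inst]
  exact .beta _ _

theorem Sub.cons_up {Γ : List Ty} {ρ : Ty} (θ : Sub Γ []) (B : Tm [] ρ) (d : Ty) :
    (θ.cons B).up d = (θ.up d).cons (B.ren (PiD.up d)) := by
  funext s x
  cases x <;> rfl

/-- Each closed argument is absorbed into the context `E` on one side and into the substitution on
the other. The term `A₀` stays fixed throughout because the parameters are not free in `A`, so that
`hA` persists when `θ` is extended. -/
theorem bisimClosed_factorization {σ : Ty} (A₀ : Tm [] (.arr σ .proc)) :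
    ∀ (ρs : List Ty) {Γ : List Ty} (A : Tm Γ (.arr σ .proc)) (θ : Sub Γ [])
      (E : Tm [.arr σ .proc] (arrs ρs)) (E' : Tm (ext ρs Γ) .proc) (F G : Tm [] (arrs ρs)),
      A.sub (θ.up σ) = A₀.ren (up σ) →
      Struct ((E.ren (up σ)).inst (trig σ 0)) ((lams ρs E').sub (θ.up σ)) →
      Struct F (E.inst A₀) →
      Struct G ((lams ρs (.res σ (.par E' (handler σ 0 (wks ρs A))))).sub θ) →
      BisimClosed F G
  | [], Γ, A, θ, E, E', F, G, hA, hE, hF, hG => by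
    refine ⟨_, isContextBisim_factors A₀, .inl ⟨E, false, hF, hG.trans (.res _ (.par hE.symm ?_))⟩⟩
    refine .of_eq ((handler_sub _ _ _ _).trans ?_)
    rw [wks, hA]
    rfl
  | ρ :: ρs, Γ, A, θ, E, E', F, G, hA, hE, hF, hG => by
    intro B
    refine bisimClosed_factorization A₀ ρs (A.wk ρ) (θ.cons B) (.app E (B.wk _)) E' _ _
      ?_ ?_ ?_ ?_
    · rw [Sub.cons_up, Tm.wk_sub_cons, hA]
    · rw [Sub.cons_up]
      refine .trans ?_ (Struct.beta_sub _ _ _)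
      simp only [Tm.ren, Tm.inst_app, Tm.wk_ren, Tm.wk_inst]
      exact .app hE (.refl _)
    · exact (Struct.app hF (.refl _)).trans (.of_eq (Tm.app_wk_inst _ _ _).symm)
    · exact (Struct.app hG (.refl _)).trans (Struct.beta_sub _ _ _)

/-- Factorization, for an iterated parameterization of any length. -/
theorem bisim_factorization {Γ : List Ty} {σ : Ty} (A : Tm Γ (.arr σ .proc)) (ρs : List Ty)
    (E : Tm (.arr σ .proc :: Γ) (arrs ρs)) (E' : Tm (ext ρs Γ) .proc)
    (h : Struct ((E.ren (up σ)).inst (trig σ 0)) (lams ρs E')) :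
    Bisim (E.inst A) (lams ρs (.res σ (.par E' (handler σ 0 (wks ρs (A.ren (up σ))))))) := by
  intro θ
  refine bisimClosed_factorization (A.sub θ) ρs (A.ren (up σ)) θ (E.sub (θ.lift _)) E' _ _
    (Tm.sub_ren _ _ _).symm ?_ ?_ (.refl _)
  · refine .trans (.of_eq ?_) (h.sub (θ.up σ))
    rw [Tm.inst_sub, Tm.sub_ren, ← Sub.ren_lift]
    rfl
  · rw [Tm.inst_sub]
    exact .refl _

end PiD

/-- Factorization. The fresh name `m` is the name `0` of sort `σ` in the scope of the restriction
`(m)`, where the names of `E` and `A` are shifted by `up σ`. -/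
theorem theorem2 (Γ : List PiD.Ty) (σ : PiD.Ty)
    (A : PiD.Tm Γ (PiD.Ty.arr σ PiD.Ty.proc)) :
    (∀ E : PiD.Tm (PiD.Ty.arr σ PiD.Ty.proc :: Γ) PiD.Ty.proc,
      PiD.Bisim (E.inst A)
        (PiD.Tm.res σ (PiD.Tm.par ((E.ren (PiD.up σ)).inst (PiD.trig σ 0))
          (PiD.handler σ 0 (A.ren (PiD.up σ)))))) ∧
    (∀ (ρs : List PiD.Ty), ρs ≠ [] →
      ∀ (E : PiD.Tm (PiD.Ty.arr σ PiD.Ty.proc :: Γ) (PiD.arrs ρs))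
        (E' : PiD.Tm (PiD.ext ρs Γ) PiD.Ty.proc),
      PiD.Struct ((E.ren (PiD.up σ)).inst (PiD.trig σ 0)) (PiD.lams ρs E') →
      PiD.Bisim (E.inst A)
        (PiD.lams ρs (PiD.Tm.res σ (PiD.Tm.par E'
          (PiD.handler σ 0 (PiD.wks ρs (A.ren (PiD.up σ)))))))) :=
  -- The first part is the case without parameters, where `E'` is `E[Tr_m]` itself.
  ⟨fun E => PiD.bisim_factorization A [] E _ (.refl _),
    fun ρs _ E E' h => PiD.bisim_factorization A ρs E E' h⟩
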